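/- **Setting.** Let $\operatorname{Sym}$ be the graded algebra of real symmetric functions in countably many variables, $p_2=\sum x_i^2$, and let $\operatorname{Sym}^{\mathrm{ev}}$, $\operatorname{Sym}^{\mathrm{odd}}$ be the spans of the homogeneous elements of even, respectively odd, degree. For a partition $\lambda$ put $n(\lambda)=\sum_i(i-1)\lambda_i$, let $m_k(\lambda)$ be the number of parts equal to $k$, let $P_\lambda(;t)$ be the Hall–Littlewood function, $Q_\lambda(;t)=\prod_{k\ge1}\prod_{j=1}^{m_k(\lambda)}(1-t^j)\,P_\lambda(;t)$ and $\widetilde Q_\lambda(;t)=(-1)^{n(\lambda)}Q_\lambda(;t)$. For $t\in(-1,0)$ put $$c_m=\sqrt{\tfrac{1-t^2}{1-t^{2m}}},\quad c_\infty=\sqrt{1-t^2},\qquad \Phi_m(F)=F(c_m,c_mt,\dots,c_mt^{m-1})\ (m\ge1),\quad \Phi_\infty(F)=F(c_\infty,c_\infty t,c_\infty t^2,\dots).$$ Let $q$ be a power of an odd prime and $\bar x=x^q$ on $\mathbb F_{q^2}$. Fix one of two cases: even, with index set $I=\mathbb Z\setminus\{0\}$, or odd, with $I=\mathbb Z$.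 For $n\ge0$ let $I_n=\{i\in I:|i|\le n\}$ and $N=|I_n|$, so $N=2n$ or $N=2n+1$. A matrix $M$ over $\mathbb F_{q^2}$ indexed by $I$ or by $I_n$ is skew-Hermitian if $m_{-b,-a}=-\overline{m_{a,b}}$ for all $a,b$. Let $\mathbb L_n$ be the group of skew-Hermitian $I\times I$ matrices with $m_{ij}=0$ whenever $i\ge j$ and $\max(|i|,|j|)>n$, and $\mathbb L=\bigcup_n\mathbb L_n$, an additive group with the group topology in which the subgroups $\{M\in\mathbb L_0: m_{ij}=0 \text{ for } i,j\in I_n\}$, $n\ge1$, form a fundamental system of neighbourhoods of $0$. Let $M^{[n]}$ be the $I_n\times I_n$ block of $M$ and, for a skew-Hermitian $I_n\times I_n$ matrix $X$, let $\operatorname{Cyl}_n(X)=\{M\in\mathbb L_n:M^{[n]}=X\}$. A matrix $M\in\mathbb L$ is pronilpotent if, for some $n$, $M\in\mathbb L_n$ and $M^{[n]}$ is nilpotent. The infinite unitary group is the union over $n$ of the groups $\{h: h^*Wh=W\}$ of $I_n\times I_n$ matrices over $\mathbb F_{q^2}$, where $W_{ij}=\delta_{i,-j}$ and $h$ is extended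 by the identity; it acts on $\mathbb L$ by conjugation. Let $\mathcal P_0$ be the cone of Borel measures on $\mathbb L$ that are finite on compact sets, invariant under this action, and supported on the set of pronilpotent matrices. **Proposition.** (a) Let $t\in(-1,0)$ and let $\Phi$ be $\Phi_m$ for some $m\ge1$, or $\Phi_\infty$. Then $\Phi(p_2)=1$, and for $\bullet\in\{\mathrm{ev},\mathrm{odd}\}$: $\Phi(p_2F)=\Phi(F)$ for all $F\in\operatorname{Sym}^{\bullet}$, and $\Phi\ge0$ on the convex cone spanned by the $\widetilde Q_\lambda(;t)$ with $|\lambda|$ even (respectively odd). (b) Let $t=-q^{-1}$ and let $\Phi$ be as in (a). In each of the even and odd cases there is exactly one measure $P\in\mathcal P_0$ such that, for every $n\ge0$ and every nilpotent skew-Hermitian $I_n\times I_n$ matrix $X$ of Jordan type $\lambda$, $$P(\operatorname{Cyl}_n(X))=\frac{q^{\,n(\lambda)-N(N-1)/2}}{(1-q^{-2})^{N/2}}\;\Phi\bigl(\widetilde Q_\lambda(;-q^{-1})\bigr).$$ (c) For $\Phi=\Phi_\infty$ this measure $P$ is the restriction to the set of pronilpotent matrices of the Haar measure of $\mathbb L$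 normalized by giving mass $1$ to $\operatorname{Cyl}_0(0)$; moreover $P(\operatorname{Cyl}_n(X))=q^{-N(N-1)/2}$ for every $n\ge0$ and every nilpotent skew-Hermitian $I_n\times I_n$ matrix $X$. -/

import Mathlib

namespace PronilHL

noncomputable section Main

open MvPolynomial Finset

/-! ### Symmetric functions -/

/-- Setting the last variable equal to `0`. -/
def dropLast (n : ℕ) : MvPolynomial (Fin (n + 1)) ℝ →ₐ[ℝ] MvPolynomial (Fin n) ℝ :=
  aeval (Fin.snoc X 0 : Fin (n + 1) → MvPolynomial (Fin n) ℝ)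

theorem eval_dropLast {n : ℕ} (x : Fin n → ℝ) (f : MvPolynomial (Fin (n + 1)) ℝ) :
    eval x (dropLast n f) = eval (Fin.snoc x 0 : Fin (n + 1) → ℝ) f := by
  have : (aeval x).comp (dropLast n) = (aeval (Fin.snoc x 0 : Fin (n + 1) → ℝ)) := by
    ext i
    refine Fin.lastCases ?_ (fun i => ?_) i <;> simp [dropLast]
  have h := DFunLike.congr_fun this f
  simpa [aeval_eq_eval] using h

/-- The algebra of real symmetric functions in countably many variables, as the inverse limit of
graded algebras: an element is a sequence `f n` of symmetric polynomials in `n` variables, of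
bounded degree, such that `f (n + 1)` becomes `f n` when its last variable is set to `0`. -/
def SymFun : Subalgebra ℝ (∀ n : ℕ, MvPolynomial (Fin n) ℝ) where
  carrier := {f | (∀ n, (f n).IsSymmetric) ∧ (∀ n, dropLast n (f (n + 1)) = f n) ∧
    ∃ D, ∀ n, (f n).totalDegree ≤ D}
  mul_mem' := by
    rintro f g ⟨hf, hf', D, hD⟩ ⟨hg, hg', E, hE⟩
    exact ⟨fun n => (hf n).mul (hg n), fun n => by simp [hf', hg'], D + E,
      fun n => (totalDegree_mul _ _).trans (add_le_add (hD n) (hE n))⟩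
  add_mem' := by
    rintro f g ⟨hf, hf', D, hD⟩ ⟨hg, hg', E, hE⟩
    exact ⟨fun n => (hf n).add (hg n), fun n => by simp [hf', hg'], max D E,
      fun n => (totalDegree_add _ _).trans (max_le_max (hD n) (hE n))⟩
  algebraMap_mem' r := ⟨fun n => IsSymmetric.C r, fun n => by simp, 0,
    fun n => by simp⟩

/-- The power sum `p_k = ∑ x_i ^ k`, `k ≥ 1`. -/
def powerSum (k : ℕ) (hk : k ≠ 0) : SymFun :=
  ⟨fun n => psum (Fin n) ℝ k, fun n => psum_isSymmetric _ _ _, fun n => by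
    simp [psum, dropLast, Fin.sum_univ_castSucc, hk], k, fun n => by
    refine totalDegree_finsetSum_le fun i _ => ?_
    simp [totalDegree_X_pow]⟩

/-! ### Auxiliary facts on divisibility by the Vandermonde product -/

section
variable {n : ℕ}

/-- Substituting `x_j` for `x_i`. -/
def subst (i j : Fin n) : MvPolynomial (Fin n) ℝ →ₐ[ℝ] MvPolynomial (Fin n) ℝ :=
  aeval (fun k => if k = i then X j else X k)

theorem subst_eq_zero {i j : Fin n} {p : MvPolynomial (Fin n) ℝ} :
    subst i j p = 0 ↔ X i - X j ∣ p := by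
  constructor
  · intro h
    rw [← Ideal.mem_span_singleton, ← Ideal.Quotient.eq_zero_iff_mem]
    set I : Ideal (MvPolynomial (Fin n) ℝ) := Ideal.span {X i - X j}
    have : (Ideal.Quotient.mkₐ ℝ I).comp (subst i j) = Ideal.Quotient.mkₐ ℝ I := by
      ext k
      by_cases hk : k = i
      · subst hk
        simp only [AlgHom.comp_apply, PronilHL.subst, aeval_X, if_pos]
        exact (Ideal.Quotient.eq.2 (Ideal.mem_span_singleton_self _)).symm
      · simp [PronilHL.subst, hk]
    have h2 := DFunLike.congr_fun this p
    simp [h] at h2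
    exact h2.symm
  · rintro ⟨c, rfl⟩
    have : subst i j (X i - X j) = 0 := by simp [subst]
    rw [map_mul, this, zero_mul]

theorem prime_X_sub {i j : Fin n} (h : i ≠ j) : Prime (X i - X j : MvPolynomial (Fin n) ℝ) := by
  refine ⟨sub_ne_zero.2 fun e => h (X_injective e), fun hu => ?_, fun a b hab => ?_⟩
  · have : subst i j 1 = 0 := subst_eq_zero.2 hu.dvd
    simp at this
  · simp only [← subst_eq_zero, map_mul, mul_eq_zero] at hab ⊢
    exact hab

theorem pair_eq_of_dvd {i j k l : Fin n} (hkl : k ≠ l)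
    (h : (X i - X j : MvPolynomial (Fin n) ℝ) ∣ X k - X l) :
    (k = i ∧ l = j) ∨ (k = j ∧ l = i) := by
  rw [← subst_eq_zero] at h
  simp only [subst, map_sub, aeval_X, sub_eq_zero] at h
  split_ifs at h with h1 h2 h2 <;> have := X_injective h <;> grind

theorem prod_dvd (E : Finset (Fin n × Fin n)) (h1 : ∀ e ∈ E, e.1 ≠ e.2)
    (h2 : ∀ e ∈ E, e.swap ∉ E) (p : MvPolynomial (Fin n) ℝ)
    (hp : ∀ e ∈ E, X e.1 - X e.2 ∣ p) : ∏ e ∈ E, (X e.1 - X e.2) ∣ p := by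
  classical
  induction E using Finset.induction_on with
  | empty => simp
  | insert e E he ih =>
    obtain ⟨c, rfl⟩ := ih (fun e h => h1 e (mem_insert_of_mem h))
      (fun e h h' => h2 e (mem_insert_of_mem h) (mem_insert_of_mem h'))
      (fun e h => hp e (mem_insert_of_mem h))
    rw [prod_insert he, mul_comm]
    refine mul_dvd_mul_left _ ?_
    have hpr := prime_X_sub (h1 e (mem_insert_self _ _))
    refine (hpr.dvd_or_dvd (hp e (mem_insert_self _ _))).resolve_left fun h => ?_
    obtain ⟨e', he', hd⟩ := (hpr.dvd_finsetProd_iff _).1 h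
    rcases pair_eq_of_dvd (h1 e' (mem_insert_of_mem he')) hd with h | h
    · exact he (by rwa [← Prod.ext h.1 h.2])
    · exact h2 e (mem_insert_self _ _) (mem_insert_of_mem (by
        rwa [show e.swap = e' from Prod.ext h.1.symm h.2.symm]))

/-- The Vandermonde product. -/
def vdm (n : ℕ) : MvPolynomial (Fin n) ℝ :=
  ∏ e ∈ univ.filter (fun e : Fin n × Fin n => e.1 < e.2), (X e.1 - X e.2)

theorem X_sub_dvd_vdm {i j : Fin n} (h : i ≠ j) : (X i - X j) ∣ vdm n := by
  rcases lt_or_gt_of_ne h with h | h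
  · exact dvd_prod_of_mem (fun e : Fin n × Fin n => (X e.1 - X e.2 : MvPolynomial (Fin n) ℝ))
      (a := (i, j)) (by simpa using h)
  · rw [← neg_dvd, neg_sub]
    exact dvd_prod_of_mem (fun e : Fin n × Fin n => (X e.1 - X e.2 : MvPolynomial (Fin n) ℝ))
      (a := (j, i)) (by simpa using h)

theorem eval_vdm_ne {x : Fin n → ℝ} (hx : Function.Injective x) : eval x (vdm n) ≠ 0 := by
  simp only [vdm, map_prod, map_sub, eval_X, prod_ne_zero_iff, mem_filter, sub_ne_zero]
  exact fun e he h => he.2.ne (hx h)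

theorem eval_vdm_eq {x : Fin n → ℝ} (hx : ¬ Function.Injective x) : eval x (vdm n) = 0 := by
  simp only [Function.Injective, not_forall] at hx
  obtain ⟨i, j, hij, hne⟩ := hx
  obtain ⟨c, hc⟩ := X_sub_dvd_vdm hne
  simp [hc, hij]

theorem vdm_ne : vdm n ≠ 0 := fun h => by
  have := eval_vdm_ne (n := n) (x := fun i => (i : ℝ)) (fun i j h => by
    simpa [Fin.ext_iff] using h)
  simp [h] at this

theorem ext_inj {p r : MvPolynomial (Fin n) ℝ}
    (h : ∀ x : Fin n → ℝ, Function.Injective x → eval x p = eval x r) : p = r := by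
  have : p * vdm n = r * vdm n := by
    refine MvPolynomial.funext fun x => ?_
    by_cases hx : Function.Injective x
    · simp [h x hx]
    · simp [eval_vdm_eq hx]
  exact mul_right_cancel₀ vdm_ne this


theorem eval_vdm_swap (x : Fin n → ℝ) (σ : Equiv.Perm (Fin n)) :
    eval (x ∘ σ) (vdm n) = ((Equiv.Perm.sign σ : ℤˣ) : ℤ) * eval x (vdm n) := by
  have key : ∀ y : Fin n → ℝ, eval y (vdm n) = ∏ j, ∏ i ∈ Iio j, (y i - y j) := fun y => by
    simp only [vdm, map_prod, map_sub, eval_X]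
    rw [prod_filter, Fintype.prod_prod_type_right]
    refine prod_congr rfl fun j _ => ?_
    rw [← prod_filter]
    congr 1
    ext; simp
  rw [key, key]
  simpa using σ.prod_Iio_comp_eq_sign_mul_prod (f := fun i j => x i - x j) (by intros; ring)

theorem exists_of_alternating (T : MvPolynomial (Fin n) ℝ) (S : (Fin n → ℝ) → ℝ)
    (hS : ∀ (x : Fin n → ℝ) (σ : Equiv.Perm (Fin n)), S (x ∘ σ) = S x)
    (hT : ∀ x : Fin n → ℝ, Function.Injective x → eval x T = eval x (vdm n) * S x) :
    ∃ G : MvPolynomial (Fin n) ℝ, T = vdm n * G ∧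
      ∀ x : Fin n → ℝ, Function.Injective x → eval x G = S x := by
  have hd : vdm n ∣ T := by
    refine prod_dvd _ (fun e he => (mem_filter.1 he).2.ne)
      (fun e he he' => lt_asymm (mem_filter.1 he).2 (mem_filter.1 he').2) _ fun e he => ?_
    have hne : e.1 ≠ e.2 := (mem_filter.1 he).2.ne
    have h1 : rename (Equiv.swap e.1 e.2) T = - T := by
      refine ext_inj fun x hx => ?_
      have h2 := hT (x ∘ Equiv.swap e.1 e.2) (hx.comp (Equiv.injective _))
      rw [eval_rename, h2, hS, eval_vdm_swap, Equiv.Perm.sign_swap hne, map_neg, hT x hx]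
      simp
    have h3 : subst e.1 e.2 (rename (Equiv.swap e.1 e.2) T) = subst e.1 e.2 T := by
      rw [subst, aeval_rename]
      congr 2
      funext k
      by_cases h1 : k = e.1
      · subst h1; simp [hne.symm]
      · by_cases h2 : k = e.2
        · subst h2; simp [hne.symm]
        · simp [Equiv.swap_apply_of_ne_of_ne h1 h2]
    rw [← subst_eq_zero]
    rw [h1, map_neg] at h3
    exact self_eq_neg.1 h3.symm
  obtain ⟨G, rfl⟩ := hd
  refine ⟨G, rfl, fun x hx => ?_⟩
  have := hT x hx
  rw [map_mul] at this
  exact mul_left_cancel₀ (eval_vdm_ne hx) this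

theorem totalDegree_prod_X_sub (E : Finset (Fin n × Fin n)) (h1 : ∀ e ∈ E, e.1 ≠ e.2) :
    (∏ e ∈ E, (X e.1 - X e.2 : MvPolynomial (Fin n) ℝ)).totalDegree = #E := by
  classical
  induction E using Finset.induction_on with
  | empty => simp
  | insert e E he ih =>
    have h2 : ∀ e' ∈ insert e E, (X e'.1 - X e'.2 : MvPolynomial (Fin n) ℝ) ≠ 0 :=
      fun e' h => (prime_X_sub (h1 e' h)).ne_zero
    rw [prod_insert he, totalDegree_mul_of_isDomain (h2 e (mem_insert_self _ _))
      (prod_ne_zero_iff.2 fun e' h => h2 e' (mem_insert_of_mem h)),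
      ih fun e' h => h1 e' (mem_insert_of_mem h), card_insert_of_notMem he, add_comm]
    congr 1
    refine le_antisymm ((totalDegree_sub _ _).trans (by simp)) ?_
    rw [Nat.one_le_iff_ne_zero, Ne, totalDegree_eq_zero_iff_eq_C]
    intro h
    have hp := prime_X_sub (h1 e (mem_insert_self _ _))
    rw [h] at hp
    have h0 : coeff 0 (X e.1 - X e.2 : MvPolynomial (Fin n) ℝ) = 0 := by simp
    rw [h0] at hp
    simp at hp

end

/-! ### Hall-Littlewood functions -/

/-- `m_k(μ)`: the number of rows of `μ` of length `k`. -/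
def mult (μ : YoungDiagram) (k : ℕ) : ℕ := μ.rowLens.count k

open Classical in
/-- The orbit of the exponent vector `(μ₁, …, μ_n)` under permutations: the vectors
`α : Fin n → ℕ` in which each `k ≥ 1` occurs `m_k(μ)` times (none if `μ` has more than `n` rows). -/
def rearrangements (μ : YoungDiagram) (n : ℕ) : Finset (Fin n → ℕ) :=
  {α ∈ Fintype.piFinset fun _ : Fin n => Finset.range (μ.card + 1) |
    ∀ k, 0 < k → #{i | α i = k} = mult μ k}

theorem mem_rearrangements {μ : YoungDiagram} {n : ℕ} {α : Fin n → ℕ} :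
    α ∈ rearrangements μ n ↔
      (∀ i, α i ≤ μ.card) ∧ ∀ k, 0 < k → #{i | α i = k} = mult μ k := by
  simp [rearrangements]

/-- The value at a point with distinct coordinates of the Hall-Littlewood polynomial
`P_μ(x₁, …, x_n; t) = ∑_{w ∈ S_n / S_n^μ} w (x ^ μ ∏_{μ_i > μ_j} (x_i - t x_j) / (x_i - x_j))`.
The cosets `w` correspond to the rearrangements `α = w μ` of `μ`. -/
def hlSum (t : ℝ) (μ : YoungDiagram) (n : ℕ) (x : Fin n → ℝ) : ℝ :=
  ∑ α ∈ rearrangements μ n, (∏ i, x i ^ α i) *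
    ∏ e : Fin n × Fin n with α e.2 < α e.1, (x e.1 - t * x e.2) / (x e.1 - x e.2)

theorem comp_mem_rearrangements {μ : YoungDiagram} {n : ℕ} {α : Fin n → ℕ}
    (σ : Equiv.Perm (Fin n)) (h : α ∈ rearrangements μ n) : α ∘ σ ∈ rearrangements μ n := by
  rw [mem_rearrangements] at h ⊢
  refine ⟨fun i => h.1 _, fun k hk => ?_⟩
  rw [← h.2 k hk]
  exact card_equiv σ (by simp)

theorem hlSum_comp (t : ℝ) (μ : YoungDiagram) (n : ℕ) (x : Fin n → ℝ) (σ : Equiv.Perm (Fin n)) :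
    hlSum t μ n (x ∘ σ) = hlSum t μ n x := by
  refine sum_bij' (fun α _ => α ∘ σ.symm) (fun α _ => α ∘ σ)
    (fun α h => comp_mem_rearrangements _ h) (fun α h => comp_mem_rearrangements _ h)
    (fun α _ => by funext; simp) (fun α _ => by funext; simp) fun α _ => ?_
  congr 1
  · exact Fintype.prod_equiv σ _ _ (by simp)
  · exact prod_bij' (fun e _ => (σ e.1, σ e.2)) (fun e _ => (σ.symm e.1, σ.symm e.2))
      (by simp) (by simp) (by simp) (by simp) (by simp)

theorem sum_eq_of_mem {μ : YoungDiagram} {n : ℕ} {α : Fin n → ℕ}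
    (h : α ∈ rearrangements μ n) : ∑ i, α i = ∑ k ∈ range (μ.card + 1), mult μ k * k := by
  rw [mem_rearrangements] at h
  rw [← sum_fiberwise_of_maps_to (s := univ) (t := range (μ.card + 1)) (g := α)
    (fun i _ => by simpa [Nat.lt_succ_iff] using h.1 i)]
  refine sum_congr rfl fun k _ => ?_
  rw [sum_congr rfl (g := fun _ => k) (by simp), sum_const, smul_eq_mul]
  rcases Nat.eq_zero_or_pos k with rfl | hk
  · simp
  · rw [h.2 k hk]

theorem exists_hlPoly (t : ℝ) (μ : YoungDiagram) (n : ℕ) :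
    ∃ G : MvPolynomial (Fin n) ℝ,
      G.totalDegree ≤ ∑ k ∈ range (μ.card + 1), mult μ k * k ∧
      ∀ x : Fin n → ℝ, Function.Injective x → eval x G = hlSum t μ n x := by
  let E : (Fin n → ℕ) → Finset (Fin n × Fin n) := fun α => {e | α e.2 < α e.1}
  have hE1 : ∀ α, ∀ e ∈ E α, e.1 ≠ e.2 := fun α e he h => by simp [E, h] at he
  have hE2 : ∀ α, ∀ e ∈ E α, e.swap ∉ E α := fun α e he h => by
    simp only [E, mem_filter, mem_univ, true_and, Prod.fst_swap, Prod.snd_swap] at he h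
    omega
  have hc : ∀ α, ∃ c, vdm n = (∏ e ∈ E α, (X e.1 - X e.2)) * c := fun α =>
    prod_dvd _ (hE1 α) (hE2 α) _ fun e he => X_sub_dvd_vdm (hE1 α e he)
  choose c hc using hc
  let term : (Fin n → ℕ) → MvPolynomial (Fin n) ℝ := fun α =>
    (∏ i, X i ^ α i) * (∏ e ∈ E α, (X e.1 - C t * X e.2)) * c α
  obtain ⟨G, hG, hG'⟩ := exists_of_alternating (∑ α ∈ rearrangements μ n, term α)
    (hlSum t μ n) (hlSum_comp t μ n) (fun x hx => by
      rw [map_sum, hlSum, mul_sum]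
      refine sum_congr rfl fun α _ => ?_
      have h1 := congrArg (eval x) (hc α)
      have h2 : ∏ e ∈ E α, (x e.1 - x e.2) ≠ 0 :=
        prod_ne_zero_iff.2 fun e he => sub_ne_zero.2 fun h => hE1 α e he (hx h)
      simp only [map_mul, map_prod, map_sub, eval_X] at h1
      rw [h1, prod_div_distrib]
      simp only [term, map_mul, map_prod, map_sub, eval_X, map_pow, eval_C]
      change _ * (∏ e ∈ E α, _) * _ = _ * (_ * ((∏ e ∈ E α, _) / (∏ e ∈ E α, _)))
      field_simp)
  refine ⟨G, ?_, hG'⟩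
  by_cases hG0 : G = 0
  · simp [hG0]
  have hdeg : (∑ α ∈ rearrangements μ n, term α).totalDegree ≤
      (vdm n).totalDegree + ∑ k ∈ range (μ.card + 1), mult μ k * k := by
    refine totalDegree_finsetSum_le fun α hα => ?_
    have h0 : (∏ e ∈ E α, (X e.1 - X e.2)) * c α ≠ 0 := hc α ▸ vdm_ne
    have h1 : (vdm n).totalDegree = #(E α) + (c α).totalDegree := by
      rw [hc α, totalDegree_mul_of_isDomain (left_ne_zero_of_mul h0) (right_ne_zero_of_mul h0),
        totalDegree_prod_X_sub _ (hE1 α)]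
    have h2 : (∏ i, X i ^ α i : MvPolynomial (Fin n) ℝ).totalDegree ≤ ∑ i, α i :=
      (totalDegree_finsetProd _ _).trans (by simp [totalDegree_X_pow])
    have h3 : (∏ e ∈ E α, (X e.1 - C t * X e.2) : MvPolynomial (Fin n) ℝ).totalDegree
        ≤ #(E α) := by
      refine (totalDegree_finsetProd _ _).trans ?_
      rw [card_eq_sum_ones]
      refine sum_le_sum fun e _ => (totalDegree_sub _ _).trans (max_le (by simp) ?_)
      exact (totalDegree_mul _ _).trans (by simp)
    rw [sum_eq_of_mem hα] at h2
    have h4 := totalDegree_mul ((∏ i, X i ^ α i) * (∏ e ∈ E α, (X e.1 - C t * X e.2))) (c α)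
    have h5 := totalDegree_mul (∏ i, X i ^ α i) (∏ e ∈ E α, (X e.1 - C t * X e.2))
    simp only [term]
    omega
  rw [hG, totalDegree_mul_of_isDomain vdm_ne hG0] at hdeg
  omega

theorem hlSum_snoc (t : ℝ) (μ : YoungDiagram) (n : ℕ) (x : Fin n → ℝ) (hx : ∀ i, x i ≠ 0) :
    hlSum t μ (n + 1) (Fin.snoc x 0 : Fin (n + 1) → ℝ) = hlSum t μ n x := by
  classical
  symm
  refine sum_of_injOn (fun α : Fin n → ℕ => (Fin.snoc α 0 : Fin (n + 1) → ℕ))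
    (fun α _ β _ h => (Fin.snoc_injective2 h).1) ?_ ?_ ?_
  · intro α h
    simp only [mem_coe, mem_rearrangements] at h ⊢
    refine ⟨fun i => Fin.lastCases (by simp) (fun i => by simpa using h.1 i) i, fun k hk => ?_⟩
    rw [← h.2 k hk, card_filter, card_filter, Fin.sum_univ_castSucc]
    simp [hk.ne]
  · intro α h h'
    rw [prod_eq_zero (mem_univ (Fin.last n)), zero_mul]
    simp only [Fin.snoc_last]
    refine zero_pow fun h0 => h' ⟨fun i => α i.castSucc, ?_, ?_⟩
    · rw [mem_rearrangements] at h
      rw [mem_coe, mem_rearrangements]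
      refine ⟨fun i => h.1 _, fun k hk => ?_⟩
      rw [← h.2 k hk, card_filter, card_filter, Fin.sum_univ_castSucc]
      simp [h0, hk.ne]
    · funext i
      refine Fin.lastCases (by simp [h0]) (fun i => by simp) i
  · intro α _
    congr 1
    · simp [Fin.prod_univ_castSucc]
    · rw [prod_filter, prod_filter, Fintype.prod_prod_type, Fintype.prod_prod_type]
      simp only [Fin.prod_univ_castSucc, Fin.snoc_castSucc, Fin.snoc_last, not_lt_zero, if_false,
        prod_const_one, mul_one, mul_zero, sub_zero]
      refine prod_congr rfl fun i _ => ?_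
      simp [hx i]

theorem exists_hallLittlewood (t : ℝ) (μ : YoungDiagram) :
    ∃ F : SymFun, ∀ (n : ℕ) (x : Fin n → ℝ), Function.Injective x →
      eval x (F.1 n) = hlSum t μ n x := by
  choose G hG1 hG2 using exists_hlPoly t μ
  refine ⟨⟨G, fun n σ => ext_inj fun x hx => ?_, fun n => ?_, _, hG1⟩, hG2⟩
  · rw [eval_rename, hG2 _ _ (hx.comp σ.injective), hG2 _ _ hx, hlSum_comp]
  · have : dropLast n (G (n + 1)) * ∏ i, X i = G n * ∏ i, X i := by
      refine ext_inj fun x hx => ?_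
      by_cases h0 : ∀ i, x i ≠ 0
      · rw [map_mul, map_mul, eval_dropLast, hG2, hG2 _ _ hx, hlSum_snoc _ _ _ _ h0]
        rw [Fin.snoc_injective_iff]
        exact ⟨hx, by simpa using h0⟩
      · push Not at h0
        obtain ⟨i, hi⟩ := h0
        simp [prod_eq_zero (mem_univ i) hi]
    exact mul_right_cancel₀ (prod_ne_zero_iff.2 fun i _ => X_ne_zero i) this

/-- The Hall-Littlewood symmetric function `P_μ(; t)`: the (unique) symmetric function whose value
at every finite tuple of distinct reals is given by `hlSum`. -/
def hallLittlewoodP (t : ℝ) (μ : YoungDiagram) : SymFun := (exists_hallLittlewood t μ).choose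

theorem eval_hallLittlewoodP (t : ℝ) (μ : YoungDiagram) {n : ℕ} (x : Fin n → ℝ)
    (hx : Function.Injective x) : eval x ((hallLittlewoodP t μ).1 n) = hlSum t μ n x :=
  (exists_hallLittlewood t μ).choose_spec n x hx

/-- `b_μ(t) = ∏_{k ≥ 1} ∏_{1 ≤ j ≤ m_k(μ)} (1 - t ^ j)`. -/
def hlB (t : ℝ) (μ : YoungDiagram) : ℝ :=
  ∏ k ∈ Icc 1 μ.card, ∏ j ∈ Icc 1 (mult μ k), (1 - t ^ j)

/-- `Q_μ(; t) = b_μ(t) P_μ(; t)`. -/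
def hallLittlewoodQ (t : ℝ) (μ : YoungDiagram) : SymFun := hlB t μ • hallLittlewoodP t μ

/-- `n(μ) = ∑_{i ≥ 1} (i - 1) μ_i`, the sum over the boxes of their (zero-based) row number. -/
def nStat (μ : YoungDiagram) : ℕ := ∑ c ∈ μ.cells, c.1

/-- `Q̃_μ(; t) = (-1) ^ n(μ) Q_μ(; t)`. -/
def signedQ (t : ℝ) (μ : YoungDiagram) : SymFun := (-1 : ℝ) ^ nStat μ • hallLittlewoodQ t μ

/-! ### Specializations -/

theorem eval_comp_perm (F : SymFun) {n : ℕ} (x : Fin n → ℝ) (σ : Equiv.Perm (Fin n)) :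
    eval (x ∘ σ) (F.1 n) = eval x (F.1 n) := by
  rw [← eval_rename, F.2.1 n σ]

theorem eval_snoc_zero (F : SymFun) {n : ℕ} (x : Fin n → ℝ) :
    eval (Fin.snoc x 0 : Fin (n + 1) → ℝ) (F.1 (n + 1)) = eval x (F.1 n) := by
  rw [← eval_dropLast, F.2.2.1 n]

theorem eval_snoc (F : SymFun) {n : ℕ} (x : Fin n → ℝ) (z : ℝ) :
    eval (Fin.snoc x z : Fin (n + 1) → ℝ) (F.1 (n + 1)) =
      Polynomial.eval z (((finSuccEquiv ℝ n) (F.1 (n + 1))).map (eval x)) := by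
  rw [← eval_eq_eval_mv_eval', Fin.snoc_eq_cons_rotate]
  exact eval_comp_perm F (Fin.cons z x : Fin (n + 1) → ℝ) (finRotate _)

/-- Coefficient of `z ^ k` in `F(z, x₁, x₂, …)`, again a symmetric function. -/
def symCoeff (F : SymFun) (k : ℕ) : SymFun :=
  ⟨fun n => ((finSuccEquiv ℝ n) (F.1 (n + 1))).coeff k, by
    refine ⟨fun n σ => MvPolynomial.funext fun x => ?_, fun n => MvPolynomial.funext fun x => ?_,
      ?_⟩
    · rw [eval_rename, ← Polynomial.coeff_map, ← Polynomial.coeff_map]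
      congr 1
      refine Polynomial.funext fun z => ?_
      rw [← eval_snoc, ← eval_snoc]
      have : (Fin.snoc (x ∘ σ) z : Fin (n + 1) → ℝ) =
          (Fin.snoc x z : Fin (n + 1) → ℝ) ∘ (finSuccEquivLast.permCongr.symm σ.optionCongr) := by
        funext i
        refine Fin.lastCases ?_ (fun i => ?_) i <;> simp
      rw [this, eval_comp_perm]
    · rw [eval_dropLast, ← Polynomial.coeff_map, ← Polynomial.coeff_map]
      congr 1
      refine Polynomial.funext fun z => ?_
      rw [← eval_eq_eval_mv_eval', ← eval_eq_eval_mv_eval', Fin.cons_snoc_eq_snoc_cons,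
        eval_snoc_zero]
    · obtain ⟨D, hD⟩ := F.2.2.2
      refine ⟨D, fun n => ?_⟩
      by_cases h : ((finSuccEquiv ℝ n) (F.1 (n + 1))).coeff k = 0
      · simp [h]
      · have := totalDegree_coeff_finSuccEquiv_add_le _ _ h
        have := hD (n + 1)
        dsimp only
        omega⟩

theorem totalDegree_symCoeff {F : SymFun} {D : ℕ} (hD : ∀ n, (F.1 n).totalDegree ≤ D) {k : ℕ}
    (n : ℕ) : ((symCoeff F k).1 n).totalDegree ≤ D - k := by
  change (((finSuccEquiv ℝ n) (F.1 (n + 1))).coeff k).totalDegree ≤ D - k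
  by_cases h : ((finSuccEquiv ℝ n) (F.1 (n + 1))).coeff k = 0
  · simp [h]
  · have := totalDegree_coeff_finSuccEquiv_add_le _ _ h
    have := hD (n + 1)
    omega

theorem eval_snoc_eq_sum {F : SymFun} {D : ℕ} (hD : ∀ n, (F.1 n).totalDegree ≤ D) {n : ℕ}
    (x : Fin n → ℝ) (z : ℝ) :
    eval (Fin.snoc x z : Fin (n + 1) → ℝ) (F.1 (n + 1)) =
      eval x (F.1 n) + ∑ k ∈ range D, z ^ (k + 1) * eval x ((symCoeff F (k + 1)).1 n) := by
  have h : ∀ z, eval (Fin.snoc x z : Fin (n + 1) → ℝ) (F.1 (n + 1)) =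
      ∑ k ∈ range (D + 1), z ^ k * eval x ((symCoeff F k).1 n) := fun z => by
    rw [eval_snoc, Polynomial.eval_eq_sum_range' (n := D + 1)]
    · refine sum_congr rfl fun k _ => ?_
      rw [Polynomial.coeff_map, mul_comm]
      rfl
    · rw [Nat.lt_succ_iff]
      refine Polynomial.natDegree_map_le.trans ?_
      refine Polynomial.natDegree_le_iff_coeff_eq_zero.2 fun k hk => ?_
      by_contra h
      have := totalDegree_coeff_finSuccEquiv_add_le _ _ h
      have := hD (n + 1)
      omega
  have h0 := h 0
  rw [eval_snoc_zero, sum_range_succ'] at h0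
  rw [h z, sum_range_succ', h0]
  simp [add_comm]

theorem exists_tendsto_specialization {x : ℕ → ℝ} (hx : Summable fun i => |x i|) (F : SymFun) :
    ∃ l, Filter.Tendsto (fun n => eval (fun i : Fin n => x i) (F.1 n)) Filter.atTop (nhds l) := by
  obtain ⟨D, hD⟩ := F.2.2.2
  induction D using Nat.strong_induction_on generalizing F with
  | _ D ih =>
  have hb : ∀ k, ∃ C, ∀ n, |eval (fun i : Fin n => x i) ((symCoeff F (k + 1)).1 n)| ≤ C ∨ D ≤ k := by
    intro k
    by_cases hk : D ≤ k
    · exact ⟨0, fun n => Or.inr hk⟩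
    obtain ⟨l, hl⟩ := ih (D - (k + 1)) (by omega) (symCoeff F (k + 1)) (totalDegree_symCoeff hD)
    obtain ⟨C, hC⟩ := (Metric.isBounded_range_of_tendsto _ hl).exists_norm_le
    exact ⟨C, fun n => Or.inl (hC _ ⟨n, rfl⟩)⟩
  choose C hC using hb
  have hs : Summable fun n => ∑ k ∈ range D, |x n| ^ (k + 1) * C k := by
    refine summable_sum fun k _ => Summable.mul_right _ ?_
    have h1 := hx.tendsto_atTop_zero.eventually (ge_mem_nhds zero_lt_one)
    refine Summable.of_norm_bounded_eventually_nat (g := fun n => |x n|) hx ?_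
    filter_upwards [h1] with n hn
    rw [Real.norm_of_nonneg (by positivity)]
    exact pow_le_of_le_one (abs_nonneg _) hn (by omega)
  refine cauchySeq_tendsto_of_complete (cauchySeq_of_dist_le_of_summable _ (fun n => ?_) hs)
  have hsn : (fun i : Fin (n + 1) => x i) = (Fin.snoc (fun i : Fin n => x i) (x n)) := by
    funext i
    refine Fin.lastCases ?_ (fun i => ?_) i <;> simp
  rw [dist_comm, Real.dist_eq, Nat.succ_eq_add_one, hsn, eval_snoc_eq_sum hD, add_sub_cancel_left]
  refine (abs_sum_le_sum_abs _ _).trans (sum_le_sum fun k hk => ?_)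
  rw [abs_mul, abs_pow]
  refine mul_le_mul_of_nonneg_left ((hC k n).resolve_right ?_) (by positivity)
  simpa using hk

/-- The specialization `F ↦ F(x₀, x₁, x₂, …) = lim_n F(x₀, …, x_{n-1})` at an absolutely summable
sequence. -/
def specialization (x : ℕ → ℝ) (hx : Summable fun i => |x i|) : SymFun →ₐ[ℝ] ℝ where
  toFun F := (exists_tendsto_specialization hx F).choose
  map_one' := tendsto_nhds_unique (exists_tendsto_specialization hx 1).choose_spec (by simp)
  map_zero' := tendsto_nhds_unique (exists_tendsto_specialization hx 0).choose_spec (by simp)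
  map_mul' F G := tendsto_nhds_unique (exists_tendsto_specialization hx _).choose_spec (by
    simpa using (exists_tendsto_specialization hx F).choose_spec.mul
      (exists_tendsto_specialization hx G).choose_spec)
  map_add' F G := tendsto_nhds_unique (exists_tendsto_specialization hx _).choose_spec (by
    simpa using (exists_tendsto_specialization hx F).choose_spec.add
      (exists_tendsto_specialization hx G).choose_spec)
  commutes' r := tendsto_nhds_unique (exists_tendsto_specialization hx _).choose_spec (by simp)


theorem tendsto_specialization {x : ℕ → ℝ} (hx : Summable fun i => |x i|) (F : SymFun) :
    Filter.Tendsto (fun n => eval (fun i : Fin n => x i) (F.1 n)) Filter.atTop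
      (nhds (specialization x hx F)) :=
  (exists_tendsto_specialization hx F).choose_spec

/-- The specialization `F ↦ F(x₁, …, x_m)` at finitely many values. -/
def finSpecialization {m : ℕ} (x : Fin m → ℝ) : SymFun →ₐ[ℝ] ℝ :=
  (aeval x).comp ((Pi.evalAlgHom ℝ (fun n : ℕ => MvPolynomial (Fin n) ℝ) m).comp SymFun.val)

/-- `Φ_m(F) = F(c_m, c_m t, …, c_m t ^ (m - 1))` with `c_m = √((1 - t ^ 2) / (1 - t ^ (2 m)))`. -/
def Phi (t : ℝ) (m : ℕ) : SymFun →ₐ[ℝ] ℝ :=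
  finSpecialization fun i : Fin m => √((1 - t ^ 2) / (1 - t ^ (2 * m))) * t ^ (i : ℕ)

theorem summable_principal {t : ℝ} (ht : t ∈ Set.Ioo (-1) 0) (c : ℝ) :
    Summable fun i : ℕ => |c * t ^ i| := by
  simp_rw [abs_mul, abs_pow]
  exact (summable_geometric_of_lt_one (abs_nonneg t)
    (abs_lt.2 ⟨ht.1, ht.2.trans one_pos⟩)).mul_left _

/-- `Φ_∞(F) = F(c_∞, c_∞ t, c_∞ t ^ 2, …)` with `c_∞ = √(1 - t ^ 2)`. -/
def PhiInf (t : ℝ) (ht : t ∈ Set.Ioo (-1) 0) : SymFun →ₐ[ℝ] ℝ :=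
  specialization (fun i => √(1 - t ^ 2) * t ^ i) (summable_principal ht _)

/-! ### Harmonicity and positivity -/

/-- Selects the even or the odd variant of the theory. -/
inductive Parity
  | even
  | odd

/-- The residue modulo `2`. -/
def Parity.toNat : Parity → ℕ
  | .even => 0
  | .odd => 1

/-- The span of the homogeneous symmetric functions of degree of the given parity. -/
def symPart (p : Parity) : Submodule ℝ SymFun :=
  Submodule.span ℝ {F | ∃ k, k % 2 = p.toNat ∧ ∀ n, (F.1 n).IsHomogeneous k}

/-- The convex cone spanned by the functions `Q̃_μ(; t)` with `|μ|` of the given parity. -/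
def hlCone (p : Parity) (t : ℝ) : PointedCone ℝ SymFun :=
  PointedCone.hull ℝ {F | ∃ μ : YoungDiagram, μ.card % 2 = p.toNat ∧ F = signedQ t μ}

/-- `Φ(p₂ F) = Φ(F)` for all `F` of the given parity. -/
def IsP2Harmonic (p : Parity) (Φ : SymFun →ₗ[ℝ] ℝ) : Prop :=
  ∀ F ∈ symPart p, Φ (powerSum 2 two_ne_zero * F) = Φ F

/-- `Φ` is nonnegative on the cone spanned by the `Q̃_μ(; t)` of the given parity. -/
def IsHLPositive (p : Parity) (t : ℝ) (Φ : SymFun →ₗ[ℝ] ℝ) : Prop :=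
  ∀ F ∈ hlCone p t, 0 ≤ Φ F

/-! ### Skew-Hermitian matrices, finite and infinite -/

/-- Indices of two-sided infinite matrices: `ℤ ∖ {0}` in the even case, `ℤ` in the odd case. -/
abbrev Index (p : Parity) : Type := {i : ℤ // p = .odd ∨ i ≠ 0}

instance (p : Parity) : Neg (Index p) := ⟨fun i => ⟨-i.1, i.2.imp_right neg_ne_zero.2⟩⟩

/-- Indices of the central block: `{-n, …, n}`, without `0` in the even case. -/
abbrev Block (p : Parity) (n : ℕ) : Type := {i : Index p // |i.1| ≤ (n : ℤ)}

instance (p : Parity) (n : ℕ) : Neg (Block p n) := ⟨fun i => ⟨-i.1, (abs_neg i.1.1).trans_le i.2⟩⟩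

instance (p : Parity) (n : ℕ) : Fintype (Block p n) :=
  Fintype.ofInjective (β := Set.Icc (-(n : ℤ)) n) (fun i => ⟨i.1.1, abs_le.1 i.2⟩)
    fun _ _ h => Subtype.ext (Subtype.ext (congrArg (fun z => z.1) h))

/-- The size `N = 2 n` or `N = 2 n + 1` of the central block. -/
def dim (p : Parity) (n : ℕ) : ℕ := 2 * n + p.toNat

universe u v

variable (F : Type u) [Field F] [Fintype F] {K : Type v} [Field K] [Algebra F K]

/-- The Frobenius map `x ↦ x ^ q`, where `q` is the cardinality of `F`. -/
def frob (x : K) : K := FiniteField.frobeniusAlgHom F K x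

/-- Skew-Hermitian matrices with respect to the form `τ(e_r, e_s) = δ_{r, -s}`. -/
def IsSkewHermitian {ι : Type} [Neg ι] (A : Matrix ι ι K) : Prop :=
  ∀ a b, A (-b) (-a) = -frob F (A a b)

/-- The matrix with `1`'s on the secondary diagonal and `0`'s elsewhere. -/
def antiDiag (K : Type v) [Field K] (p : Parity) (n : ℕ) : Matrix (Block p n) (Block p n) K :=
  Matrix.of fun i j => if i = -j then 1 else 0

/-- The unitary group of the form `τ(x, y) = y^* W x`: `h^* W h = W`. -/
def IsUnitary {p : Parity} {n : ℕ} (h : Matrix (Block p n) (Block p n) K) : Prop :=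
  (h.map (frob F)).transpose * antiDiag K p n * h = antiDiag K p n

/-- The infinite matrix that is `h` on the central block and the identity elsewhere. -/
def extend {p : Parity} {n : ℕ} (h : Matrix (Block p n) (Block p n) K) :
    Matrix (Index p) (Index p) K :=
  Matrix.of fun i j => if hij : |i.1| ≤ (n : ℤ) ∧ |j.1| ≤ (n : ℤ) then h ⟨i, hij.1⟩ ⟨j, hij.2⟩
    else if i = j then 1 else 0

/-- The conjugate `g M g⁻¹` of an infinite matrix `M` by the infinite matrix `g` extending the
invertible matrix `h`; the sums have finitely many nonzero terms. -/
def conjBy {p : Parity} {n : ℕ} (h : Matrix (Block p n) (Block p n) K)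
    (M : Matrix (Index p) (Index p) K) : Matrix (Index p) (Index p) K :=
  Matrix.of fun i j => ∑ᶠ k, ∑ᶠ l, extend h i k * M k l * extend h⁻¹ l j

/-- `m_{ij} = 0` whenever `i ≥ j` and `max (|i|, |j|) > n`. -/
def HasLevel {p : Parity} (n : ℕ) (M : Matrix (Index p) (Index p) K) : Prop :=
  ∀ i j, j ≤ i → (n : ℤ) < max |i.1| |j.1| → M i j = 0

/-- The central block `M^{[n]}`. -/
def corner {p : Parity} (n : ℕ) (M : Matrix (Index p) (Index p) K) :
    Matrix (Block p n) (Block p n) K :=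
  M.submatrix Subtype.val Subtype.val

variable (K)

/-- The additive group `𝕃` of almost strictly upper triangular skew-Hermitian matrices. -/
def almostUpper (p : Parity) : AddSubgroup (Matrix (Index p) (Index p) K) where
  carrier := {M | IsSkewHermitian F M ∧ ∃ n, HasLevel n M}
  zero_mem' := ⟨fun a b => by simp [frob], 0, fun i j _ _ => rfl⟩
  add_mem' := by
    rintro A B ⟨hA, n, hn⟩ ⟨hB, m, hm⟩
    refine ⟨fun a b => ?_, max n m, fun i j hij h => ?_⟩
    · rw [Matrix.add_apply, hA a b, hB a b, Matrix.add_apply, frob, frob, frob, map_add, neg_add]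
    · rw [Nat.cast_max, max_lt_iff] at h
      simp [hn i j hij h.1, hm i j hij h.2]
  neg_mem' := by
    rintro A ⟨hA, n, hn⟩
    refine ⟨fun a b => ?_, n, fun i j hij h => by simp [hn i j hij h]⟩
    rw [Matrix.neg_apply, hA a b, Matrix.neg_apply, frob, frob, map_neg]

/-- The space `𝕃`, as a type. -/
abbrev LSpace (p : Parity) : Type v := almostUpper F K p

variable {K}

/-- The subgroup `𝕃_{-n}` (for `n ≥ 1`): strictly upper triangular, with vanishing central block. -/
def IsSmall {p : Parity} (n : ℕ) (M : LSpace F K p) : Prop :=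
  HasLevel 0 M.1 ∧ corner n M.1 = 0

/-- The topology on `𝕃` in which the cosets of the subgroups `𝕃_{-n}`, `n ≥ 1`, through a point form
a fundamental system of neighbourhoods of the point. -/
instance (p : Parity) : TopologicalSpace (LSpace F K p) where
  IsOpen U := ∀ M ∈ U, ∃ n, 1 ≤ n ∧ ∀ D, IsSmall F n D → M + D ∈ U
  isOpen_univ _ _ := ⟨1, le_rfl, fun _ _ => trivial⟩
  isOpen_inter U V hU hV M hM := by
    obtain ⟨n, hn, h⟩ := hU M hM.1
    obtain ⟨m, hm, h'⟩ := hV M hM.2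
    refine ⟨max n m, hn.trans (le_max_left _ _), fun D hD => ⟨h D ⟨hD.1, ?_⟩, h' D ⟨hD.1, ?_⟩⟩⟩
    · ext i j
      exact congrFun (congrFun hD.2 ⟨i.1, i.2.trans (by simp)⟩) ⟨j.1, j.2.trans (by simp)⟩
    · ext i j
      exact congrFun (congrFun hD.2 ⟨i.1, i.2.trans (by simp)⟩) ⟨j.1, j.2.trans (by simp)⟩
  isOpen_sUnion S hS M := by
    rintro ⟨U, hU, hM⟩
    obtain ⟨n, hn, h⟩ := hS U hU M hM
    exact ⟨n, hn, fun D hD => ⟨U, hU, h D hD⟩⟩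

/-- The Borel σ-algebra of `𝕃`. -/
instance (p : Parity) : MeasurableSpace (LSpace F K p) := borel _

instance (p : Parity) : BorelSpace (LSpace F K p) := ⟨rfl⟩

/-- The elementary cylinder set `{M ∈ 𝕃_n : M^{[n]} = X}`. -/
def cylinder {p : Parity} (n : ℕ) (X : Matrix (Block p n) (Block p n) K) : Set (LSpace F K p) :=
  {M | HasLevel n M.1 ∧ corner n M.1 = X}

variable (K)

/-- The set of pronilpotent matrices. -/
def pronilpotent (p : Parity) : Set (LSpace F K p) :=
  {M | ∃ n, HasLevel n M.1 ∧ IsNilpotent (corner n M.1)}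

variable {K}

/-- The cone of Radon measures on `𝕃` (Borel measures, finite on compact sets) that are invariant
under conjugation by the infinite unitary group and supported on the pronilpotent matrices. -/
structure IsInvariantNilMeasure {p : Parity} (P : MeasureTheory.Measure (LSpace F K p)) :
    Prop where
  finite_on_compacts : MeasureTheory.IsFiniteMeasureOnCompacts P
  invariant : ∀ (n : ℕ) (h : Matrix (Block p n) (Block p n) K), IsUnitary F h →
    ∀ A : Set (LSpace F K p), MeasurableSet A →
      P {M' | ∃ M ∈ A, M'.1 = conjBy h M.1} = P A
  supported : P (pronilpotent F K p)ᶜ = 0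

/-- The nilpotent matrix `X` has Jordan type `μ`: there is a basis indexed by the boxes of `μ`
on which `X` acts by moving each box one step to the left, the first column being killed. -/
def HasJordanType {ι : Type} [Fintype ι] (X : Matrix ι ι K) (μ : YoungDiagram) : Prop :=
  ∃ b : Module.Basis μ.cells K (ι → K),
    (∀ (i : ℕ) (h : (i, 0) ∈ μ.cells), X.mulVec (b ⟨(i, 0), h⟩) = 0) ∧
    ∀ (i j : ℕ) (h : (i, j + 1) ∈ μ.cells) (h' : (i, j) ∈ μ.cells),
      X.mulVec (b ⟨(i, j + 1), h⟩) = b ⟨(i, j), h'⟩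

/-- The relation between a measure `P` and a functional `Φ`, with `t = -1/q`:
`P(Cyl_n(X)) = q ^ (n(μ) - N(N-1)/2) (1 - q ^ (-2)) ^ (-N/2) Φ(Q̃_μ(; -1/q))` for every nilpotent
skew-Hermitian matrix `X` of size `N` and Jordan type `μ`. -/
def Corresponds {p : Parity} (P : MeasureTheory.Measure (LSpace F K p)) (Φ : SymFun →ₗ[ℝ] ℝ) :
    Prop :=
  ∀ (n : ℕ) (X : Matrix (Block p n) (Block p n) K) (μ : YoungDiagram),
    IsSkewHermitian F X → HasJordanType X μ →
      P (cylinder F n X) = ENNReal.ofReal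
        ((Fintype.card F : ℝ) ^ ((nStat μ : ℤ) - ((dim p n).choose 2 : ℤ)) /
          (1 - ((Fintype.card F : ℝ) ^ 2)⁻¹) ^ ((dim p n : ℝ) / 2) *
          Φ (signedQ (-(Fintype.card F : ℝ)⁻¹) μ))

end Main

end PronilHL

open PronilHL

namespace PronilHL

noncomputable section

open MvPolynomial Finset

/-! ### The principal specialization of Hall-Littlewood functions -/

/-! Part (a). At a geometric progression `x_i = c t^i` only one term of the sum defining `P_μ`
survives: if the exponents `α` are not weakly decreasing, then `α_i < α_{i+1}` for some `i`, and the
factor `x_{i+1} - t x_i` vanishes. The remaining product telescopes (`hlB_mul_hlSum`), and with `l`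
the number of rows of `μ`, `Q̃_μ(c, ct, …, c t^(m-1)) = c^|μ| (-t)^n(μ) ∏_{j<l} (1 - t^(m-j))`. This
is nonnegative for `-1 < t < 0` and `c > 0`, and the product tends to `1` as `m → ∞`. The constants
`c_m`, `c_∞` make the geometric series `Φ(p₂)` equal to `1`; as `Φ` is multiplicative, `Φ(p₂ F) =
Φ(F)` follows.

Parts (b) and (c). Put `t = -1/q`. A nilpotent `X` of Jordan type `μ` has size `N = |μ|` and a
kernel of dimension `l`, so the powers `q^n(μ)` cancel and the prescribed mass of `Cyl_n(X)` is
`q^(-N(N-1)/2) (1-u)^(-N/2) f(l)`, with `u = t^(2m)` and `f(l) = ∏_{j<l} (1 - t^(m-j))` for `Φ_m`,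
and with `u = 0` and `f = 1` for `Φ_∞`. Only the nullity of `X` enters.

`Cyl_n(X)` is the disjoint union of the `Cyl_{n+1}(Y)`, where `Y` is `X` bordered by a zero first
column, a zero last row, a last column `x` and a corner `s` with `s̄ = -s`; the first row is forced
by symmetry. `Y` is nilpotent exactly when `X` is. Since `X` is skew-Hermitian, its image is the
orthogonal complement of its kernel. Hence `Y` has nullity `l` if `x` is not in the image, while for
`x = X u` the nullity is `l + 2` for one value of `s` and `l + 1` for the `q - 1` others. As the
image has `q^(2(N-l))` elements, additivity of the masses is the recurrence `IsNullityHarmonic`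
(`sum_border`), which both choices of `f` satisfy.

Cylinders are compact and open, so consistent weights extend to a measure
(`exists_measure_of_isConsistent`). It is invariant because nullity and nilpotency are invariant
under conjugation, and unique because the cylinders form a generating π-system on which its values
are prescribed. The weights with `u = 0`, `f = 1`, put on all skew-Hermitian blocks, give a Haar
measure; each cylinder lies inside the pronilpotent set or is disjoint from it, which yields (c). -/

theorem sum_cells {M : Type*} [AddCommMonoid M] (μ : YoungDiagram) {n : ℕ}
    (hn : μ.colLen 0 ≤ n) (g : ℕ × ℕ → M) :
    ∑ c ∈ μ.cells, g c = ∑ i ∈ range n, ∑ j ∈ range (μ.rowLen i), g (i, j) := by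
  rw [Finset.sum_sigma']
  refine sum_bij' (fun c _ => ⟨c.1, c.2⟩) (fun c _ => (c.1, c.2)) ?_ ?_ ?_ ?_ ?_
  · rintro ⟨i, j⟩ h
    rw [YoungDiagram.mem_cells] at h
    have h0 : (i, 0) ∈ μ := μ.up_left_mem le_rfl (Nat.zero_le j) h
    rw [YoungDiagram.mem_iff_lt_rowLen] at h
    rw [YoungDiagram.mem_iff_lt_colLen] at h0
    simp only [mem_sigma, mem_range]
    exact ⟨h0.trans_le hn, h⟩
  · rintro ⟨i, j⟩ h
    simp only [mem_sigma, mem_range] at h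
    rw [YoungDiagram.mem_cells, YoungDiagram.mem_iff_lt_rowLen]
    exact h.2
  all_goals simp

theorem sum_rowLen (μ : YoungDiagram) {n : ℕ} (hn : μ.colLen 0 ≤ n) :
    ∑ i ∈ range n, μ.rowLen i = μ.card := by
  rw [YoungDiagram.card, card_eq_sum_ones, sum_cells μ hn]
  simp

theorem sum_mul_rowLen (μ : YoungDiagram) {n : ℕ} (hn : μ.colLen 0 ≤ n) :
    ∑ i ∈ range n, i * μ.rowLen i = nStat μ := by
  rw [nStat, sum_cells μ hn]
  simp [mul_comm]

theorem lt_colLen_iff {μ : YoungDiagram} {i j : ℕ} : i < μ.colLen j ↔ j < μ.rowLen i := by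
  rw [← YoungDiagram.mem_iff_lt_colLen, YoungDiagram.mem_iff_lt_rowLen]

theorem rowLen_le_card (μ : YoungDiagram) (i : ℕ) : μ.rowLen i ≤ μ.card := by
  rw [YoungDiagram.rowLen_eq_card]
  exact card_le_card (filter_subset _ _)

/-- The rows of length `k > 0` are those with index in `[μ'_{k+1}, μ'_k)`. -/
theorem filter_rowLen_eq (μ : YoungDiagram) {n k : ℕ} (hn : μ.colLen 0 ≤ n) (hk : 0 < k) :
    {i ∈ range n | μ.rowLen i = k} = Ico (μ.colLen k) (μ.colLen (k - 1)) := by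
  ext i
  have h1 : i < μ.colLen k ↔ k < μ.rowLen i := lt_colLen_iff
  have h2 : i < μ.colLen (k - 1) ↔ k - 1 < μ.rowLen i := lt_colLen_iff
  have h3 : μ.colLen (k - 1) ≤ μ.colLen 0 := μ.colLen_anti _ _ (Nat.zero_le _)
  simp only [mem_filter, mem_range, mem_Ico]
  omega

theorem mult_eq (μ : YoungDiagram) {n k : ℕ} (hn : μ.colLen 0 ≤ n) (hk : 0 < k) :
    #{i ∈ range n | μ.rowLen i = k} = mult μ k := by
  rw [filter_rowLen_eq μ hn hk, ← filter_rowLen_eq μ le_rfl hk, mult, YoungDiagram.rowLens,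
    List.count_eq_countP, List.countP_map, List.countP_eq_length_filter]
  rw [← Multiset.coe_card]
  simp only [card_def, filter_val, range_val, Multiset.range]
  rw [Multiset.filter_coe, Multiset.coe_card, Multiset.coe_card]
  congr 1

theorem card_filter_rowLen (μ : YoungDiagram) {n k : ℕ} (hn : μ.colLen 0 ≤ n) (hk : 0 < k) :
    #{i : Fin n | μ.rowLen i = k} = mult μ k := by
  rw [← mult_eq μ hn hk, card_filter, card_filter, Fin.sum_univ_eq_sum_range
    (fun i => if μ.rowLen i = k then 1 else 0)]

theorem rowLen_mem_rearrangements (μ : YoungDiagram) {n : ℕ} (hn : μ.colLen 0 ≤ n) :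
    (fun i : Fin n => μ.rowLen i) ∈ rearrangements μ n :=
  mem_rearrangements.2 ⟨fun i => rowLen_le_card μ i, fun _ hk => card_filter_rowLen μ hn hk⟩

/-- For a weakly decreasing sequence, the set of positions with value at least `k` is an initial
segment. -/
theorem le_iff_lt_card_of_antitone {n : ℕ} {α : Fin n → ℕ} (h : Antitone α) (i : Fin n) (k : ℕ) :
    k ≤ α i ↔ (i : ℕ) < #{j | k ≤ α j} := by
  constructor
  · intro hk
    have : Iic i ⊆ ({j | k ≤ α j} : Finset (Fin n)) := fun j hj => by
      simpa using hk.trans (h (mem_Iic.1 hj))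
    have := card_le_card this
    rw [Fin.card_Iic] at this
    omega
  · intro hi
    by_contra hk
    have : ({j | k ≤ α j} : Finset (Fin n)) ⊆ Iio i := fun j hj => by
      rw [mem_Iio]
      by_contra hij
      exact hk ((mem_filter.1 hj).2.trans (h (not_lt.1 hij)))
    have := card_le_card this
    rw [Fin.card_Iio] at this
    omega

/-- The numbers of entries `≥ k`, for `k ≥ 1`, determine a weakly decreasing sequence, and they are
sums of multiplicities of positive values. -/
theorem eq_of_antitone {n : ℕ} {α β : Fin n → ℕ} (hα : Antitone α) (hβ : Antitone β)
    (h : ∀ k, 0 < k → #{i | α i = k} = #{i | β i = k}) : α = β := by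
  obtain ⟨B, hB⟩ : ∃ B, ∀ i, α i < B ∧ β i < B :=
    ⟨∑ i, α i + ∑ i, β i + 1, fun i => by
      have h1 := single_le_sum (f := α) (fun _ _ => Nat.zero_le _) (mem_univ i)
      have h2 := single_le_sum (f := β) (fun _ _ => Nat.zero_le _) (mem_univ i)
      omega⟩
  have key : ∀ γ : Fin n → ℕ, (∀ i, γ i < B) → ∀ k,
      #{j | k ≤ γ j} = ∑ l ∈ Ico k B, #{j | γ j = l} := fun γ hγ k => by
    rw [card_eq_sum_card_fiberwise (f := γ) (t := Ico k B)
      (fun i hi => by simpa [hγ i] using hi)]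
    refine sum_congr rfl fun l hl => ?_
    rw [filter_filter]
    congr 1
    ext j
    simp only [mem_filter, mem_univ, true_and, mem_Ico] at hl ⊢
    omega
  have hk : ∀ i k, 0 < k → (k ≤ α i ↔ k ≤ β i) := fun i k hk => by
    rw [le_iff_lt_card_of_antitone hα, le_iff_lt_card_of_antitone hβ, key α fun i => (hB i).1,
      key β fun i => (hB i).2]
    rw [sum_congr rfl fun l hl => h l (hk.trans_le (mem_Ico.1 hl).1)]
  funext i
  have h1 := hk i (α i)
  have h2 := hk i (β i)
  omega

/-- The multiplicities of the positive values add up to the number of rows, which would have to fit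
into `n` positions. -/
theorem rearrangements_eq_empty {μ : YoungDiagram} {n : ℕ} (hn : n < μ.colLen 0) :
    rearrangements μ n = ∅ := by
  refine eq_empty_of_forall_notMem fun α h => ?_
  rw [mem_rearrangements] at h
  have h1 : ∑ k ∈ Icc 1 μ.card, mult μ k ≤ n := by
    calc ∑ k ∈ Icc 1 μ.card, mult μ k = ∑ k ∈ Icc 1 μ.card, #{i | α i = k} :=
          sum_congr rfl fun k hk => (h.2 k (mem_Icc.1 hk).1).symm
      _ = #{i | α i ∈ Icc 1 μ.card} := by
          rw [card_eq_sum_card_fiberwise (f := α) (t := Icc 1 μ.card)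
            (fun i hi => by simpa using hi)]
          refine sum_congr rfl fun l hl => ?_
          rw [filter_filter]
          congr 1
          ext j
          simp only [mem_filter, mem_univ, true_and]
          exact ⟨fun h => ⟨h ▸ hl, h⟩, fun h => h.2⟩
      _ ≤ n := (card_le_univ _).trans (by simp)
  have h2 : ∑ k ∈ Icc 1 μ.card, mult μ k = μ.colLen 0 := by
    calc ∑ k ∈ Icc 1 μ.card, mult μ k
        = ∑ k ∈ Icc 1 μ.card, #{i ∈ range (μ.colLen 0) | μ.rowLen i = k} :=
          sum_congr rfl fun k hk => (mult_eq μ le_rfl (mem_Icc.1 hk).1).symm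
      _ = #(range (μ.colLen 0)) := (card_eq_sum_card_fiberwise fun i hi => by
          have := lt_colLen_iff.1 (mem_range.1 hi)
          simpa using ⟨this, rowLen_le_card μ i⟩).symm
      _ = _ := card_range _
  omega

/-- Every other rearrangement has an ascent `α_i < α_{i+1}`, and the pair `(i + 1, i)` then
contributes the factor `x_{i+1} - t x_i = 0`. -/
theorem hlSum_eq_single {t : ℝ} {μ : YoungDiagram} {n : ℕ} {x : Fin n → ℝ}
    (hx : ∀ i j : Fin n, (j : ℕ) = i + 1 → x j = t * x i) (hn : μ.colLen 0 ≤ n) :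
    hlSum t μ n x = (∏ i : Fin n, x i ^ μ.rowLen i) *
      ∏ e : Fin n × Fin n with μ.rowLen e.2 < μ.rowLen e.1,
        (x e.1 - t * x e.2) / (x e.1 - x e.2) := by
  refine sum_eq_single_of_mem _ (rowLen_mem_rearrangements μ hn) fun α hα hne => ?_
  have hr : Antitone fun i : Fin n => μ.rowLen i := fun i j h => μ.rowLen_anti _ _ h
  have h1 : ¬ Antitone α := fun h => hne (eq_of_antitone h hr fun k hk => by
    rw [(mem_rearrangements.1 hα).2 k hk, card_filter_rowLen μ hn hk])
  have h2 : ∃ i j : Fin n, (j : ℕ) = i + 1 ∧ α i < α j := by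
    by_contra! h
    cases n with
    | zero => exact h1 fun i => i.elim0
    | succ n =>
      exact h1 (Fin.antitone_iff_succ_le.2 fun i => h i.castSucc i.succ (by simp))
  obtain ⟨i, j, hij, hlt⟩ := h2
  rw [prod_eq_zero (i := (j, i)) (s := {e : Fin n × Fin n | α e.2 < α e.1}) (by simpa using hlt)
    (by simp [hx i j hij]), mul_zero]

/-- The numerator of each factor is the denominator of the preceding one. In the application, `j` is
a row and `i` runs through the longer rows. -/
theorem prod_telescope {t : ℝ} (ht : ∀ k, 0 < k → 1 - t ^ k ≠ 0) {j s : ℕ} (hs : s ≤ j) :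
    ∏ i ∈ range s, (1 - t ^ (j - i + 1)) / (1 - t ^ (j - i)) =
      (1 - t ^ (j + 1)) / (1 - t ^ (j - s + 1)) := by
  induction s with
  | zero => simp [div_self (ht (j + 1) (by omega))]
  | succ s ih =>
    rw [prod_range_succ, ih (by omega), show j - (s + 1) + 1 = j - s by omega]
    have h1 := ht (j - s + 1) (by omega)
    have h2 := ht (j - s) (by omega)
    field_simp

/-- `μ.colLen (μ.rowLen j)` is the index of the first row as long as row `j`, so the exponents count
`1, 2, …` through each block of equal rows. The blocks of positive length give `b_μ(t)`; the empty
rows give the other product. -/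
theorem prod_blocks {t : ℝ} {μ : YoungDiagram} {n : ℕ} (hn : μ.colLen 0 ≤ n) :
    ∏ j ∈ range n, (1 - t ^ (j - μ.colLen (μ.rowLen j) + 1)) =
      hlB t μ * ∏ j ∈ Icc 1 (n - μ.colLen 0), (1 - t ^ j) := by
  have hIco : ∀ a b : ℕ, ∏ j ∈ Ico a b, (1 - t ^ (j - a + 1)) = ∏ j ∈ Icc 1 (b - a), (1 - t ^ j) := by
    intro a b
    rw [prod_Ico_eq_prod_range, ← Ico_add_one_right_eq_Icc, prod_Ico_eq_prod_range]
    simp [add_comm]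
  rw [← prod_fiberwise_of_maps_to (g := μ.rowLen) (t := range (μ.card + 1))
    (fun i _ => by simpa [Nat.lt_succ_iff] using rowLen_le_card μ i), prod_range_succ']
  congr 1
  · rw [hlB, ← Ico_add_one_right_eq_Icc, prod_Ico_eq_prod_range]
    refine prod_congr rfl fun k _ => ?_
    rw [add_comm 1 k, ← mult_eq μ hn (by omega), filter_rowLen_eq μ hn (by omega), Nat.card_Ico,
      ← hIco, ← filter_rowLen_eq μ hn (by omega)]
    exact prod_congr rfl fun j hj => by rw [(mem_filter.1 hj).2]
  · rw [← hIco]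
    have : {i ∈ range n | μ.rowLen i = 0} = Ico (μ.colLen 0) n := by
      ext i
      have h1 : i < μ.colLen 0 ↔ 0 < μ.rowLen i := lt_colLen_iff
      simp only [mem_filter, mem_range, mem_Ico]
      omega
    rw [← this]
    exact prod_congr rfl fun j hj => by rw [(mem_filter.1 hj).2]

/-- For fixed `j` the rows longer than row `j` are those with index below `μ.colLen (μ.rowLen j)`;
after cancelling `c t^i` the product over them telescopes. -/
theorem prod_ratio {t : ℝ} (ht : ∀ k, 0 < k → 1 - t ^ k ≠ 0) (ht0 : t ≠ 0) {c : ℝ} (hc : c ≠ 0)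
    (μ : YoungDiagram) (n : ℕ) :
    ∏ e : Fin n × Fin n with μ.rowLen e.2 < μ.rowLen e.1,
        (c * t ^ (e.1 : ℕ) - t * (c * t ^ (e.2 : ℕ))) /
          (c * t ^ (e.1 : ℕ) - c * t ^ (e.2 : ℕ)) =
      (∏ j ∈ range n, (1 - t ^ (j + 1))) /
        ∏ j ∈ range n, (1 - t ^ (j - μ.colLen (μ.rowLen j) + 1)) := by
  rw [prod_filter, Fintype.prod_prod_type_right, ← prod_div_distrib,
    ← Fin.prod_univ_eq_prod_range
      (fun j => (1 - t ^ (j + 1)) / (1 - t ^ (j - μ.colLen (μ.rowLen j) + 1)))]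
  refine prod_congr rfl fun j _ => ?_
  have hs : μ.colLen (μ.rowLen j) ≤ j := by
    by_contra h
    exact lt_irrefl _ (lt_colLen_iff.1 (not_le.1 h))
  rw [← prod_telescope ht hs]
  rw [Fin.prod_univ_eq_prod_range (fun i => if μ.rowLen j < μ.rowLen i then
    (c * t ^ i - t * (c * t ^ (j : ℕ))) / (c * t ^ i - c * t ^ (j : ℕ)) else 1), ← prod_filter]
  have hf : {i ∈ range n | μ.rowLen j < μ.rowLen i} = range (μ.colLen (μ.rowLen j)) := by
    ext i
    have h1 : i < μ.colLen (μ.rowLen j) ↔ μ.rowLen j < μ.rowLen i := lt_colLen_iff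
    simp only [mem_filter, mem_range]
    have := j.2
    omega
  rw [hf]
  refine prod_congr rfl fun i hi => ?_
  have hij : i < j := (mem_range.1 hi).trans_le hs
  have hpow : t ^ (j : ℕ) = t ^ i * t ^ ((j : ℕ) - i) := by rw [← pow_add]; congr 1; omega
  have h1 := ht (j - i) (by omega)
  rw [div_eq_div_iff _ h1]
  · rw [hpow, pow_succ]; ring
  · rw [hpow, show c * t ^ i - c * (t ^ i * t ^ ((j : ℕ) - i)) =
      c * t ^ i * (1 - t ^ ((j : ℕ) - i)) by ring]
    exact mul_ne_zero (mul_ne_zero hc (pow_ne_zero _ ht0)) h1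

/-- The factor `∏_{j < l} (1 - t ^ (m - j))`, which vanishes for `l > m`. -/
def fallingFactor (t : ℝ) (m l : ℕ) : ℝ := ∏ j ∈ range l, (1 - t ^ (m - j))

theorem fallingFactor_of_lt (t : ℝ) {m l : ℕ} (h : m < l) : fallingFactor t m l = 0 :=
  -- The factor with `j = m` is `1 - t^0`.
  prod_eq_zero (mem_range.2 h) (by simp)

theorem fallingFactor_mul (t : ℝ) {m l : ℕ} (h : l ≤ m) :
    fallingFactor t m l * ∏ j ∈ Icc 1 (m - l), (1 - t ^ j) = ∏ j ∈ range m, (1 - t ^ (j + 1)) := by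
  have h1 : ∏ j ∈ Icc 1 (m - l), (1 - t ^ j) = ∏ j ∈ range (m - l), (1 - t ^ (j + 1)) := by
    rw [← Ico_add_one_right_eq_Icc, prod_Ico_eq_prod_range]
    simp [add_comm]
  rw [h1]
  clear h1
  induction l with
  | zero => simp [fallingFactor]
  | succ l ih =>
    rw [← ih (by omega), fallingFactor, prod_range_succ, fallingFactor,
      show m - l = m - (l + 1) + 1 by omega, prod_range_succ]
    ring

theorem one_sub_pow_pos {t : ℝ} (ht : t ∈ Set.Ioo (-1) 0) {k : ℕ} (hk : 0 < k) :
    0 < 1 - t ^ k := by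
  have h : |t ^ k| < 1 := by
    rw [abs_pow]
    exact pow_lt_one₀ (abs_nonneg _) (abs_lt.2 ⟨ht.1, ht.2.trans one_pos⟩) hk.ne'
  linarith [(abs_lt.1 h).2]

theorem fallingFactor_nonneg {t : ℝ} (ht : t ∈ Set.Ioo (-1) 0) (m l : ℕ) :
    0 ≤ fallingFactor t m l := by
  refine prod_nonneg fun j _ => ?_
  rcases Nat.eq_zero_or_pos (m - j) with h | h
  · simp [h]
  · exact (one_sub_pow_pos ht h).le

/-- `b_μ(t)` cancels the blocks of equal positive rows, which leaves `∏_{j≤n} (1 - t^j) / ∏_{j≤n-l}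
(1 - t^j)` with `l` the number of rows. For `n < l` both sides vanish. -/
theorem hlB_mul_hlSum {t : ℝ} (ht : t ∈ Set.Ioo (-1) 0) {c : ℝ} (hc : c ≠ 0) (μ : YoungDiagram)
    (n : ℕ) :
    hlB t μ * hlSum t μ n (fun i => c * t ^ (i : ℕ)) =
      c ^ μ.card * t ^ nStat μ * fallingFactor t n (μ.colLen 0) := by
  rcases lt_or_ge n (μ.colLen 0) with hn | hn
  · rw [hlSum, rearrangements_eq_empty hn, fallingFactor_of_lt t hn]
    simp
  have h1 : ∀ k, 0 < k → 1 - t ^ k ≠ 0 := fun k hk => (one_sub_pow_pos ht hk).ne'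
  rw [hlSum_eq_single (fun i j h => by rw [h, pow_succ]; ring) hn, prod_ratio h1 ht.2.ne hc,
    prod_blocks hn, ← fallingFactor_mul t hn]
  have h2 : ∏ i : Fin n, (c * t ^ (i : ℕ)) ^ μ.rowLen i = c ^ μ.card * t ^ nStat μ := by
    rw [Fin.prod_univ_eq_prod_range (fun i => (c * t ^ i) ^ μ.rowLen i)]
    simp_rw [mul_pow, ← pow_mul]
    rw [prod_mul_distrib, prod_pow_eq_pow_sum, prod_pow_eq_pow_sum, sum_rowLen μ hn,
      sum_mul_rowLen μ hn]
  rw [h2]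
  have h3 : hlB t μ ≠ 0 := prod_ne_zero_iff.2 fun k _ => prod_ne_zero_iff.2 fun j hj =>
    h1 j (mem_Icc.1 hj).1
  have h4 : ∏ j ∈ Icc 1 (n - μ.colLen 0), (1 - t ^ j) ≠ 0 := prod_ne_zero_iff.2 fun j hj =>
    h1 j (mem_Icc.1 hj).1
  field_simp

theorem eval_signedQ {t : ℝ} (ht : t ∈ Set.Ioo (-1) 0) {c : ℝ} (hc : c ≠ 0) (μ : YoungDiagram)
    (n : ℕ) :
    eval (fun i : Fin n => c * t ^ (i : ℕ)) ((signedQ t μ).1 n) =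
      c ^ μ.card * (-t) ^ nStat μ * fallingFactor t n (μ.colLen 0) := by
  -- `hlSum` describes `P_μ` only at distinct coordinates; here even the absolute values differ, as
  -- `0 < |t| < 1`.
  have hinj : Function.Injective (fun i : Fin n => c * t ^ (i : ℕ)) := by
    intro i j h
    have h' : |t| ^ (i : ℕ) = |t| ^ (j : ℕ) := by
      rw [← abs_pow, ← abs_pow, mul_left_cancel₀ hc h]
    exact Fin.ext (pow_right_injective₀ (abs_pos.2 ht.2.ne)
      (abs_lt.2 ⟨ht.1, ht.2.trans one_pos⟩).ne h')
  have h : (signedQ t μ).1 n = ((-1 : ℝ) ^ nStat μ * hlB t μ) • (hallLittlewoodP t μ).1 n := by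
    rw [mul_smul]; rfl
  rw [h, smul_eval, eval_hallLittlewoodP t μ _ hinj, mul_assoc, hlB_mul_hlSum ht hc, neg_pow t]
  ring

/-! ### Values of `Φ_m` and `Φ_∞` on `Q̃_μ` and on `p₂` -/

theorem Phi_apply (t : ℝ) (m : ℕ) (F : SymFun) : Phi t m F =
    eval (fun i : Fin m => √((1 - t ^ 2) / (1 - t ^ (2 * m))) * t ^ (i : ℕ)) (F.1 m) := by
  simp [Phi, finSpecialization, aeval_eq_eval]

theorem Phi_signedQ {t : ℝ} (ht : t ∈ Set.Ioo (-1) 0) {m : ℕ} (hm : 1 ≤ m) (μ : YoungDiagram) :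
    Phi t m (signedQ t μ) = √((1 - t ^ 2) / (1 - t ^ (2 * m))) ^ μ.card * (-t) ^ nStat μ *
      fallingFactor t m (μ.colLen 0) := by
  rw [Phi_apply, eval_signedQ ht]
  exact (Real.sqrt_pos.2 (div_pos (one_sub_pow_pos ht two_pos)
    (one_sub_pow_pos ht (by omega)))).ne'

theorem tendsto_fallingFactor {t : ℝ} (ht : t ∈ Set.Ioo (-1) 0) (l : ℕ) :
    Filter.Tendsto (fun m => fallingFactor t m l) Filter.atTop (nhds 1) := by
  have h : ∀ j, Filter.Tendsto (fun m => 1 - t ^ (m - j)) Filter.atTop (nhds (1 - 0)) := fun j =>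
    tendsto_const_nhds.sub ((tendsto_pow_atTop_nhds_zero_of_abs_lt_one
      (abs_lt.2 ⟨ht.1, ht.2.trans one_pos⟩)).comp (Filter.tendsto_sub_atTop_nat j))
  simpa [fallingFactor] using tendsto_finsetProd (range l) fun j _ => h j

theorem PhiInf_signedQ {t : ℝ} (ht : t ∈ Set.Ioo (-1) 0) (μ : YoungDiagram) :
    PhiInf t ht (signedQ t μ) = √(1 - t ^ 2) ^ μ.card * (-t) ^ nStat μ := by
  refine tendsto_nhds_unique (tendsto_specialization (summable_principal ht _) _) ?_
  simp_rw [eval_signedQ ht (Real.sqrt_pos.2 (one_sub_pow_pos ht two_pos)).ne' μ]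
  simpa using (tendsto_fallingFactor ht (μ.colLen 0)).const_mul
    (√(1 - t ^ 2) ^ μ.card * (-t) ^ nStat μ)

theorem eval_powerSum (k : ℕ) (hk : k ≠ 0) {n : ℕ} (x : Fin n → ℝ) :
    eval x ((powerSum k hk).1 n) = ∑ i, x i ^ k := by
  simp [powerSum, psum]

/-- A geometric sum of ratio `t^2`. Here `d` stands for `c_m ^ 2` or `c_∞ ^ 2`. -/
theorem eval_powerSum_two {t : ℝ} (ht : t ∈ Set.Ioo (-1) 0) {d : ℝ} (hd : 0 ≤ d) (n : ℕ) :
    eval (fun i : Fin n => √d * t ^ (i : ℕ)) ((powerSum 2 two_ne_zero).1 n) =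
      d * ((1 - t ^ (2 * n)) / (1 - t ^ 2)) := by
  rw [eval_powerSum, Fin.sum_univ_eq_sum_range (fun i => (√d * t ^ i) ^ 2)]
  have h : ∀ i, (√d * t ^ i) ^ 2 = d * (t ^ 2) ^ i := fun i => by
    rw [mul_pow, Real.sq_sqrt hd, ← pow_mul, ← pow_mul, mul_comm 2]
  simp_rw [h]
  have h2 := one_sub_pow_pos ht two_pos
  rw [← mul_sum, geom_sum_eq (by linarith), pow_mul, ← neg_div_neg_eq, neg_sub, neg_sub]

theorem Phi_powerSum_two {t : ℝ} (ht : t ∈ Set.Ioo (-1) 0) {m : ℕ} (hm : 1 ≤ m) :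
    Phi t m (powerSum 2 two_ne_zero) = 1 := by
  have h2 := one_sub_pow_pos ht two_pos
  have h3 := one_sub_pow_pos ht (k := 2 * m) (by omega)
  rw [Phi_apply, eval_powerSum_two ht (by positivity)]
  field_simp

theorem PhiInf_powerSum_two {t : ℝ} (ht : t ∈ Set.Ioo (-1) 0) :
    PhiInf t ht (powerSum 2 two_ne_zero) = 1 := by
  have h2 := one_sub_pow_pos ht two_pos
  refine tendsto_nhds_unique (tendsto_specialization (summable_principal ht _) _) ?_
  simp_rw [eval_powerSum_two ht h2.le, pow_mul]
  have h := (((tendsto_pow_atTop_nhds_zero_of_lt_one (sq_nonneg t) (by linarith)).const_sub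
    1).div_const (1 - t ^ 2)).const_mul (1 - t ^ 2)
  rwa [sub_zero, mul_one_div_cancel h2.ne'] at h

theorem isP2Harmonic_of_algHom (p : Parity) {Φ : SymFun →ₐ[ℝ] ℝ}
    (h : Φ (powerSum 2 two_ne_zero) = 1) : IsP2Harmonic p Φ.toLinearMap := fun F _ => by
  simp [h]

theorem isHLPositive_of_signedQ (p : Parity) {t : ℝ} {Φ : SymFun →ₗ[ℝ] ℝ}
    (h : ∀ μ, 0 ≤ Φ (signedQ t μ)) : IsHLPositive p t Φ := fun F hF => by
  refine Submodule.span_induction ?_ (by simp) ?_ ?_ hF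
  · rintro _ ⟨μ, -, rfl⟩
    exact h μ
  · intro x y _ _ hx hy
    rw [map_add]
    exact add_nonneg hx hy
  · intro a x _ hx
    rw [show a • x = (a : ℝ) • x from rfl, map_smul]
    exact mul_nonneg a.2 hx

end

end PronilHL

namespace PronilHL

noncomputable section

open Finset Matrix

/-! ### Central blocks and bordered matrices -/

section Blocks

variable {p : Parity} {n : ℕ}

/-- The inclusion of `{-n, …, n}` in `{-(n + 1), …, n + 1}`. -/
def incl (i : Block p n) : Block p (n + 1) :=
  ⟨i.1, i.2.trans (by push_cast; omega)⟩

variable (p n) in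
/-- The index `n + 1`. -/
def topIdx : Block p (n + 1) :=
  ⟨⟨(n : ℤ) + 1, Or.inr (by omega)⟩, by
    change |(n : ℤ) + 1| ≤ _
    rw [abs_of_nonneg (by omega)]; push_cast; omega⟩

variable (p n) in
/-- The index `-(n + 1)`. -/
def botIdx : Block p (n + 1) := -topIdx p n

theorem neg_neg_block (i : Block p n) : - -i = i :=
  Subtype.ext (Subtype.ext (neg_neg i.1.1))

theorem neg_block_injective : Function.Injective (fun i : Block p n => -i) :=
  Function.LeftInverse.injective neg_neg_block

/-- Negation of indices, as an equivalence. -/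
def negEquiv : Block p n ≃ Block p n := ⟨fun i => -i, fun i => -i, neg_neg_block, neg_neg_block⟩

@[simp] theorem neg_topIdx : -topIdx p n = botIdx p n := rfl

@[simp] theorem neg_botIdx : -botIdx p n = topIdx p n := neg_neg_block _

@[simp] theorem neg_incl (i : Block p n) : -incl i = incl (-i) := rfl

theorem coe_incl (i : Block p n) : (incl i).1.1 = i.1.1 := rfl

theorem coe_topIdx : (topIdx p n).1.1 = n + 1 := rfl

theorem coe_botIdx : (botIdx p n).1.1 = -(n + 1) := rfl

theorem block_ext {i j : Block p n} (h : i.1.1 = j.1.1) : i = j := Subtype.ext (Subtype.ext h)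

theorem incl_injective : Function.Injective (incl : Block p n → Block p (n + 1)) :=
  fun _ _ h => block_ext (congrArg (fun z : Block p (n + 1) => z.1.1) h)

theorem incl_ne_topIdx (i : Block p n) : incl i ≠ topIdx p n := fun h => by
  have h1 := congrArg (fun z : Block p (n + 1) => z.1.1) h
  have h2 := abs_le.1 i.2
  simp only [coe_incl, coe_topIdx] at h1
  omega

theorem incl_ne_botIdx (i : Block p n) : incl i ≠ botIdx p n := fun h => by
  have h1 := congrArg (fun z : Block p (n + 1) => z.1.1) h
  have h2 := abs_le.1 i.2
  simp only [coe_incl, coe_botIdx] at h1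
  omega

theorem topIdx_ne_botIdx : topIdx p n ≠ botIdx p n := fun h => by
  have h1 := congrArg (fun z : Block p (n + 1) => z.1.1) h
  simp only [coe_topIdx, coe_botIdx] at h1
  omega

theorem block_cases (i : Block p (n + 1)) :
    i = botIdx p n ∨ (∃ j, i = incl j) ∨ i = topIdx p n := by
  by_cases h1 : i.1.1 = -(n + 1)
  · exact Or.inl (block_ext h1)
  by_cases h2 : i.1.1 = n + 1
  · exact Or.inr (Or.inr (block_ext h2))
  · refine Or.inr (Or.inl ⟨⟨i.1, ?_⟩, rfl⟩)
    have h3 := abs_le.1 i.2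
    push_cast at h3
    exact abs_le.2 ⟨by omega, by omega⟩

variable (p n) in
/-- The decomposition of `{-(n + 1), …, n + 1}` into its least element, its greatest element and
`{-n, …, n}`. -/
def blockEquiv : Option (Option (Block p n)) ≃ Block p (n + 1) :=
  Equiv.ofBijective
    (fun o => o.elim (botIdx p n) fun o' => o'.elim (topIdx p n) incl) <| by
    constructor
    · rintro (_ | _ | i) (_ | _ | j) h
      · rfl
      · exact absurd h.symm topIdx_ne_botIdx
      · exact absurd h.symm (incl_ne_botIdx j)
      · exact absurd h topIdx_ne_botIdx
      · rfl
      · exact absurd h.symm (incl_ne_topIdx j)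
      · exact absurd h (incl_ne_botIdx i)
      · exact absurd h (incl_ne_topIdx i)
      · rw [incl_injective h]
    · intro i
      rcases block_cases i with rfl | ⟨j, rfl⟩ | rfl
      · exact ⟨none, rfl⟩
      · exact ⟨some (some j), rfl⟩
      · exact ⟨some none, rfl⟩

@[simp] theorem blockEquiv_symm_botIdx : (blockEquiv p n).symm (botIdx p n) = none :=
  (Equiv.symm_apply_eq _).2 rfl

@[simp] theorem blockEquiv_symm_topIdx : (blockEquiv p n).symm (topIdx p n) = some none :=
  (Equiv.symm_apply_eq _).2 rfl

@[simp] theorem blockEquiv_symm_incl (i : Block p n) :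
    (blockEquiv p n).symm (incl i) = some (some i) :=
  (Equiv.symm_apply_eq _).2 rfl

theorem sum_block {M : Type*} [AddCommMonoid M] (f : Block p (n + 1) → M) :
    ∑ i, f i = f (botIdx p n) + (f (topIdx p n) + ∑ i, f (incl i)) := by
  rw [← (blockEquiv p n).sum_comp, Fintype.sum_option, Fintype.sum_option]
  rfl

theorem card_block (p : Parity) (n : ℕ) : Fintype.card (Block p n) = dim p n := by
  induction n with
  | zero =>
    cases p with
    | even =>
      rw [Fintype.card_eq_zero_iff.2]
      · rfl
      · refine ⟨fun i => ?_⟩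
        have h1 := abs_le.1 i.2
        have h2 := i.1.2.resolve_left (by simp)
        push_cast at h1
        omega
    | odd =>
      refine Fintype.card_eq_one_iff.2 ⟨⟨⟨0, Or.inl rfl⟩, by simp⟩, fun i => block_ext ?_⟩
      have h1 := abs_le.1 i.2
      push_cast at h1
      change i.1.1 = 0
      omega
  | succ n ih =>
    rw [← Fintype.card_congr (blockEquiv p n), Fintype.card_option, Fintype.card_option, ih]
    simp only [dim]
    ring

end Blocks

/-! ### Bordered matrices and nilpotency -/

section Bordered

variable {p : Parity} {n : ℕ} {K : Type*}

/-- The central block of size `n` of a matrix of size `n + 1`. -/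
def shrink (Y : Matrix (Block p (n + 1)) (Block p (n + 1)) K) : Matrix (Block p n) (Block p n) K :=
  Y.submatrix incl incl

@[simp] theorem shrink_apply (Y : Matrix (Block p (n + 1)) (Block p (n + 1)) K) (i j : Block p n) :
    shrink Y i j = Y (incl i) (incl j) := rfl

variable [Field K]

/-- The last row and the first column of `Y` vanish. -/
def IsBordered (Y : Matrix (Block p (n + 1)) (Block p (n + 1)) K) : Prop :=
  (∀ j, Y (topIdx p n) j = 0) ∧ ∀ i, Y i (botIdx p n) = 0

theorem IsBordered.mul {Y Z : Matrix (Block p (n + 1)) (Block p (n + 1)) K} (hY : IsBordered Y)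
    (hZ : IsBordered Z) : IsBordered (Y * Z) :=
  ⟨fun j => by simp [mul_apply, hY.1], fun i => by simp [mul_apply, hZ.2]⟩

/-- The exponent is shifted by one because the zeroth power, the identity, is not bordered. -/
theorem IsBordered.pow {Y : Matrix (Block p (n + 1)) (Block p (n + 1)) K} (hY : IsBordered Y)
    (r : ℕ) : IsBordered (Y ^ (r + 1)) := by
  induction r with
  | zero => simpa using hY
  | succ r ih => rw [pow_succ]; exact ih.mul hY

/-- The zero first column of `Y` and the zero last row of `Z` remove the two outer terms of the
inner sum. -/
theorem shrink_mul {Y Z : Matrix (Block p (n + 1)) (Block p (n + 1)) K} (hY : IsBordered Y)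
    (hZ : IsBordered Z) : shrink (Y * Z) = shrink Y * shrink Z := by
  ext i j
  simp [mul_apply, sum_block, hY.2, hZ.1]

theorem shrink_pow {Y : Matrix (Block p (n + 1)) (Block p (n + 1)) K} (hY : IsBordered Y)
    (r : ℕ) : shrink (Y ^ (r + 1)) = shrink Y ^ (r + 1) := by
  induction r with
  | zero => simp
  | succ r ih => rw [pow_succ, shrink_mul (hY.pow r) hY, ih, ← pow_succ]

/-- With respect to the decomposition into first, central and last indices, `Z` is strictly block
upper triangular with three blocks. -/
theorem IsBordered.cube_eq_zero {Z : Matrix (Block p (n + 1)) (Block p (n + 1)) K}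
    (hZ : IsBordered Z) (h0 : shrink Z = 0) : Z ^ 3 = 0 := by
  have h1 : ∀ i j, Z (incl i) (incl j) = 0 := fun i j => congrFun (congrFun h0 i) j
  have h2 : ∀ i j, (Z * Z) i (incl j) = 0 := fun i j => by
    simp [mul_apply, sum_block, hZ.2, hZ.1, h1]
  rw [pow_succ, pow_two]
  ext i j
  rw [mul_apply, sum_block]
  simp [h2, hZ.1, (hZ.mul hZ).2]

theorem IsBordered.isNilpotent_iff {Y : Matrix (Block p (n + 1)) (Block p (n + 1)) K}
    (hY : IsBordered Y) : IsNilpotent Y ↔ IsNilpotent (shrink Y) := by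
  constructor
  · rintro ⟨r, hr⟩
    refine ⟨r + 1, ?_⟩
    rw [← shrink_pow hY, pow_succ, hr, zero_mul]
    rfl
  · rintro ⟨r, hr⟩
    -- `Y ^ (r + 1)` is bordered with zero central block, so its cube vanishes.
    refine ⟨(r + 1) * 3, ?_⟩
    rw [pow_mul]
    exact (hY.pow r).cube_eq_zero (by rw [shrink_pow hY, pow_succ, hr, zero_mul])

end Bordered

/-! ### The Hermitian form -/

section Hermitian

variable (F : Type*) [Field F] [Fintype F] {K : Type*} [Field K] [Algebra F K]

@[simp] theorem frob_zero : frob F (0 : K) = 0 := map_zero (FiniteField.frobeniusAlgHom F K)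

@[simp] theorem frob_one : frob F (1 : K) = 1 := map_one (FiniteField.frobeniusAlgHom F K)

theorem frob_mul (x y : K) : frob F (x * y) = frob F x * frob F y :=
  map_mul (FiniteField.frobeniusAlgHom F K) x y

theorem frob_neg (x : K) : frob F (-x) = -frob F x := map_neg (FiniteField.frobeniusAlgHom F K) x

theorem frob_sub (x y : K) : frob F (x - y) = frob F x - frob F y :=
  map_sub (FiniteField.frobeniusAlgHom F K) x y

theorem frob_sum {ι : Type*} (s : Finset ι) (f : ι → K) :
    frob F (∑ i ∈ s, f i) = ∑ i ∈ s, frob F (f i) :=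
  map_sum (FiniteField.frobeniusAlgHom F K) f s

theorem frob_eq_pow (x : K) : frob F x = x ^ Fintype.card F := by
  simp [frob]

theorem frob_algebraMap (y : F) : frob F (algebraMap F K y) = algebraMap F K y := by
  rw [frob_eq_pow, ← map_pow, FiniteField.pow_card]

theorem finite_of_finrank_eq_two (hK : Module.finrank F K = 2) : Finite K :=
  have : Module.Finite F K := Module.finite_of_finrank_pos (by omega)
  Module.finite_of_finite F

variable {F}

theorem card_eq_sq [Fintype K] (hK : Module.finrank F K = 2) :
    Fintype.card K = Fintype.card F ^ 2 := by
  rw [Module.card_eq_pow_finrank (K := F), hK]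

theorem frob_frob (hK : Module.finrank F K = 2) (x : K) : frob F (frob F x) = x := by
  have := finite_of_finrank_eq_two F hK
  have := Fintype.ofFinite K
  rw [frob_eq_pow, frob_eq_pow, ← pow_mul, ← sq, ← card_eq_sq hK, FiniteField.pow_card]

variable {p : Parity} {n : ℕ}

variable (F) in
/-- The adjoint of a matrix with respect to the form `τ(e_r, e_s) = δ_{r, -s}`. -/
def formAdjoint (A : Matrix (Block p n) (Block p n) K) : Matrix (Block p n) (Block p n) K :=
  Matrix.of fun i j => frob F (A (-j) (-i))

theorem formAdjoint_mul (A B : Matrix (Block p n) (Block p n) K) :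
    formAdjoint F (A * B) = formAdjoint F B * formAdjoint F A := by
  ext i j
  simp only [formAdjoint, of_apply, mul_apply, frob_sum, frob_mul]
  rw [← (negEquiv (p := p) (n := n)).sum_comp]
  exact sum_congr rfl fun k _ => by rw [mul_comm]; simp [negEquiv]

theorem formAdjoint_formAdjoint (hK : Module.finrank F K = 2)
    (A : Matrix (Block p n) (Block p n) K) : formAdjoint F (formAdjoint F A) = A := by
  ext i j
  simp [formAdjoint, frob_frob hK, neg_neg_block]

theorem isSkewHermitian_iff (A : Matrix (Block p n) (Block p n) K) :
    IsSkewHermitian F A ↔ formAdjoint F A = -A := by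
  constructor
  · intro h
    ext i j
    have := h (-j) (-i)
    rw [neg_neg_block, neg_neg_block] at this
    simp [formAdjoint, this]
  · intro h a b
    have := congrFun (congrFun h (-b)) (-a)
    simp only [formAdjoint, of_apply, neg_neg_block, Matrix.neg_apply] at this
    rw [this, neg_neg]

/-- Row `-i` of `h^* W h` is row `i` of `formAdjoint F h * h`, and row `-i` of `W` is row `i` of the
identity. -/
theorem isUnitary_iff (h : Matrix (Block p n) (Block p n) K) :
    IsUnitary F h ↔ formAdjoint F h * h = 1 := by
  have h1 : ∀ i j, ((h.map (frob F)).transpose * antiDiag K p n * h) (-i) j =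
      (formAdjoint F h * h) i j := fun i j => by
    rw [mul_apply, mul_apply]
    refine sum_congr rfl fun k _ => ?_
    congr 1
    rw [mul_apply, sum_eq_single (-k)]
    · simp [antiDiag, formAdjoint]
    · intro l _ hl
      simp [antiDiag, hl]
    · simp
  have h2 : ∀ i j, antiDiag K p n (-i) j = (1 : Matrix (Block p n) (Block p n) K) i j :=
    fun i j => by
      simp only [antiDiag, of_apply, one_apply]
      exact if_congr (neg_block_injective (p := p) (n := n)).eq_iff rfl rfl
  constructor
  · intro hu
    ext i j
    rw [← h1, ← h2, hu]
  · intro hu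
    refine Matrix.ext fun i j => ?_
    rw [← neg_neg_block i, h1, h2, hu]

theorem IsUnitary.inv_eq {h : Matrix (Block p n) (Block p n) K} (hh : IsUnitary F h) :
    h⁻¹ = formAdjoint F h := inv_eq_left_inv ((isUnitary_iff h).1 hh)

theorem IsUnitary.isUnit {h : Matrix (Block p n) (Block p n) K} (hh : IsUnitary F h) :
    IsUnit h.det := by
  rw [← isUnit_iff_isUnit_det]
  exact IsUnit.of_mul_eq_one_right _ ((isUnitary_iff h).1 hh)

theorem IsUnitary.inv (hK : Module.finrank F K = 2) {h : Matrix (Block p n) (Block p n) K}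
    (hh : IsUnitary F h) : IsUnitary F h⁻¹ := by
  rw [isUnitary_iff, hh.inv_eq, formAdjoint_formAdjoint hK]
  exact mul_eq_one_comm.1 ((isUnitary_iff h).1 hh)

theorem IsSkewHermitian.conj (hK : Module.finrank F K = 2)
    {h X : Matrix (Block p n) (Block p n) K} (hh : IsUnitary F h) (hX : IsSkewHermitian F X) :
    IsSkewHermitian F (h * X * h⁻¹) := by
  rw [isSkewHermitian_iff] at hX ⊢
  rw [formAdjoint_mul, formAdjoint_mul, hX, hh.inv_eq, formAdjoint_formAdjoint hK, Matrix.neg_mul,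
    Matrix.mul_neg, Matrix.mul_assoc]

/-- The conjugate vector, such that `τ(x, v) = conjVec x ⬝ᵥ v`. -/
def conjVec (F : Type*) [Field F] [Fintype F] [Algebra F K] (x : Block p n → K) : Block p n → K :=
  fun j => frob F (x (-j))

theorem conjVec_conjVec (hK : Module.finrank F K = 2) (x : Block p n → K) :
    conjVec F (conjVec F x) = x := by
  funext j
  simp [conjVec, frob_frob hK, neg_neg_block]

theorem conjVec_neg (x : Block p n → K) : conjVec F (-x) = -conjVec F x := by
  funext j
  simp [conjVec, frob_neg]

/-- The Hermitian symmetry of the form `τ`. -/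
theorem frob_conjVec_dotProduct (hK : Module.finrank F K = 2) (x v : Block p n → K) :
    frob F (conjVec F x ⬝ᵥ v) = conjVec F v ⬝ᵥ x := by
  simp only [dotProduct, conjVec, frob_sum, frob_mul, frob_frob hK]
  rw [← (negEquiv (p := p) (n := n)).sum_comp]
  exact sum_congr rfl fun k _ => by rw [mul_comm]; simp [negEquiv, neg_neg_block]

theorem IsSkewHermitian.conjVec_mulVec {X : Matrix (Block p n) (Block p n) K}
    (hX : IsSkewHermitian F X) (u : Block p n → K) :
    conjVec F (X *ᵥ u) = -(conjVec F u ᵥ* X) := by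
  funext j
  simp only [conjVec, mulVec, vecMul, dotProduct, frob_sum, frob_mul, Pi.neg_apply]
  rw [← (negEquiv (p := p) (n := n)).sum_comp, ← sum_neg_distrib]
  refine sum_congr rfl fun k _ => ?_
  have := hX (-j) (-k)
  rw [neg_neg_block, neg_neg_block] at this
  rw [this]
  simp [negEquiv, mul_comm]

theorem IsSkewHermitian.conjVec_mulVec_dotProduct {X : Matrix (Block p n) (Block p n) K}
    (hX : IsSkewHermitian F X) (u v : Block p n → K) :
    conjVec F (X *ᵥ u) ⬝ᵥ v = -(conjVec F u ⬝ᵥ (X *ᵥ v)) := by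
  rw [hX.conjVec_mulVec, neg_dotProduct, dotProduct_mulVec]

/-- The image of a skew-Hermitian matrix is the orthogonal complement of its kernel. -/
theorem IsSkewHermitian.mem_range_of_orthogonal (hK : Module.finrank F K = 2)
    {X : Matrix (Block p n) (Block p n) K} (hX : IsSkewHermitian F X) {x : Block p n → K}
    (hx : ∀ v, X *ᵥ v = 0 → conjVec F x ⬝ᵥ v = 0) : ∃ u, X *ᵥ u = x := by
  -- The functional `v ↦ τ(x, v)` vanishes on the kernel of `X`, so it factors through `X` and has
  -- the form `v ↦ y ⬝ᵥ X v`.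
  have h1 : (dotProductEquiv K (Block p n) (conjVec F x)) ∈
      LinearMap.range X.mulVecLin.dualMap := by
    rw [LinearMap.range_dualMap_eq_dualAnnihilator_ker, Submodule.mem_dualAnnihilator]
    exact fun v hv => hx v hv
  obtain ⟨ψ, hψ⟩ := h1
  obtain ⟨y, rfl⟩ := (dotProductEquiv K (Block p n)).surjective ψ
  have h2 : conjVec F x = y ᵥ* X := by
    refine dotProduct_eq _ _ fun v => ?_
    rw [← dotProduct_mulVec]
    exact (DFunLike.congr_fun hψ v).symm
  -- By skew-Hermitian symmetry, conjugating the column `X *ᵥ (-conjVec F y)` gives the row `y ᵥ*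
  -- X`, the conjugate of `x`.
  refine ⟨-conjVec F y, ?_⟩
  rw [← conjVec_conjVec hK x, h2, ← conjVec_conjVec hK y, ← neg_neg (_ ᵥ* X),
    ← hX.conjVec_mulVec, conjVec_conjVec hK, conjVec_neg, conjVec_conjVec hK, mulVec_neg]

end Hermitian

end

end PronilHL

namespace PronilHL

noncomputable section

open Finset Matrix

/-! ### Counting the bordered extensions of a skew-Hermitian matrix -/

section Nullity

variable {K : Type*} [Field K] {p : Parity} {n : ℕ}

/-- The dimension of the kernel. -/
def nullity {ι : Type*} [Fintype ι] (X : Matrix ι ι K) : ℕ :=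
  Module.finrank K (LinearMap.ker X.mulVecLin)

theorem nullity_conj {ι : Type*} [Fintype ι] [DecidableEq ι] {h : Matrix ι ι K}
    (hh : IsUnit h.det) (X : Matrix ι ι K) : nullity (h * X * h⁻¹) = nullity X := by
  have h1 : LinearMap.range h.mulVecLin = ⊤ := by
    rw [LinearMap.range_eq_top]
    exact mulVec_surjective_iff_isUnit.2 ((isUnit_iff_isUnit_det h).2 hh)
  have h2 : ∀ A : Matrix ι ι K, A.rank + nullity A = Fintype.card ι := fun A => by
    rw [nullity, Matrix.rank, LinearMap.finrank_range_add_finrank_ker, Module.finrank_pi]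
  have h3 := h2 (h * X * h⁻¹)
  have h4 := h2 X
  rw [rank_mul_eq_left_of_isUnit_det _ _ ((isUnit_nonsing_inv_det_iff).2 hh),
    rank_mul_eq_right_of_isUnit_det _ _ hh] at h3
  omega

theorem isNilpotent_conj_iff {ι : Type*} [Fintype ι] [DecidableEq ι] {h : Matrix ι ι K}
    (hh : IsUnit h.det) (X : Matrix ι ι K) : IsNilpotent (h * X * h⁻¹) ↔ IsNilpotent X := by
  have h1 : ∀ r, (h * X * h⁻¹) ^ r = h * X ^ r * h⁻¹ := fun r => by
    induction r with
    | zero => simp [mul_nonsing_inv h hh]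
    | succ r ih =>
      rw [pow_succ, ih, pow_succ]
      simp only [Matrix.mul_assoc]
      rw [nonsing_inv_mul_cancel_left _ _ hh]
  refine exists_congr fun r => ?_
  rw [h1]
  constructor
  · intro h0
    have := congrArg (fun A => h⁻¹ * A * h) h0
    simpa [Matrix.mul_assoc, nonsing_inv_mul_cancel_left _ _ hh, nonsing_inv_mul _ hh] using this
  · intro h0
    simp [h0]

/-- The column vector with first entry `w.1`, central part `w.2.1` and last entry `w.2.2`. -/
def packVec : (K × (Block p n → K) × K) ≃ₗ[K] (Block p (n + 1) → K) where
  toFun w i := ((blockEquiv p n).symm i).elim w.1 fun o => o.elim w.2.2 w.2.1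
  invFun v := (v (botIdx p n), fun i => v (incl i), v (topIdx p n))
  map_add' w w' := by
    funext i
    rcases block_cases i with rfl | ⟨i, rfl⟩ | rfl <;> simp
  map_smul' c w := by
    funext i
    rcases block_cases i with rfl | ⟨i, rfl⟩ | rfl <;> simp
  left_inv w := by simp
  right_inv v := by
    funext i
    rcases block_cases i with rfl | ⟨i, rfl⟩ | rfl <;> simp

@[simp] theorem packVec_botIdx (w : K × (Block p n → K) × K) : packVec w (botIdx p n) = w.1 := by
  simp [packVec]

@[simp] theorem packVec_topIdx (w : K × (Block p n → K) × K) : packVec w (topIdx p n) = w.2.2 := by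
  simp [packVec]

@[simp] theorem packVec_incl (w : K × (Block p n → K) × K) (i : Block p n) :
    packVec w (incl i) = w.2.1 i := by
  simp [packVec]

variable (F : Type*) [Field F] [Fintype F] [Algebra F K]

/-- The bordered matrix with central block `X`, last column `x` and upper right corner `s`, and with
first row determined by skew-Hermitian symmetry. -/
def border (X : Matrix (Block p n) (Block p n) K) (x : Block p n → K) (s : K) :
    Matrix (Block p (n + 1)) (Block p (n + 1)) K :=
  Matrix.of fun i j => ((blockEquiv p n).symm i).elim
    (((blockEquiv p n).symm j).elim 0 fun o => o.elim s fun j => -conjVec F x j) fun o =>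
    o.elim 0 fun i => ((blockEquiv p n).symm j).elim 0 fun o => o.elim (x i) fun j => X i j

variable {X : Matrix (Block p n) (Block p n) K} {x : Block p n → K} {s : K}

@[simp] theorem border_top_apply (j) : border F X x s (topIdx p n) j = 0 := by simp [border]

@[simp] theorem border_apply_bot (i) : border F X x s i (botIdx p n) = 0 := by
  rcases block_cases i with rfl | ⟨i, rfl⟩ | rfl <;> simp [border]

@[simp] theorem border_bot_top : border F X x s (botIdx p n) (topIdx p n) = s := by simp [border]

@[simp] theorem border_bot_incl (j) :
    border F X x s (botIdx p n) (incl j) = -conjVec F x j := by simp [border]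

@[simp] theorem border_incl_top (i) : border F X x s (incl i) (topIdx p n) = x i := by
  simp [border]

@[simp] theorem border_incl_incl (i j) : border F X x s (incl i) (incl j) = X i j := by
  simp [border]

variable (X x s) in
theorem isBordered_border : IsBordered (border F X x s) :=
  ⟨border_top_apply F, border_apply_bot F⟩

variable (X x s) in
@[simp] theorem shrink_border : shrink (border F X x s) = X := by
  ext i j
  simp

variable {F}

theorem isSkewHermitian_border (hK : Module.finrank F K = 2) (hX : IsSkewHermitian F X)
    (hs : frob F s = -s) : IsSkewHermitian F (border F X x s) := by
  intro a b
  rcases block_cases a with rfl | ⟨a, rfl⟩ | rfl <;>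
    rcases block_cases b with rfl | ⟨b, rfl⟩ | rfl <;>
    simp [hs, conjVec, frob_neg, frob_frob hK, neg_neg_block]
  exact hX a b

/-- The symmetry couples the entries `(a, b)` and `(-b, -a)`, so the first row is determined by the
last column. -/
theorem eq_border {Y : Matrix (Block p (n + 1)) (Block p (n + 1)) K} (hY : IsSkewHermitian F Y)
    (hb : IsBordered Y) :
    Y = border F (shrink Y) (fun i => Y (incl i) (topIdx p n)) (Y (botIdx p n) (topIdx p n)) := by
  ext i j
  rcases block_cases i with rfl | ⟨i, rfl⟩ | rfl
  · rcases block_cases j with rfl | ⟨j, rfl⟩ | rfl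
    · simp [hb.2]
    · have := hY (incl (-j)) (topIdx p n)
      rw [neg_incl, neg_neg_block, neg_topIdx] at this
      simp [this, conjVec]
    · simp
  · rcases block_cases j with rfl | ⟨j, rfl⟩ | rfl
    · simp [hb.2]
    · simp
    · simp
  · simp [hb.1]

/-- The upper right corner is fixed by `(a, b) ↦ (-b, -a)`. -/
theorem frob_apply_bot_top {Y : Matrix (Block p (n + 1)) (Block p (n + 1)) K}
    (hY : IsSkewHermitian F Y) :
    frob F (Y (botIdx p n) (topIdx p n)) = -Y (botIdx p n) (topIdx p n) := by
  have := hY (botIdx p n) (topIdx p n)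
  rw [neg_botIdx, neg_topIdx] at this
  rw [this, neg_neg, ← this]

theorem border_mulVec (w : K × (Block p n → K) × K) :
    border F X x s *ᵥ packVec w =
      packVec (s * w.2.2 - conjVec F x ⬝ᵥ w.2.1, X *ᵥ w.2.1 + w.2.2 • x, 0) := by
  funext i
  rcases block_cases i with rfl | ⟨i, rfl⟩ | rfl
  · simp [mulVec, dotProduct, sum_block, sub_eq_add_neg]
  · simp [mulVec, dotProduct, sum_block, add_comm, mul_comm]
  · simp [mulVec, dotProduct]

/-- The dimension of the kernel of a bordered matrix, from a parametrization of the kernel. -/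
theorem nullity_border {W : Type*} [AddCommGroup W] [Module K W]
    (g : W →ₗ[K] (Block p n → K) × K) (hg : Function.Injective g)
    (h : ∀ v b, (X *ᵥ v + b • x = 0 ∧ s * b = conjVec F x ⬝ᵥ v) ↔ ∃ w, g w = (v, b)) :
    nullity (border F X x s) = Module.finrank K W + 1 := by
  have : FiniteDimensional K W := FiniteDimensional.of_injective g hg
  -- The first coordinate of a vector only meets the zero column, so it is free in the kernel and
  -- accounts for the summand `1`.
  let g' : (K × W) →ₗ[K] (Block p (n + 1) → K) :=
    packVec.toLinearMap ∘ₗ LinearMap.prodMap LinearMap.id g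
  have hg' : Function.Injective g' := by
    refine packVec.injective.comp ?_
    rintro ⟨a, w⟩ ⟨a', w'⟩ hw
    simp only [LinearMap.prodMap_apply, LinearMap.id_apply, Prod.mk.injEq] at hw
    rw [hw.1, hg hw.2]
  have hker : LinearMap.ker (border F X x s).mulVecLin = LinearMap.range g' := by
    ext v
    obtain ⟨⟨a, v, b⟩, rfl⟩ := packVec.surjective v
    rw [LinearMap.mem_ker, mulVecLin_apply, border_mulVec, LinearEquiv.map_eq_zero_iff,
      Prod.mk_eq_zero, Prod.mk_eq_zero, sub_eq_zero]
    have := h v b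
    constructor
    · rintro ⟨h1, h2, -⟩
      obtain ⟨w, hw⟩ := this.1 ⟨h2, h1⟩
      exact ⟨(a, w), by simp [g', hw]⟩
    · rintro ⟨⟨a', w⟩, hw⟩
      have hw' := packVec.injective hw
      simp only [LinearMap.prodMap_apply, Prod.mk.injEq] at hw'
      have := this.2 ⟨w, hw'.2⟩
      exact ⟨this.2, this.1, rfl⟩
  rw [nullity, hker, LinearMap.finrank_range_of_inj hg', Module.finrank_prod, Module.finrank_self,
    add_comm]

/-- A kernel vector `(a, v, b)` satisfies `X v = -b x`, which forces `b = 0`; then `v` lies in the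
hyperplane of `ker X` orthogonal to `x`. The dimension lost there balances the free coordinate `a`.
-/
theorem nullity_border_of_notMem (hK : Module.finrank F K = 2) (hX : IsSkewHermitian F X)
    (hx : ¬ ∃ u, X *ᵥ u = x) : nullity (border F X x s) = nullity X := by
  let φ : Module.Dual K (LinearMap.ker X.mulVecLin) :=
    (dotProductEquiv K (Block p n) (conjVec F x)) ∘ₗ (LinearMap.ker X.mulVecLin).subtype
  -- If `x` were orthogonal to the whole kernel, it would lie in the image.
  have hφ : φ ≠ 0 := fun h0 => hx <| hX.mem_range_of_orthogonal hK fun v hv =>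
    DFunLike.congr_fun h0 ⟨v, hv⟩
  rw [nullity.eq_1 X, ← Module.Dual.finrank_ker_add_one_of_ne_zero hφ]
  refine nullity_border (W := LinearMap.ker φ) (LinearMap.inl K _ _ ∘ₗ
    (LinearMap.ker X.mulVecLin).subtype ∘ₗ
    (LinearMap.ker φ).subtype) ?_ fun v b => ?_
  · exact LinearMap.inl_injective.comp
      (Subtype.val_injective.comp Subtype.val_injective)
  · constructor
    · rintro ⟨h1, h2⟩
      have hb : b = 0 := by
        by_contra hb
        refine hx ⟨-(b⁻¹ • v), ?_⟩
        rw [mulVec_neg, mulVec_smul, eq_neg_of_add_eq_zero_left h1, smul_neg, neg_neg,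
          inv_smul_smul₀ hb]
      subst hb
      rw [zero_smul, add_zero] at h1
      rw [mul_zero] at h2
      exact ⟨⟨⟨v, h1⟩, h2.symm⟩, rfl⟩
    · rintro ⟨w, hw⟩
      obtain ⟨rfl, rfl⟩ := Prod.mk.inj hw
      refine ⟨?_, ?_⟩
      · rw [LinearMap.zero_apply, zero_smul, add_zero]
        exact w.1.2
      · rw [LinearMap.zero_apply, mul_zero]
        exact (w.2 : φ w.1 = 0).symm

theorem IsSkewHermitian.dotProduct_of_mem_ker (hX : IsSkewHermitian F X) (u : Block p n → K)
    {k : Block p n → K} (hk : X *ᵥ k = 0) : conjVec F (X *ᵥ u) ⬝ᵥ k = 0 := by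
  rw [hX.conjVec_mulVec_dotProduct, hk, dotProduct_zero, neg_zero]

/-- For a kernel vector `(a, v, b)`, the vector `k = v + b u` is in `ker X`, hence orthogonal to `X
u`. The remaining equation becomes `(s + τ(X u, u)) b = 0`, so that `b = 0`. -/
theorem nullity_border_of_ne (hX : IsSkewHermitian F X) (u : Block p n → K)
    (hs : s ≠ -(conjVec F (X *ᵥ u) ⬝ᵥ u)) :
    nullity (border F X (X *ᵥ u) s) = nullity X + 1 := by
  refine nullity_border (LinearMap.inl K _ _ ∘ₗ (LinearMap.ker X.mulVecLin).subtype)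
    (LinearMap.inl_injective.comp Subtype.val_injective) fun v b => ?_
  constructor
  · rintro ⟨h1, h2⟩
    rw [← mulVec_smul, ← mulVec_add] at h1
    have h3 := hX.dotProduct_of_mem_ker u h1
    rw [dotProduct_add, ← h2, dotProduct_smul, smul_eq_mul, mul_comm b, ← add_mul,
      mul_eq_zero] at h3
    have hb : b = 0 := h3.resolve_left fun h => hs (eq_neg_of_add_eq_zero_left h)
    subst hb
    rw [zero_smul, add_zero] at h1
    exact ⟨⟨v, h1⟩, rfl⟩
  · rintro ⟨w, hw⟩
    obtain ⟨rfl, rfl⟩ := Prod.mk.inj hw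
    refine ⟨?_, ?_⟩
    · rw [LinearMap.zero_apply, zero_smul, add_zero]
      exact w.2
    · rw [LinearMap.zero_apply, mul_zero]
      exact (hX.dotProduct_of_mem_ker u w.2).symm

/-- For this corner the equation `(s + τ(X u, u)) b = 0` is void, and `b` is a further free
parameter, with `v = k - b u` and `k ∈ ker X`. -/
theorem nullity_border_of_eq (hX : IsSkewHermitian F X) (u : Block p n → K) :
    nullity (border F X (X *ᵥ u) (-(conjVec F (X *ᵥ u) ⬝ᵥ u))) = nullity X + 2 := by
  have h := nullity_border (F := F) (X := X) (x := X *ᵥ u) (s := -(conjVec F (X *ᵥ u) ⬝ᵥ u))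
    (((LinearMap.ker X.mulVecLin).subtype.coprod (-LinearMap.toSpanSingleton K _ u)).prod
      (LinearMap.snd K _ K)) ?_ fun v b => ?_
  · rw [h, Module.finrank_prod, Module.finrank_self]
    rfl
  · rintro ⟨k, b⟩ ⟨k', b'⟩ hw
    obtain ⟨h1, rfl⟩ := Prod.mk.inj hw
    simpa using h1
  · constructor
    · rintro ⟨h1, -⟩
      rw [← mulVec_smul, ← mulVec_add] at h1
      exact ⟨(⟨v + b • u, h1⟩, b), by simp⟩
    · rintro ⟨⟨k, b'⟩, hw⟩
      obtain ⟨rfl, rfl⟩ := Prod.mk.inj hw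
      have hk : X *ᵥ k.1 = 0 := k.2
      simp [mulVec_add, mulVec_neg, mulVec_smul, hk, hX.dotProduct_of_mem_ker u hk, mul_comm]

/-- The exceptional corner is one of the admissible values, those with `s̄ = -s`. -/
theorem frob_neg_dotProduct (hK : Module.finrank F K = 2) (hX : IsSkewHermitian F X)
    (u : Block p n → K) : frob F (-(conjVec F (X *ᵥ u) ⬝ᵥ u)) =
      - -(conjVec F (X *ᵥ u) ⬝ᵥ u) := by
  rw [frob_neg, frob_conjVec_dotProduct hK, hX.conjVec_mulVec_dotProduct, neg_neg]

end Nullity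

/-! ### The sum over all bordered extensions -/

section Counting

variable {F : Type*} [Field F] [Fintype F] {K : Type*} [Field K] [Fintype K] [Algebra F K]
  {p : Parity} {n : ℕ}

open Classical in
variable (F K) in
/-- The elements `s` with `s̄ = -s`. -/
def antiFixed : Finset K := {s | frob F s = -s}

@[simp] theorem mem_antiFixed {s : K} : s ∈ antiFixed F K ↔ frob F s = -s := by
  simp [antiFixed]

/-- The fixed points of `x ↦ x ^ q` are the elements of `F`. -/
theorem frob_eq_self_iff {x : K} : frob F x = x ↔ ∃ y, algebraMap F K y = x := by
  classical
  refine ⟨fun hx => ?_, fun ⟨y, hy⟩ => hy ▸ frob_algebraMap F y⟩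
  have hq : 1 < Fintype.card F := Fintype.one_lt_card
  have hne := FiniteField.X_pow_card_sub_X_ne_zero K hq
  set R := (Polynomial.X ^ Fintype.card F - Polynomial.X : Polynomial K).roots.toFinset
  have hmem : ∀ z, z ∈ R ↔ frob F z = z := fun z => by
    rw [Multiset.mem_toFinset, Polynomial.mem_roots hne, frob_eq_pow]
    simp [sub_eq_zero]
  -- `X^q - X` has at most `q` roots in `K`, and the `q` elements of `F` are among them.
  have hle : #R ≤ #(univ.image (algebraMap F K)) := by
    rw [card_image_of_injective _ (FaithfulSMul.algebraMap_injective F K), card_univ]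
    exact (Multiset.toFinset_card_le _).trans ((Polynomial.card_roots' _).trans
      (FiniteField.X_pow_card_sub_X_natDegree_eq K hq).le)
  have heq := eq_of_subset_of_card_le (fun z hz => by
    obtain ⟨y, -, rfl⟩ := mem_image.1 hz
    exact (hmem _).2 (frob_algebraMap F y)) hle
  rw [← hmem, ← heq] at hx
  simpa using hx

/-- Since `q < q^2`, some `a` has `ā ≠ a`. Then `d = a - ā` is nonzero with `d̄ = -d`, and division
by `d` identifies the set with `F`. -/
theorem card_antiFixed (hK : Module.finrank F K = 2) : #(antiFixed F K) = Fintype.card F := by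
  classical
  have hq : 1 < Fintype.card F := Fintype.one_lt_card
  have hinj := FaithfulSMul.algebraMap_injective F K
  obtain ⟨a, ha⟩ : ∃ a : K, frob F a ≠ a := by
    by_contra! h
    have h1 := Fintype.card_le_of_surjective (algebraMap F K) fun x => frob_eq_self_iff.1 (h x)
    rw [card_eq_sq hK] at h1
    nlinarith
  have hd : a - frob F a ≠ 0 := sub_ne_zero.2 ha.symm
  set d := a - frob F a with hd'
  have hfd : frob F d = -d := by
    rw [hd', frob_sub, frob_frob hK, neg_sub]
  have himg : antiFixed F K = univ.image fun y : F => algebraMap F K y * d := by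
    ext s
    simp only [mem_antiFixed, mem_image, mem_univ, true_and]
    constructor
    · intro hs
      obtain ⟨y, hy⟩ := frob_eq_self_iff (F := F).1 (show frob F (s / d) = s / d by
        rw [frob_eq_pow, div_pow, ← frob_eq_pow, ← frob_eq_pow, hs, hfd, neg_div_neg_eq])
      exact ⟨y, by rw [hy, div_mul_cancel₀ _ hd]⟩
    · rintro ⟨y, rfl⟩
      rw [frob_mul, hfd, frob_algebraMap F, mul_neg]
  rw [himg, card_image_of_injective _ fun y z h => hinj (mul_right_cancel₀ hd h), card_univ]

open Classical in
-- The last column `x` and the corner `s` are free coordinates on the set of bordered skew-Hermitian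
-- extensions of `X`.
theorem sum_bordered (hK : Module.finrank F K = 2) {M : Type*} [AddCommMonoid M]
    {X : Matrix (Block p n) (Block p n) K}
    (hX : IsSkewHermitian F X) (g : Matrix (Block p (n + 1)) (Block p (n + 1)) K → M) :
    ∑ Y with IsSkewHermitian F Y ∧ IsBordered Y ∧ shrink Y = X, g Y =
      ∑ x, ∑ s ∈ antiFixed F K, g (border F X x s) := by
  rw [← sum_product']
  symm
  refine sum_nbij' (fun w => border F X w.1 w.2)
    (fun Y => (fun i => Y (incl i) (topIdx p n), Y (botIdx p n) (topIdx p n))) ?_ ?_ ?_ ?_ ?_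
  · rintro ⟨x, s⟩ h
    simp only [mem_product, mem_univ, mem_antiFixed, true_and] at h
    simp [isSkewHermitian_border hK hX h, isBordered_border]
  · intro Y h
    simp only [mem_filter, mem_univ, true_and] at h
    simp [frob_apply_bot_top h.1]
  · rintro ⟨x, s⟩ -
    simp
  · intro Y h
    simp only [mem_filter, mem_univ, true_and] at h
    rw [← h.2.2]
    exact (eq_border h.1 h.2.1).symm
  · simp

theorem sum_antiFixed_of_mem (hK : Module.finrank F K = 2) {X : Matrix (Block p n) (Block p n) K}
    (hX : IsSkewHermitian F X) (f : ℕ → ℝ) (u : Block p n → K) :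
    ∑ s ∈ antiFixed F K, f (nullity (border F X (X *ᵥ u) s)) =
      f (nullity X + 2) + (Fintype.card F - 1) * f (nullity X + 1) := by
  classical
  have hmem : -(conjVec F (X *ᵥ u) ⬝ᵥ u) ∈ antiFixed F K :=
    mem_antiFixed.2 (frob_neg_dotProduct hK hX u)
  rw [← add_sum_erase _ _ hmem, nullity_border_of_eq hX,
    sum_congr rfl (g := fun _ => f (nullity X + 1)) fun s hs => by
      rw [nullity_border_of_ne hX u (ne_of_mem_erase hs)],
    sum_const, card_erase_of_mem hmem, card_antiFixed hK, nsmul_eq_mul,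
    Nat.cast_pred Fintype.card_pos]

theorem sum_antiFixed_of_notMem (hK : Module.finrank F K = 2)
    {X : Matrix (Block p n) (Block p n) K}
    (hX : IsSkewHermitian F X) (f : ℕ → ℝ) {x : Block p n → K} (hx : ¬ ∃ u, X *ᵥ u = x) :
    ∑ s ∈ antiFixed F K, f (nullity (border F X x s)) = Fintype.card F * f (nullity X) := by
  rw [sum_congr rfl (g := fun _ => f (nullity X)) fun s _ => by
      rw [nullity_border_of_notMem hK hX hx], sum_const, card_antiFixed hK, nsmul_eq_mul]

/-- The number of vectors in the image of `X`. -/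
theorem card_range_mulVec (hK : Module.finrank F K = 2) (X : Matrix (Block p n) (Block p n) K)
    [DecidablePred fun x => ∃ u, X *ᵥ u = x] :
    #{x | ∃ u, X *ᵥ u = x} * Fintype.card F ^ (2 * nullity X) =
      Fintype.card F ^ (2 * dim p n) := by
  have h1 : #{x | ∃ u, X *ᵥ u = x} = Nat.card (LinearMap.range X.mulVecLin) := by
    rw [← Fintype.card_subtype, ← Nat.card_eq_fintype_card]
    rfl
  have h2 : Nat.card (LinearMap.range X.mulVecLin) =
      Fintype.card K ^ Module.finrank K (LinearMap.range X.mulVecLin) := by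
    rw [Module.natCard_eq_pow_finrank (K := K), Nat.card_eq_fintype_card]
  have h3 := LinearMap.finrank_range_add_finrank_ker X.mulVecLin
  rw [Module.finrank_pi, card_block] at h3
  rw [h1, h2, card_eq_sq hK, ← pow_mul, ← pow_add, ← mul_add, nullity, h3]

/-- A function `f` of the dimension `l` of the kernel such that the sum of `f` over all bordered
extensions of a matrix is proportional to `f`. -/
def IsNullityHarmonic (t u : ℝ) (f : ℕ → ℝ) : Prop :=
  ∀ l, (1 - t ^ (2 * l)) * f l + t ^ (2 * l) * (-t * f (l + 2) + (1 + t) * f (l + 1)) =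
    (1 - u) * f l

/-- Let `l` be the nullity of `X` and `N` its size. Each of the `q^(2(N-l))` columns in the image
contributes `f(l+2) + (q-1) f(l+1)`, every other column `q f(l)`. Dividing by `q^(2N+1)` and writing
`t = -1/q` gives the left side of `IsNullityHarmonic`. -/
theorem sum_border (hK : Module.finrank F K = 2) {X : Matrix (Block p n) (Block p n) K}
    (hX : IsSkewHermitian F X) {u : ℝ} {f : ℕ → ℝ}
    (hf : IsNullityHarmonic (-(Fintype.card F : ℝ)⁻¹) u f) :
    ∑ x, ∑ s ∈ antiFixed F K, f (nullity (border F X x s)) =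
      (Fintype.card F : ℝ) ^ (2 * dim p n + 1) * (1 - u) * f (nullity X) := by
  classical
  have hq : (Fintype.card F : ℝ) ≠ 0 := Nat.cast_ne_zero.2 Fintype.card_ne_zero
  have hr := card_range_mulVec hK X
  have hc := card_filter_add_card_filter_not (s := univ) (fun x => ∃ u, X *ᵥ u = x)
  rw [card_univ, Fintype.card_fun, card_block, card_eq_sq hK, ← pow_mul] at hc
  rw [← sum_filter_add_sum_filter_not univ (fun x => ∃ u, X *ᵥ u = x),
    sum_congr rfl (g := fun _ => f (nullity X + 2) + (Fintype.card F - 1) * f (nullity X + 1))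
      fun x hx => by
        obtain ⟨u, rfl⟩ := (mem_filter.1 hx).2
        exact sum_antiFixed_of_mem hK hX f u,
    sum_congr (s₁ := {x | ¬ ∃ u, X *ᵥ u = x}) rfl (g := fun _ => Fintype.card F * f (nullity X))
      fun x hx => sum_antiFixed_of_notMem hK hX f (mem_filter.1 hx).2,
    sum_const, sum_const, nsmul_eq_mul, nsmul_eq_mul]
  have h := hf (nullity X)
  have hr' : (#{x | ∃ u, X *ᵥ u = x} : ℝ) =
      (Fintype.card F : ℝ) ^ (2 * dim p n) * (-(Fintype.card F : ℝ)⁻¹) ^ (2 * nullity X) := by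
    rw [pow_mul (-_), neg_sq, ← pow_mul, inv_pow, eq_mul_inv_iff_mul_eq₀ (by positivity)]
    exact_mod_cast hr
  have hc' : (#{x | ¬ ∃ u, X *ᵥ u = x} : ℝ) =
      (Fintype.card F : ℝ) ^ (2 * dim p n) - #{x | ∃ u, X *ᵥ u = x} := by
    rw [eq_sub_iff_add_eq, add_comm]
    exact_mod_cast hc
  rw [hc', hr', pow_succ, mul_assoc (_ * _), ← h]
  generalize (-(Fintype.card F : ℝ)⁻¹) ^ (2 * nullity X) = a
  field_simp
  ring

end Counting

end

end PronilHL

namespace PronilHL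

noncomputable section

open Finset Matrix

/-! ### Jordan types of nilpotent matrices -/

section Jordan

variable {K : Type*} [Field K]

open Polynomial in
/-- The basis `1, X, …, X ^ (k - 1)` of `K[X] / (X ^ k)`. -/
theorem exists_basis_quotient_X_pow (k : ℕ) :
    ∃ b : Module.Basis (Fin k) K (K[X] ⧸ Submodule.span K[X] {(X : K[X]) ^ k}),
      ∀ j, b j = Submodule.Quotient.mk (X ^ (j : ℕ)) := by
  have hm : (X ^ k : K[X]).Monic := monic_X_pow k
  have hd : (AdjoinRoot.powerBasis' hm).dim = k := natDegree_X_pow k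
  let b : Module.Basis (Fin k) K (AdjoinRoot (X ^ k : K[X])) :=
    (AdjoinRoot.powerBasis' hm).basis.reindex (finCongr hd)
  refine ⟨b, fun j => ?_⟩
  have h : b j = AdjoinRoot.mk (X ^ k) (X ^ (j : ℕ)) := by simp [b]
  exact h

/-- A nilpotent endomorphism is a direct sum of Jordan blocks. -/
theorem exists_jordan_basis {V : Type*} [AddCommGroup V] [Module K V] [FiniteDimensional K V]
    {f : V →ₗ[K] V} (hf : IsNilpotent f) :
    ∃ (d : ℕ) (k : Fin d → ℕ) (b : Module.Basis (Σ i, Fin (k i)) K V),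
      (∀ i (j : Fin (k i)) (h : (j : ℕ) + 1 < k i), f (b ⟨i, j⟩) = b ⟨i, ⟨j + 1, h⟩⟩) ∧
      ∀ i (j : Fin (k i)), (j : ℕ) + 1 = k i → f (b ⟨i, j⟩) = 0 := by
  obtain ⟨r, hr⟩ := hf
  -- Let `X` act on `V` as `f`. Nilpotency makes this `K[X]`-module torsion for the powers of the
  -- prime `X`, so it is a direct sum of modules `K[X] / (X^k)`.
  have htors : Module.IsTorsion' (Module.AEval' f) (Submonoid.powers (Polynomial.X : Polynomial K)) := by
    intro m
    refine ⟨⟨Polynomial.X ^ r, r, rfl⟩, ?_⟩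
    obtain ⟨m, rfl⟩ := (Module.AEval'.of f).surjective m
    change (Polynomial.X ^ r : Polynomial K) • Module.AEval'.of f m = 0
    rw [Module.AEval'.X_pow_smul_of, hr, zero_smul, map_zero]
  obtain ⟨d, k, ⟨e⟩⟩ := Module.torsion_by_prime_power_decomposition Polynomial.irreducible_X htors
  choose c hc using fun i => exists_basis_quotient_X_pow (K := K) (k i)
  let e1 := e.trans (DirectSum.linearEquivFunOnFintype (Polynomial K) (Fin d) fun i =>
    Polynomial K ⧸ Submodule.span (Polynomial K) {(Polynomial.X : Polynomial K) ^ k i})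
  let b := (Pi.basis c).map ((Module.AEval'.of f).trans (e1.restrictScalars K)).symm
  have hb : ∀ i j, b ⟨i, j⟩ = (Module.AEval'.of f).symm (e1.symm (Pi.single i
      (Submodule.Quotient.mk (Polynomial.X ^ (j : ℕ))))) := fun i j => by
    simp only [b, Module.Basis.map_apply, Pi.basis_apply, hc]
    rfl
  have hX : ∀ i j, f (b ⟨i, j⟩) = (Module.AEval'.of f).symm (e1.symm (Pi.single i
      (Submodule.Quotient.mk (Polynomial.X ^ ((j : ℕ) + 1))))) := fun i j => by
    rw [hb, ← Module.AEval'.of_symm_X_smul, ← map_smul, ← Pi.single_smul, ← Submodule.Quotient.mk_smul,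
      smul_eq_mul, ← pow_succ']
  refine ⟨d, k, b, fun i j h => by rw [hX, hb], fun i j h => ?_⟩
  rw [hX, h, (Submodule.Quotient.mk_eq_zero _).2 (Submodule.mem_span_singleton_self _),
    Pi.single_zero, map_zero, map_zero]

/-- The Young diagram with the rows of lengths `k 0 ≥ k 1 ≥ …`. -/
def diagramOfAntitone {d : ℕ} (k : Fin d → ℕ) (hk : Antitone k) : YoungDiagram where
  cells := (univ.sigma fun i => (univ : Finset (Fin (k i)))).image fun c => ((c.1 : ℕ), (c.2 : ℕ))
  isLowerSet := by
    rintro ⟨i, j⟩ ⟨i', j'⟩ ⟨hi, hj⟩ h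
    simp only [coe_image, Set.mem_image, mem_coe, mem_sigma, mem_univ, and_self, true_and,
      Prod.mk.injEq] at h ⊢
    obtain ⟨⟨a, b⟩, rfl, rfl⟩ := h
    have hi' : i' < d := lt_of_le_of_lt hi a.2
    exact ⟨⟨⟨i', hi'⟩, ⟨j', (lt_of_le_of_lt hj b.2).trans_le (hk (a := ⟨i', hi'⟩) hi)⟩⟩, rfl, rfl⟩

theorem mem_diagramOfAntitone {d : ℕ} {k : Fin d → ℕ} {hk : Antitone k} {c : ℕ × ℕ} :
    c ∈ (diagramOfAntitone k hk).cells ↔ ∃ h : c.1 < d, c.2 < k ⟨c.1, h⟩ := by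
  obtain ⟨i, j⟩ := c
  simp only [diagramOfAntitone, mem_image, mem_sigma, mem_univ, and_self, true_and, Prod.mk.injEq]
  constructor
  · rintro ⟨⟨a, b⟩, rfl, rfl⟩
    exact ⟨a.2, b.2⟩
  · rintro ⟨h, h'⟩
    exact ⟨⟨⟨i, h⟩, ⟨j, h'⟩⟩, rfl, rfl⟩

theorem exists_hasJordanType {ι : Type} [Fintype ι] [DecidableEq ι] {X : Matrix ι ι K}
    (hX : IsNilpotent X) : ∃ μ, HasJordanType X μ := by
  have hf : IsNilpotent (Matrix.toLin' X) := by
    obtain ⟨r, hr⟩ := hX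
    exact ⟨r, by rw [← toLin'_pow, hr, map_zero]⟩
  obtain ⟨d, k, b, h1, h2⟩ := exists_jordan_basis hf
  -- Sorting in the dual order lists the chains by decreasing length.
  let σ : Equiv.Perm (Fin d) := Tuple.sort fun i => OrderDual.toDual (k i)
  have hσ : Antitone (k ∘ σ) := fun i j hij =>
    OrderDual.toDual_le_toDual.1 (Tuple.monotone_sort (fun i => OrderDual.toDual (k i)) hij)
  let μ := diagramOfAntitone (k ∘ σ) hσ
  have hμ : ∀ c, c ∈ μ.cells ↔ ∃ h : c.1 < d, c.2 < k (σ ⟨c.1, h⟩) := fun c => mem_diagramOfAntitone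
  -- The chains of `b` run upwards and end in the kernel, whereas a Jordan type moves boxes to the
  -- left; each chain is therefore reversed, `j ↦ k - 1 - j`.
  let e : (Σ i, Fin (k i)) ≃ μ.cells :=
    { toFun := fun c => ⟨((σ.symm c.1 : ℕ), k c.1 - 1 - c.2), (hμ _).2 ⟨(σ.symm c.1).2, by
        have := c.2.2
        simp only [Fin.eta, Equiv.apply_symm_apply]
        omega⟩⟩
      invFun := fun c => ⟨σ ⟨c.1.1, ((hμ _).1 c.2).1⟩,
        ⟨k (σ ⟨c.1.1, ((hμ _).1 c.2).1⟩) - 1 - c.1.2, by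
          have := ((hμ _).1 c.2).2
          omega⟩⟩
      left_inv := by
        rintro ⟨i, j⟩
        have := j.2
        have h : ∀ i' : Fin d, i' = i → ∀ hlt : k i' - 1 - (k i - 1 - j) < k i',
            (⟨i', ⟨k i' - 1 - (k i - 1 - j), hlt⟩⟩ : Σ i, Fin (k i)) = ⟨i, j⟩ := by
          rintro i' rfl hlt
          congr 1
          ext
          simp only
          omega
        exact h _ (by simp) _
      right_inv := by
        rintro ⟨⟨i, j⟩, hc⟩
        obtain ⟨h, h'⟩ := (hμ _).1 hc
        simp only at h h'
        ext
        · simp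
        · simp only
          omega }
  refine ⟨μ, b.reindex e, fun i h => ?_, fun i j h h' => ?_⟩
  · obtain ⟨hd, hk⟩ := (hμ _).1 h
    simp only at hd hk
    rw [Module.Basis.reindex_apply, ← toLin'_apply]
    refine h2 _ _ ?_
    simp only
    omega
  · obtain ⟨hd, hk⟩ := (hμ _).1 h
    simp only at hd hk
    rw [Module.Basis.reindex_apply, Module.Basis.reindex_apply, ← toLin'_apply]
    refine (h1 _ _ ?_).trans ?_
    · simp only
      omega
    · congr 2
      refine Fin.ext ?_
      simp only
      omega

section

variable {ι : Type} [Fintype ι] {X : Matrix ι ι K} {μ : YoungDiagram}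

theorem HasJordanType.card_eq (h : HasJordanType X μ) : μ.card = Fintype.card ι := by
  obtain ⟨b, -⟩ := h
  have := Module.finrank_eq_card_basis b
  rw [Module.finrank_pi, Fintype.card_coe] at this
  exact this.symm

/-- `X ^ r` kills the boxes in the first `r` columns, and every row has length at most `|μ|`. -/
theorem HasJordanType.isNilpotent [DecidableEq ι] (h : HasJordanType X μ) : IsNilpotent X := by
  obtain ⟨b, h0, h1⟩ := h
  have key : ∀ r i j (h : (i, j) ∈ μ.cells), j < r → (X ^ r) *ᵥ b ⟨(i, j), h⟩ = 0 := by
    intro r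
    induction r with
    | zero => intro i j h hj; omega
    | succ r ih =>
      intro i j h hj
      rw [pow_succ, ← mulVec_mulVec]
      cases j with
      | zero => rw [h0, mulVec_zero]
      | succ j =>
        have h' : (i, j) ∈ μ.cells := μ.up_left_mem le_rfl (Nat.le_succ j) h
        rw [h1 i j h h']
        exact ih i j h' (by omega)
  refine ⟨μ.card, toLin'.injective (b.ext ?_)⟩
  rintro ⟨⟨i, j⟩, h⟩
  rw [toLin'_apply, map_zero, LinearMap.zero_apply]
  refine key _ i j h ?_
  exact (YoungDiagram.mem_iff_lt_rowLen.1 h).trans_le (rowLen_le_card μ i)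

/-- The image is spanned by the basis vectors of the boxes that have a right neighbour; these are as
many as the boxes outside the first column. -/
theorem HasJordanType.nullity_eq (h : HasJordanType X μ) : nullity X = μ.colLen 0 := by
  classical
  have hcard := h.card_eq
  obtain ⟨b, h0, h1⟩ := h
  let S : Finset μ.cells := {c | (c.1.1, c.1.2 + 1) ∈ μ.cells}
  have hrange : LinearMap.range X.mulVecLin = Submodule.span K 
      (Set.range (b ∘ (Subtype.val : S → μ.cells))) := by
    refine le_antisymm ?_ (Submodule.span_le.2 ?_)
    · rw [LinearMap.range_eq_map, ← b.span_eq, Submodule.map_span, Submodule.span_le]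
      rintro _ ⟨_, ⟨⟨⟨i, j⟩, hc⟩, rfl⟩, rfl⟩
      cases j with
      | zero => simp [h0]
      | succ j =>
        have h' : (i, j) ∈ μ.cells := μ.up_left_mem le_rfl (Nat.le_succ j) hc
        rw [mulVecLin_apply, h1 i j hc h']
        exact Submodule.subset_span ⟨⟨⟨(i, j), h'⟩, by simpa [S] using hc⟩, rfl⟩
    · rintro _ ⟨⟨⟨⟨i, j⟩, hc⟩, hS⟩, rfl⟩
      have hS' : (i, j + 1) ∈ μ.cells := by simpa [S] using hS
      exact ⟨b ⟨(i, j + 1), hS'⟩, h1 i j hS' hc⟩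
  have hr := LinearMap.finrank_range_add_finrank_ker X.mulVecLin
  rw [hrange, finrank_span_eq_card (b.linearIndependent.comp _ Subtype.val_injective),
    Module.finrank_pi, ← hcard, Fintype.card_coe] at hr
  have hS : #S = #{c ∈ μ.cells | ¬ c.2 = 0} := by
    refine card_bij (fun c _ => (c.1.1, c.1.2 + 1)) ?_ ?_ ?_
    · rintro ⟨⟨i, j⟩, hc⟩ hS
      simpa [S] using hS
    · rintro ⟨⟨i, j⟩, hc⟩ _ ⟨⟨i', j'⟩, hc'⟩ _ h
      simpa using h
    · rintro ⟨i, j⟩ h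
      obtain ⟨hc, hj⟩ := mem_filter.1 h
      obtain ⟨j, rfl⟩ := Nat.exists_eq_succ_of_ne_zero hj
      exact ⟨⟨(i, j), μ.up_left_mem le_rfl (Nat.le_succ j) hc⟩, by simpa [S] using hc, rfl⟩
  have hcol : μ.colLen 0 = #{c ∈ μ.cells | c.2 = 0} := YoungDiagram.colLen_eq_card μ
  have := card_filter_add_card_filter_not (s := μ.cells) (fun c => c.2 = 0)
  rw [nullity, hcol]
  simp only [YoungDiagram.card] at hr
  omega

end

end Jordan

end

end PronilHL

namespace PronilHL

noncomputable section

open Finset Matrix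

/-! ### Cylinder sets -/

section Cylinders

variable {F : Type*} [Field F] [Fintype F] {K : Type*} {p : Parity}

theorem corner_eq_of_le {n m : ℕ} (h : n ≤ m) {A B : Matrix (Index p) (Index p) K}
    (hAB : corner m A = corner m B) : corner n A = corner n B := by
  have h' : (n : ℤ) ≤ m := by exact_mod_cast h
  ext i j
  exact congrFun (congrFun hAB ⟨i.1, i.2.trans h'⟩) ⟨j.1, j.2.trans h'⟩

theorem shrink_corner {n : ℕ} (A : Matrix (Index p) (Index p) K) :
    shrink (corner (n + 1) A) = corner n A := rfl

variable [Field K] [Algebra F K]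

theorem HasLevel.mono {n m : ℕ} (h : n ≤ m) {M : Matrix (Index p) (Index p) K}
    (hM : HasLevel n M) : HasLevel m M :=
  fun i j hij hm => hM i j hij (lt_of_le_of_lt (by exact_mod_cast h) hm)

theorem HasLevel.isBordered {n : ℕ} {A : Matrix (Index p) (Index p) K} (hA : HasLevel n A) :
    IsBordered (corner (n + 1) A) := by
  constructor
  · intro j
    refine hA _ _ ?_ (lt_max_of_lt_left ?_)
    · have := (abs_le.1 j.2).2
      push_cast at this
      exact this
    · change (n : ℤ) < |(n : ℤ) + 1|
      rw [abs_of_nonneg (by omega)]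
      omega
  · intro i
    refine hA _ _ ?_ (lt_max_of_lt_right ?_)
    · have := (abs_le.1 i.2).1
      push_cast at this
      exact this
    · change (n : ℤ) < |-((n : ℤ) + 1)|
      rw [abs_neg, abs_of_nonneg (by omega)]
      omega

/-- A position `i ≥ j` with `max (|i|, |j|) = n + 1` lies in the last row or in the first column of
the block. -/
theorem hasLevel_of_isBordered {n : ℕ} {A : Matrix (Index p) (Index p) K}
    (hA : HasLevel (n + 1) A) (hb : IsBordered (corner (n + 1) A)) : HasLevel n A := by
  intro i j hij hm
  rcases lt_or_ge ((n : ℤ) + 1) (max |i.1| |j.1|) with h | h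
  · exact hA i j hij (by exact_mod_cast h)
  · obtain ⟨hi, hj⟩ := max_le_iff.1 h
    have hij' : j.1 ≤ i.1 := hij
    have hi' := abs_le.1 hi
    have hj' := abs_le.1 hj
    have hm' : i.1 = n + 1 ∨ j.1 = -(n + 1) := by
      rcases lt_max_iff.1 hm with h1 | h1 <;> rcases lt_abs.1 h1 with h2 | h2 <;> omega
    rcases hm' with h1 | h1
    · have := hb.1 ⟨j, by exact_mod_cast hj⟩
      rwa [show topIdx p n = ⟨i, by exact_mod_cast hi⟩ from block_ext h1.symm] at this
    · have := hb.2 ⟨i, by exact_mod_cast hi⟩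
      rwa [show botIdx p n = ⟨j, by exact_mod_cast hj⟩ from block_ext h1.symm] at this

/-- Inside the block of size `m` the two matrices agree, and outside it `B` has no entries on or
below the diagonal. -/
theorem HasLevel.congr {n m : ℕ} {A B : Matrix (Index p) (Index p) K}
    (hA : HasLevel n A) (hB : HasLevel m B) (hAB : corner m B = corner m A) : HasLevel n B := by
  intro i j hij hm
  rcases lt_or_ge (m : ℤ) (max |i.1| |j.1|) with h1 | h1
  · exact hB i j hij h1
  · obtain ⟨hi, hj⟩ := max_le_iff.1 h1
    have := congrFun (congrFun hAB ⟨i, hi⟩) ⟨j, hj⟩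
    exact this.trans (hA i j hij hm)

theorem HasLevel.isNilpotent_corner_iff {n m : ℕ} (h : n ≤ m) {A : Matrix (Index p) (Index p) K}
    (hA : HasLevel n A) : IsNilpotent (corner m A) ↔ IsNilpotent (corner n A) := by
  induction m, h using Nat.le_induction with
  | base => rfl
  | succ m h ih => rw [← ih, (hA.mono h).isBordered.isNilpotent_iff, shrink_corner]

variable {n m : ℕ}

theorem mem_cylinder_self {M : LSpace F K p} (hM : HasLevel n M.1) :
    M ∈ cylinder F n (corner n M.1) := ⟨hM, rfl⟩

theorem cylinder_subset {M : LSpace F K p} (hM : HasLevel n M.1) (h : n ≤ m) :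
    cylinder F m (corner m M.1) ⊆ cylinder F n (corner n M.1) :=
  fun _ hB => ⟨hM.congr hB.1 hB.2, corner_eq_of_le h hB.2⟩

theorem isSkewHermitian_corner (M : LSpace F K p) : IsSkewHermitian F (corner n M.1) :=
  fun a b => M.2.1 a.1 b.1

theorem cylinder_nonempty {X : Matrix (Block p n) (Block p n) K} (hX : IsSkewHermitian F X) :
    (cylinder F n X).Nonempty := by
  let M : Matrix (Index p) (Index p) K := Matrix.of fun i j =>
    if h : |i.1| ≤ (n : ℤ) ∧ |j.1| ≤ (n : ℤ) then X ⟨i, h.1⟩ ⟨j, h.2⟩ else 0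
  have hMn : HasLevel n M := fun i j _ hm => dif_neg fun h' => not_le.2 hm (max_le h'.1 h'.2)
  have habs : ∀ a : Index p, |(-a).1| = |a.1| := fun a => abs_neg a.1
  refine ⟨⟨M, fun a b => ?_, n, hMn⟩, hMn, ?_⟩
  · by_cases h : |a.1| ≤ (n : ℤ) ∧ |b.1| ≤ (n : ℤ)
    · have h' : |(-b).1| ≤ (n : ℤ) ∧ |(-a).1| ≤ (n : ℤ) := by rw [habs, habs]; exact h.symm
      simp only [M, of_apply, dif_pos h, dif_pos h']
      exact hX ⟨a, h.1⟩ ⟨b, h.2⟩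
    · have h' : ¬ (|(-b).1| ≤ (n : ℤ) ∧ |(-a).1| ≤ (n : ℤ)) := by
        rw [habs, habs, and_comm]; exact h
      simp only [M, of_apply, dif_neg h, dif_neg h', frob_zero, neg_zero]
  · ext i j
    exact dif_pos ⟨i.2, j.2⟩

theorem cylinder_eq_empty {X : Matrix (Block p n) (Block p n) K} (hX : ¬ IsSkewHermitian F X) :
    cylinder F n X = ∅ :=
  Set.eq_empty_of_forall_notMem fun M hM => hX (hM.2 ▸ isSkewHermitian_corner M)

theorem isOpen_cylinder (X : Matrix (Block p n) (Block p n) K) : IsOpen (cylinder F n X) := by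
  rintro M ⟨hM, rfl⟩
  -- Basic neighbourhoods are indexed by `n ≥ 1`, whereas the cylinder may have `n = 0`.
  refine ⟨max n 1, le_max_right _ _, fun D hD => ⟨fun i j hij hm => ?_, ?_⟩⟩
  · have h1 := hM i j hij hm
    have h2 := hD.1 i j hij (lt_of_le_of_lt (by simp) hm)
    change M.1 i j + D.1 i j = 0
    rw [h1, h2, add_zero]
  · have h1 := corner_eq_of_le (le_max_left n 1) (hD.2.trans (show 0 = corner (max n 1) 0 from rfl))
    ext i j
    change M.1 i j + D.1 i j = M.1 i j
    rw [show D.1 i j = 0 from congrFun (congrFun h1 i) j, add_zero]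

theorem isSmall_sub {A B : LSpace F K p} (h : n ≤ m) (hA : HasLevel n A.1)
    (hB : HasLevel n B.1) (hAB : corner m A.1 = corner m B.1) : IsSmall F m (A - B) := by
  have key : ∀ i j, |i.1| ≤ (m : ℤ) → |j.1| ≤ (m : ℤ) → (A - B).1 i j = 0 := fun i j hi hj =>
    sub_eq_zero.2 (congrFun (congrFun hAB ⟨i, hi⟩) ⟨j, hj⟩)
  refine ⟨fun i j hij hm => ?_, ?_⟩
  · rcases lt_or_ge (n : ℤ) (max |i.1| |j.1|) with h1 | h1
    · change A.1 i j - B.1 i j = 0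
      rw [hA i j hij h1, hB i j hij h1, sub_zero]
    · have h' : (n : ℤ) ≤ m := by exact_mod_cast h
      obtain ⟨hi, hj⟩ := max_le_iff.1 h1
      exact key i j (hi.trans h') (hj.trans h')
  · ext i j
    exact key i j i.2 j.2

/-- Once `k` is at least a level of `M`, the members of the cylinder over the `k`-block of `M`
differ from `M` by elements of `𝕃_{-k}`. Cylinders over arbitrarily large blocks are thus a
neighbourhood basis. -/
theorem exists_cylinder_subset {U : Set (LSpace F K p)} (hU : IsOpen U) {M : LSpace F K p}
    (hM : M ∈ U) (n₀ : ℕ) :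
    ∃ k, n₀ ≤ k ∧ HasLevel k M.1 ∧ cylinder F k (corner k M.1) ⊆ U := by
  obtain ⟨n, -, hn⟩ := hU M hM
  obtain ⟨l, hl⟩ := M.2.2
  have h1 : l ≤ max n₀ (max n l) := by simp
  have h2 : n ≤ max n₀ (max n l) := by simp
  refine ⟨max n₀ (max n l), by simp, hl.mono h1, fun A hA => ?_⟩
  have h3 := isSmall_sub le_rfl hA.1 (hl.mono h1) hA.2
  have h4 := hn (A - M) ⟨h3.1, corner_eq_of_le h2 (h3.2.trans (show 0 = corner _ 0 from rfl))⟩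
  rwa [add_sub_cancel] at h4

theorem isCompact_cylinder [Finite K] (X : Matrix (Block p n) (Block p n) K) :
    IsCompact (cylinder F n X) := by
  rw [isCompact_iff_ultrafilter_le_nhds]
  intro U hU
  rw [Filter.le_principal_iff] at hU
  -- As `K` is finite, each entry is constant on some member of the ultrafilter. These constants are
  -- the entries of the limit, and each condition on it involves only finitely many of them at a
  -- time.
  have h1 : ∀ i j : Index p, ∃ a : K, {A : LSpace F K p | A.1 i j = a} ∈ U := fun i j => by
    obtain ⟨a, ha⟩ := Ultrafilter.eq_pure_of_finite (U.map fun A : LSpace F K p => A.1 i j)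
    refine ⟨a, ?_⟩
    have : ({a} : Set K) ∈ U.map fun A : LSpace F K p => A.1 i j := by
      rw [ha]
      exact Ultrafilter.mem_pure.2 rfl
    exact this
  choose m hm using h1
  have hlevel : HasLevel n (Matrix.of m) := fun i j hij hm' => by
    obtain ⟨A, hA, hA'⟩ := U.nonempty_of_mem (Filter.inter_mem hU (hm i j))
    exact (hA' : A.1 i j = m i j).symm.trans (hA.1 i j hij hm')
  have hskew : IsSkewHermitian F (Matrix.of m) := fun a b => by
    obtain ⟨A, hA, hA'⟩ := U.nonempty_of_mem (Filter.inter_mem (hm a b) (hm (-b) (-a)))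
    have := A.2.1 a b
    rwa [(hA : A.1 a b = m a b), (hA' : A.1 (-b) (-a) = m (-b) (-a))] at this
  let M : LSpace F K p := ⟨Matrix.of m, hskew, n, hlevel⟩
  refine ⟨M, ⟨hlevel, ?_⟩, le_nhds_iff.2 fun S hMS hS => ?_⟩
  · ext i j
    obtain ⟨A, hA, hA'⟩ := U.nonempty_of_mem (Filter.inter_mem hU (hm i.1 j.1))
    exact (hA' : A.1 i j = m i j).symm.trans (congrFun (congrFun hA.2 i) j)
  · obtain ⟨k, hk, -, hkS⟩ := exists_cylinder_subset hS hMS n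
    have h2 : ⋂ e : Block p k × Block p k, {A : LSpace F K p | A.1 e.1.1 e.2.1 = m e.1.1 e.2.1} ∈ U :=
      Filter.iInter_mem.2 fun e => hm _ _
    refine Filter.mem_of_superset (Filter.inter_mem hU h2) fun A hA => hkS ⟨hA.1.1.mono hk, ?_⟩
    ext i j
    exact Set.mem_iInter.1 hA.2 (i, j)

variable (F K p) in
/-- The cylinder sets over blocks of size at least `n₀`. -/
def cylinders (n₀ : ℕ) : Set (Set (LSpace F K p)) :=
  {S | ∃ k, n₀ ≤ k ∧ ∃ X : Matrix (Block p k) (Block p k) K, S = cylinder F k X}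

theorem countable_cylinders [Finite K] (n₀ : ℕ) : (cylinders F K p n₀).Countable := by
  refine (Set.countable_range fun s : Σ k, Matrix (Block p k) (Block p k) K =>
    cylinder F s.1 s.2).mono ?_
  rintro _ ⟨k, -, X, rfl⟩
  exact ⟨⟨k, X⟩, rfl⟩

theorem measurableSet_cylinder (X : Matrix (Block p n) (Block p n) K) :
    MeasurableSet (cylinder F n X) := (isOpen_cylinder X).measurableSet

/-- Every open set is a union of cylinders, of which there are only countably many. -/
theorem generateFrom_cylinders [Finite K] (n₀ : ℕ) :
    (inferInstance : MeasurableSpace (LSpace F K p)) =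
      MeasurableSpace.generateFrom (cylinders F K p n₀) := by
  refine le_antisymm ?_ (MeasurableSpace.generateFrom_le ?_)
  · refine MeasurableSpace.generateFrom_le fun U hU => ?_
    have hU' : U = ⋃₀ {S | S ∈ cylinders F K p n₀ ∧ S ⊆ U} := by
      refine Set.Subset.antisymm (fun M hM => ?_) (Set.sUnion_subset fun S hS => hS.2)
      obtain ⟨k, hk, hl, hs⟩ := exists_cylinder_subset hU hM n₀
      exact ⟨_, ⟨⟨k, hk, _, rfl⟩, hs⟩, mem_cylinder_self hl⟩
    rw [hU']
    exact MeasurableSet.sUnion ((countable_cylinders n₀).mono fun S hS => hS.1) fun S hS =>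
      MeasurableSpace.measurableSet_generateFrom hS.1
  · rintro _ ⟨k, -, X, rfl⟩
    exact measurableSet_cylinder X

/-- Cylinders that meet are nested: each is the cylinder through a common element. -/
theorem cylinder_inter {X : Matrix (Block p n) (Block p n) K} {Y : Matrix (Block p m) (Block p m) K}
    (h : n ≤ m) (hne : (cylinder F n X ∩ cylinder F m Y).Nonempty) :
    cylinder F n X ∩ cylinder F m Y = cylinder F m Y := by
  obtain ⟨M, ⟨h1, rfl⟩, -, rfl⟩ := hne
  exact Set.inter_eq_right.2 (cylinder_subset h1 h)

theorem isPiSystem_cylinders (n₀ : ℕ) : IsPiSystem (cylinders F K p n₀) := by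
  rintro _ ⟨k, hk, X, rfl⟩ _ ⟨l, hl, Y, rfl⟩ hne
  rcases le_total k l with h | h
  · exact ⟨l, hl, Y, cylinder_inter h hne⟩
  · rw [Set.inter_comm] at hne ⊢
    exact ⟨k, hk, X, cylinder_inter h hne⟩

theorem sUnion_cylinders (n₀ : ℕ) : ⋃₀ cylinders F K p n₀ = Set.univ :=
  Set.eq_univ_of_forall fun M => by
    obtain ⟨k, hk, hl, -⟩ := exists_cylinder_subset isOpen_univ (Set.mem_univ M) n₀
    exact ⟨_, ⟨k, hk, _, rfl⟩, mem_cylinder_self hl⟩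

open MeasureTheory

theorem measure_ext_of_cylinder [Finite K] {P Q : Measure (LSpace F K p)} (n₀ : ℕ)
    (hfin : ∀ k, n₀ ≤ k → ∀ X : Matrix (Block p k) (Block p k) K, IsSkewHermitian F X →
      P (cylinder F k X) ≠ ⊤)
    (h : ∀ k, n₀ ≤ k → ∀ X : Matrix (Block p k) (Block p k) K, IsSkewHermitian F X →
      P (cylinder F k X) = Q (cylinder F k X)) : P = Q := by
  refine Measure.ext_of_generateFrom_of_cover_subset (generateFrom_cylinders n₀)
    (isPiSystem_cylinders n₀) subset_rfl (countable_cylinders n₀) (sUnion_cylinders n₀) ?_ ?_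
  · rintro _ ⟨k, hk, X, rfl⟩
    by_cases hX : IsSkewHermitian F X
    · exact hfin k hk X hX
    · simp [cylinder_eq_empty hX]
  · rintro _ ⟨k, hk, X, rfl⟩
    by_cases hX : IsSkewHermitian F X
    · exact h k hk X hX
    · simp [cylinder_eq_empty hX]

/-- The bound `n₀` is there because conjugation by a matrix of size `n`, or translation by an
element of level `n`, is only known to carry cylinders to cylinders over blocks of size at least
`n`. -/
theorem map_eq_of_cylinder [Finite K] {P : Measure (LSpace F K p)} (n₀ : ℕ)
    {T : LSpace F K p → LSpace F K p}
    (φ : ∀ k, Matrix (Block p k) (Block p k) K → Matrix (Block p k) (Block p k) K)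
    (hT : ∀ k, n₀ ≤ k → ∀ X, T ⁻¹' cylinder F k X = cylinder F k (φ k X))
    (hfin : ∀ k, n₀ ≤ k → ∀ X : Matrix (Block p k) (Block p k) K, IsSkewHermitian F X →
      P (cylinder F k X) ≠ ⊤)
    (hP : ∀ k, n₀ ≤ k → ∀ X, IsSkewHermitian F X →
      P (cylinder F k (φ k X)) = P (cylinder F k X)) : Measurable T ∧ P.map T = P := by
  have hm : Measurable T := by
    refine (measurable_generateFrom (s := cylinders F K p n₀) ?_).mono le_rfl
      (generateFrom_cylinders n₀).le
    rintro _ ⟨k, hk, X, rfl⟩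
    rw [hT k hk]
    exact measurableSet_cylinder _
  refine ⟨hm, (measure_ext_of_cylinder n₀ hfin fun k hk X hX => ?_).symm⟩
  rw [Measure.map_apply hm (measurableSet_cylinder X), hT k hk, hP k hk X hX]

theorem isFiniteMeasureOnCompacts_of_cylinder {P : Measure (LSpace F K p)}
    (hfin : ∀ k, ∀ X : Matrix (Block p k) (Block p k) K, IsSkewHermitian F X →
      P (cylinder F k X) ≠ ⊤) : IsFiniteMeasureOnCompacts P := by
  have : IsLocallyFiniteMeasure P := ⟨fun M => by
    obtain ⟨k, hk⟩ := M.2.2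
    exact ⟨_, (isOpen_cylinder _).mem_nhds (mem_cylinder_self hk),
      (hfin k _ (isSkewHermitian_corner M)).lt_top⟩⟩
  infer_instance

end Cylinders

/-! ### Measures from consistent weights -/

section Construction

variable {F : Type*} [Field F] [Fintype F] {K : Type*} [Field K] [Algebra F K]
  {p : Parity} {n m : ℕ}

/-- `S` is a union of cylinders over the block of size `n`. -/
def IsDetermined (n : ℕ) (S : Set (LSpace F K p)) : Prop :=
  ∀ A ∈ S, HasLevel n A.1 ∧ cylinder F n (corner n A.1) ⊆ S

theorem IsDetermined.mono {S : Set (LSpace F K p)} (hS : IsDetermined n S) (h : n ≤ m) :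
    IsDetermined m S := fun A hA =>
  ⟨(hS A hA).1.mono h, (cylinder_subset (hS A hA).1 h).trans (hS A hA).2⟩

theorem IsDetermined.union {S T : Set (LSpace F K p)} (hS : IsDetermined n S)
    (hT : IsDetermined n T) : IsDetermined n (S ∪ T) := by
  rintro A (hA | hA)
  · exact ⟨(hS A hA).1, (hS A hA).2.trans Set.subset_union_left⟩
  · exact ⟨(hT A hA).1, (hT A hA).2.trans Set.subset_union_right⟩

theorem IsDetermined.sdiff {S T : Set (LSpace F K p)} (hS : IsDetermined n S)
    (hT : IsDetermined n T) : IsDetermined n (S \ T) := by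
  rintro A ⟨hA, hA'⟩
  refine ⟨(hS A hA).1, fun B hB => ⟨(hS A hA).2 hB, fun hB' => hA' ((hT B hB').2 ?_)⟩⟩
  exact ⟨(hS A hA).1, hB.2.symm⟩

theorem IsDetermined.subset_of_nonempty {S : Set (LSpace F K p)} (hS : IsDetermined n S)
    {X : Matrix (Block p n) (Block p n) K} (h : (S ∩ cylinder F n X).Nonempty) :
    cylinder F n X ⊆ S := by
  obtain ⟨A, hA, hA1, rfl⟩ := h
  exact (hS A hA).2

theorem isDetermined_cylinder (X : Matrix (Block p n) (Block p n) K) :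
    IsDetermined n (cylinder F n X) := by
  rintro A ⟨hA, rfl⟩
  exact ⟨hA, subset_rfl⟩

theorem IsDetermined.isOpen {S : Set (LSpace F K p)} (hS : IsDetermined n S) : IsOpen S :=
  isOpen_iff_forall_mem_open.2 fun A hA =>
    ⟨_, (hS A hA).2, isOpen_cylinder _, mem_cylinder_self (hS A hA).1⟩

variable (F K p) in
/-- The ring of finite unions of cylinders. -/
def determinedSets : Set (Set (LSpace F K p)) := {S | ∃ n, IsDetermined n S}

theorem isSetRing_determinedSets : MeasureTheory.IsSetRing (determinedSets F K p) where
  empty_mem := ⟨0, fun _ h => h.elim⟩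
  union_mem := by
    rintro S T ⟨n, hS⟩ ⟨m, hT⟩
    exact ⟨max n m, (hS.mono (le_max_left _ _)).union (hT.mono (le_max_right _ _))⟩
  sdiff_mem := by
    rintro S T ⟨n, hS⟩ ⟨m, hT⟩
    exact ⟨max n m, (hS.mono (le_max_left _ _)).sdiff (hT.mono (le_max_right _ _))⟩

variable [Fintype K]

/-- There are finitely many blocks of a given size over a finite field. -/
theorem IsDetermined.isCompact {S : Set (LSpace F K p)} (hS : IsDetermined n S) :
    IsCompact S := by
  have : S = ⋃ X ∈ {X : Matrix (Block p n) (Block p n) K | cylinder F n X ⊆ S}, cylinder F n X :=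
    Set.Subset.antisymm (fun A hA => Set.mem_biUnion (hS A hA).2 (mem_cylinder_self (hS A hA).1))
      (Set.iUnion₂_subset fun X hX => hX)
  rw [this]
  exact (Set.toFinite _).isCompact_biUnion fun X _ => isCompact_cylinder X

open scoped ENNReal

variable (w : ∀ n, Matrix (Block p n) (Block p n) K → ℝ≥0∞)

open Classical in
/-- The total weight of the blocks of size `n` of the elements of `S`. -/
def levelMass (n : ℕ) (S : Set (LSpace F K p)) : ℝ≥0∞ :=
  ∑ X with (S ∩ cylinder F n X).Nonempty, w n X

open Classical in
variable (F) in
/-- The weight of a skew-Hermitian matrix is the sum of the weights of its bordered extensions. -/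
def IsConsistent : Prop :=
  ∀ n (X : Matrix (Block p n) (Block p n) K), IsSkewHermitian F X →
    ∑ Y with IsSkewHermitian F Y ∧ IsBordered Y ∧ shrink Y = X, w (n + 1) Y = w n X

variable {w}

/-- The blocks of size `n + 1` of elements of `S` above a given block `X` are exactly the bordered
skew-Hermitian extensions of `X`, so this is consistency summed over `X`. -/
theorem levelMass_succ (hw : IsConsistent F w) {S : Set (LSpace F K p)} (hS : IsDetermined n S) :
    levelMass w (n + 1) S = levelMass w n S := by
  classical
  rw [levelMass, levelMass, sum_congr rfl (g := fun X =>
    ∑ Y with IsSkewHermitian F Y ∧ IsBordered Y ∧ shrink Y = X, w (n + 1) Y) fun X hX => by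
      obtain ⟨A, -, -, rfl⟩ := (mem_filter.1 hX).2
      exact (hw n _ (isSkewHermitian_corner A)).symm]
  rw [← sum_fiberwise_of_maps_to (g := shrink)
    (t := {X | (S ∩ cylinder F n X).Nonempty})]
  · refine sum_congr rfl fun X hX => ?_
    rw [filter_filter]
    refine sum_congr (filter_congr fun Y _ => ?_) fun _ _ => rfl
    constructor
    · rintro ⟨⟨A, hA, -, rfl⟩, rfl⟩
      exact ⟨isSkewHermitian_corner A, (hS A hA).1.isBordered, rfl⟩
    · rintro ⟨h1, h2, rfl⟩
      refine ⟨?_, rfl⟩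
      obtain ⟨A, hA, rfl⟩ := cylinder_nonempty h1
      exact ⟨A, hS.subset_of_nonempty (mem_filter.1 hX).2 ⟨hasLevel_of_isBordered hA h2, rfl⟩,
        hA, rfl⟩
  · intro Y hY
    obtain ⟨A, hA, -, rfl⟩ := (mem_filter.1 hY).2
    exact mem_filter.2 ⟨mem_univ _, A, hA, (hS A hA).1, rfl⟩

theorem levelMass_eq (hw : IsConsistent F w) {S : Set (LSpace F K p)} (hS : IsDetermined n S)
    (h : n ≤ m) : levelMass w m S = levelMass w n S := by
  induction m, h using Nat.le_induction with
  | base => rfl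
  | succ m h ih => rw [levelMass_succ hw (hS.mono h), ih]

theorem levelMass_union {S T : Set (LSpace F K p)} (hS : IsDetermined n S)
    (hST : Disjoint S T) :
    levelMass w n (S ∪ T) = levelMass w n S + levelMass w n T := by
  classical
  rw [levelMass, levelMass, levelMass, ← sum_union]
  · rw [← filter_or]
    refine sum_congr (filter_congr fun X _ => ?_) fun _ _ => rfl
    rw [Set.union_inter_distrib_right, Set.union_nonempty]
  · refine disjoint_filter.2 fun X _ h1 h2 => ?_
    obtain ⟨A, hA, hA'⟩ := h2
    exact Set.disjoint_left.1 hST (hS.subset_of_nonempty h1 hA') hA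

theorem levelMass_cylinder {X : Matrix (Block p n) (Block p n) K} (hX : IsSkewHermitian F X) :
    levelMass w n (cylinder F n X) = w n X := by
  classical
  rw [levelMass, sum_eq_single_of_mem X]
  · simpa using cylinder_nonempty hX
  · intro Y hY hne
    obtain ⟨A, ⟨-, rfl⟩, -, rfl⟩ := (mem_filter.1 hY).2
    exact absurd rfl hne

theorem generateFrom_determinedSets : (inferInstance : MeasurableSpace (LSpace F K p)) =
    MeasurableSpace.generateFrom (determinedSets F K p) := by
  refine le_antisymm ?_ (MeasurableSpace.generateFrom_le ?_)
  · rw [generateFrom_cylinders 0]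
    refine MeasurableSpace.generateFrom_mono ?_
    rintro _ ⟨k, -, X, rfl⟩
    exact ⟨k, isDetermined_cylinder X⟩
  · rintro S ⟨n, hS⟩
    exact hS.isOpen.measurableSet

open Classical in
/-- The content on finite unions of cylinders defined by consistent weights. -/
def cylinderContent (hw : IsConsistent F w) :
    MeasureTheory.AddContent ℝ≥0∞ (determinedSets F K p) :=
  MeasureTheory.IsSetRing.addContent_of_union
    (fun S => if h : ∃ n, IsDetermined n S then levelMass w h.choose S else 0)
    isSetRing_determinedSets (by simp [levelMass]) <| by
    rintro S T hS hT hST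
    have hST' : ∃ n, IsDetermined n (S ∪ T) := isSetRing_determinedSets.union_mem hS hT
    change ∃ n, IsDetermined n S at hS
    change ∃ n, IsDetermined n T at hT
    rw [dif_pos hS, dif_pos hT, dif_pos hST']
    -- The mass does not depend on the chosen level, so the three sets are compared at a common one.
    obtain ⟨N, h1, h2, h3⟩ : ∃ N, hS.choose ≤ N ∧ hT.choose ≤ N ∧ hST'.choose ≤ N :=
      ⟨max hS.choose (max hT.choose hST'.choose), by simp, by simp, by simp⟩
    rw [← levelMass_eq hw hS.choose_spec h1, ← levelMass_eq hw hT.choose_spec h2,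
      ← levelMass_eq hw hST'.choose_spec h3, levelMass_union (hS.choose_spec.mono h1) hST]

open Classical in
theorem cylinderContent_apply (hw : IsConsistent F w) {S : Set (LSpace F K p)}
    (hS : IsDetermined n S) : cylinderContent hw S = levelMass w n S := by
  have h : ∃ n, IsDetermined n S := ⟨n, hS⟩
  change (if h : ∃ n, IsDetermined n S then levelMass w h.choose S else 0) = _
  rw [dif_pos h, ← levelMass_eq hw h.choose_spec (le_max_left _ n),
    levelMass_eq hw hS (le_max_right _ n)]

/-- Members of the ring are compact and open: a countable union that is again a member is already a
finite union, and finite subadditivity applies. -/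
theorem isSigmaSubadditive_cylinderContent (hw : IsConsistent F w) :
    (cylinderContent (F := F) hw).IsSigmaSubadditive := by
  rintro f hf ⟨n, hn⟩
  obtain ⟨t, ht⟩ := hn.isCompact.elim_finite_subcover f (fun i => (hf i).choose_spec.isOpen)
    subset_rfl
  have h1 : ⋃ i, f i = ⋃ i ∈ t, f i := ht.antisymm (Set.iUnion₂_subset_iUnion _ _)
  rw [h1]
  exact (MeasureTheory.addContent_biUnion_le isSetRing_determinedSets fun i _ => hf i).trans
    (ENNReal.sum_le_tsum t)

/-- Consistent weights of skew-Hermitian matrices define a measure on `𝕃`. -/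
theorem exists_measure_of_isConsistent (hw : IsConsistent F w) :
    ∃ P : MeasureTheory.Measure (LSpace F K p), ∀ n (X : Matrix (Block p n) (Block p n) K),
      IsSkewHermitian F X → P (cylinder F n X) = w n X := by
  refine ⟨(cylinderContent hw).measure isSetRing_determinedSets.isSetSemiring
    generateFrom_determinedSets.le (isSigmaSubadditive_cylinderContent hw), fun n X hX => ?_⟩
  rw [MeasureTheory.AddContent.measure_eq _ _ generateFrom_determinedSets _
    ⟨n, isDetermined_cylinder X⟩, cylinderContent_apply hw (isDetermined_cylinder X),
    levelMass_cylinder hX]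

end Construction

end

end PronilHL

namespace PronilHL

noncomputable section

open Finset Matrix

/-! ### Conjugation by the infinite unitary group -/

section Conjugation

variable {F : Type*} [Field F] [Fintype F] {K : Type*} [Field K] [Algebra F K] {p : Parity} {n k : ℕ}

theorem finsum_eq_sum_block {M : Type*} [AddCommMonoid M] (f : Index p → M)
    (h : ∀ i, f i ≠ 0 → |i.1| ≤ (k : ℤ)) : ∑ᶠ i, f i = ∑ i : Block p k, f i.1 := by
  classical
  rw [finsum_eq_sum_of_support_subset f 
      (s := univ.map (Function.Embedding.subtype fun i : Index p => |i.1| ≤ (k : ℤ))), sum_map]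
  · rfl
  · intro i hi
    simpa using h i hi

theorem exists_block_mem (n : ℕ) (a b : Index p) :
    ∃ k, n ≤ k ∧ |a.1| ≤ (k : ℤ) ∧ |b.1| ≤ (k : ℤ) := by
  refine ⟨n + a.1.natAbs + b.1.natAbs, by omega, ?_, ?_⟩ <;>
    · rw [Int.abs_eq_natAbs]
      omega

theorem extend_ne_zero {h : Matrix (Block p n) (Block p n) K} {a b : Index p}
    (hab : extend h a b ≠ 0) : a = b ∨ |a.1| ≤ (n : ℤ) ∧ |b.1| ≤ (n : ℤ) := by
  by_contra! hc
  refine hab ?_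
  simp only [extend, of_apply]
  rw [dif_neg fun hh => not_le.2 (hc.2 hh.1) hh.2, if_neg hc.1]

theorem extend_of_mem (h : Matrix (Block p n) (Block p n) K) (a b : Block p n) :
    extend h a.1 b.1 = h a b := dif_pos ⟨a.2, b.2⟩

theorem extend_of_not_mem (h : Matrix (Block p n) (Block p n) K) {a b : Index p}
    (hab : ¬ (|a.1| ≤ (n : ℤ) ∧ |b.1| ≤ (n : ℤ))) :
    extend h a b = if a = b then 1 else 0 := dif_neg hab

theorem extend_one : extend (1 : Matrix (Block p n) (Block p n) K) = 1 := by
  ext a b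
  by_cases hab : |a.1| ≤ (n : ℤ) ∧ |b.1| ≤ (n : ℤ)
  · rw [extend_of_mem _ ⟨a, hab.1⟩ ⟨b, hab.2⟩, one_apply, one_apply]
    exact if_congr Subtype.ext_iff rfl rfl
  · rw [extend_of_not_mem _ hab, one_apply]

/-- The extended matrices do not link the block of size `n` with its complement, so truncation to a
larger block is multiplicative. -/
theorem corner_extend_mul (hk : n ≤ k) (A B : Matrix (Block p n) (Block p n) K) :
    corner k (extend A) * corner k (extend B) = corner k (extend (A * B)) := by
  have hk' : (n : ℤ) ≤ k := by exact_mod_cast hk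
  ext i j
  change ∑ l : Block p k, extend A i.1 l.1 * extend B l.1 j.1 = extend (A * B) i.1 j.1
  by_cases hi : |i.1.1| ≤ (n : ℤ)
  · by_cases hj : |j.1.1| ≤ (n : ℤ)
    · have h0 : ∀ l : Index p, extend A i.1 l * extend B l j.1 ≠ 0 → |l.1| ≤ (n : ℤ) := by
        intro l hl
        rcases extend_ne_zero (left_ne_zero_of_mul hl) with h | h
        · rw [← h]; exact hi
        · exact h.2
      rw [← finsum_eq_sum_block (fun l => extend A i.1 l * extend B l j.1)
        fun l hl => (h0 l hl).trans hk', finsum_eq_sum_block _ h0,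
        extend_of_mem _ ⟨i.1, hi⟩ ⟨j.1, hj⟩, mul_apply]
      exact sum_congr rfl fun l _ => by
        rw [← extend_of_mem A, ← extend_of_mem B]
    · rw [sum_eq_single j]
      · rw [extend_of_not_mem B fun h => hj h.2, if_pos rfl, mul_one,
          extend_of_not_mem A fun h => hj h.2, extend_of_not_mem _ fun h => hj h.2]
      · intro l _ hl
        rw [extend_of_not_mem B fun h => hj h.2, if_neg fun h => hl (Subtype.ext h), mul_zero]
      · simp
  · rw [sum_eq_single i]
    · rw [extend_of_not_mem A fun h => hi h.1, if_pos rfl, one_mul,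
        extend_of_not_mem B fun h => hi h.1, extend_of_not_mem _ fun h => hi h.1]
    · intro l _ hl
      rw [extend_of_not_mem A fun h => hi h.1, if_neg fun h => hl (Subtype.ext h.symm), zero_mul]
    · simp

theorem corner_one : corner k (1 : Matrix (Index p) (Index p) K) = 1 :=
  submatrix_one _ Subtype.val_injective

theorem corner_extend_formAdjoint (h : Matrix (Block p n) (Block p n) K) :
    formAdjoint F (corner k (extend h)) = corner k (extend (formAdjoint F h)) := by
  have habs : ∀ a : Index p, |(-a).1| = |a.1| := fun a => abs_neg a.1
  ext i j
  change frob F (extend h (-j.1) (-i.1)) = extend (formAdjoint F h) i.1 j.1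
  by_cases hij : |i.1.1| ≤ (n : ℤ) ∧ |j.1.1| ≤ (n : ℤ)
  · rw [extend_of_mem _ ⟨i.1, hij.1⟩ ⟨j.1, hij.2⟩]
    have := extend_of_mem h (-⟨j.1, hij.2⟩) (-⟨i.1, hij.1⟩)
    exact congrArg (frob F) this
  · rw [extend_of_not_mem _ hij, extend_of_not_mem h (by rwa [habs, habs, and_comm])]
    have h1 : (-j.1 = -i.1) ↔ i.1 = j.1 :=
      ⟨fun h => Subtype.ext (neg_injective (congrArg Subtype.val h)).symm, fun h => by rw [h]⟩
    rw [if_congr h1 rfl rfl]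
    split_ifs <;> simp

theorem IsUnitary.corner_extend (hk : n ≤ k) {h : Matrix (Block p n) (Block p n) K}
    (hh : IsUnitary F h) : IsUnitary F (corner k (extend h)) := by
  rw [isUnitary_iff] at hh ⊢
  rw [corner_extend_formAdjoint, corner_extend_mul hk, hh, extend_one, corner_one]

theorem IsUnitary.inv_corner_extend (hk : n ≤ k) {h : Matrix (Block p n) (Block p n) K}
    (hh : IsUnitary F h) : (corner k (extend h))⁻¹ = corner k (extend h⁻¹) := by
  rw [(hh.corner_extend hk).inv_eq, corner_extend_formAdjoint, hh.inv_eq]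

/-- The extensions are the identity outside the block of size `n ≤ k`, so both infinite sums stay
inside the block of size `k`. -/
theorem corner_conjBy (hk : n ≤ k) (h : Matrix (Block p n) (Block p n) K)
    (M : Matrix (Index p) (Index p) K) :
    corner k (conjBy h M) = corner k (extend h) * corner k M * corner k (extend h⁻¹) := by
  have hk' : (n : ℤ) ≤ k := by exact_mod_cast hk
  ext i j
  change ∑ᶠ a, ∑ᶠ b, extend h i.1 a * M a b * extend h⁻¹ b j.1 = _
  have h1 : ∀ a, ∑ᶠ b, extend h i.1 a * M a b * extend h⁻¹ b j.1 =
      ∑ b : Block p k, extend h i.1 a * M a b.1 * extend h⁻¹ b.1 j.1 := fun a =>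
    finsum_eq_sum_block _ fun b hb => by
      rcases extend_ne_zero (right_ne_zero_of_mul hb) with h | h
      · rw [h]; exact j.2
      · exact h.1.trans hk'
  simp_rw [h1]
  rw [finsum_eq_sum_block (k := k), sum_comm]
  · rw [mul_apply]
    exact sum_congr rfl fun b _ => by rw [mul_apply, sum_mul]; rfl
  · intro a ha
    obtain ⟨b, -, hb⟩ := exists_ne_zero_of_sum_ne_zero ha
    rcases extend_ne_zero (left_ne_zero_of_mul (left_ne_zero_of_mul hb)) with h | h
    · rw [← h]; exact i.2
    · exact h.2.trans hk'

/-- Only indices of absolute value at most `n` are mixed. If one of `i`, `j` is larger than `k` in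
absolute value, it stays in place, and moving the other one within the block of size `n` does not
change their order. -/
theorem HasLevel.conjBy (hk : n ≤ k) (h : Matrix (Block p n) (Block p n) K)
    {M : Matrix (Index p) (Index p) K} (hM : HasLevel k M) : HasLevel k (conjBy h M) := by
  have hk' : (n : ℤ) ≤ k := by exact_mod_cast hk
  intro i j hij hm
  refine finsum_eq_zero_of_forall_eq_zero fun a => finsum_eq_zero_of_forall_eq_zero fun b => ?_
  by_contra hne
  have h1 := extend_ne_zero (left_ne_zero_of_mul (left_ne_zero_of_mul hne))
  have h2 := extend_ne_zero (right_ne_zero_of_mul hne)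
  refine right_ne_zero_of_mul (left_ne_zero_of_mul hne) (hM a b ?_ ?_)
  · have hij' : j.1 ≤ i.1 := hij
    change b.1 ≤ a.1
    rcases h1 with rfl | ⟨hi, ha⟩ <;> rcases h2 with rfl | ⟨hb, hj⟩
    · exact hij'
    · have hi : (k : ℤ) < |i.1| := (lt_max_iff.1 hm).resolve_right (not_lt.2 (hj.trans hk'))
      have := abs_le.1 hb
      have := abs_le.1 hj
      rcases lt_abs.1 hi with h | h <;> omega
    · have hj : (k : ℤ) < |b.1| := (lt_max_iff.1 hm).resolve_left (not_lt.2 (hi.trans hk'))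
      have := abs_le.1 hi
      have := abs_le.1 ha
      rcases lt_abs.1 hj with h | h <;> omega
    · exact absurd hm (not_lt.2 (max_le (hi.trans hk') (hj.trans hk')))
  · rcases h1 with rfl | ⟨hi, ha⟩ <;> rcases h2 with rfl | ⟨hb, hj⟩
    · exact hm
    · exact lt_max_of_lt_left ((lt_max_iff.1 hm).resolve_right (not_lt.2 (hj.trans hk')))
    · exact lt_max_of_lt_right ((lt_max_iff.1 hm).resolve_left (not_lt.2 (hi.trans hk')))
    · exact absurd hm (not_lt.2 (max_le (hi.trans hk') (hj.trans hk')))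

theorem isSkewHermitian_conjBy (hK : Module.finrank F K = 2)
    {h : Matrix (Block p n) (Block p n) K} (hh : IsUnitary F h) (M : LSpace F K p) :
    IsSkewHermitian F (conjBy h M.1) := by
  intro a b
  obtain ⟨k, hk, ha, hb⟩ := exists_block_mem n a b
  have h1 := corner_conjBy hk h M.1
  have h2 := (isSkewHermitian_corner (n := k) M).conj hK (hh.corner_extend hk)
  rw [hh.inv_corner_extend hk, ← h1] at h2
  exact h2 ⟨a, ha⟩ ⟨b, hb⟩

/-- Conjugation of an element of `𝕃` by a unitary matrix. -/
def conjL (hK : Module.finrank F K = 2) {h : Matrix (Block p n) (Block p n) K}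
    (hh : IsUnitary F h) (M : LSpace F K p) : LSpace F K p :=
  ⟨conjBy h M.1, isSkewHermitian_conjBy hK hh M, by
    obtain ⟨l, hl⟩ := M.2.2
    exact ⟨max n l, (hl.mono (le_max_right n l)).conjBy (le_max_left n l) h⟩⟩

theorem matrix_ext_corner {R : Type*} {A B : Matrix (Index p) (Index p) R} (n : ℕ)
    (h : ∀ k, n ≤ k → corner k A = corner k B) : A = B := by
  ext a b
  obtain ⟨k, hk, ha, hb⟩ := exists_block_mem n a b
  exact congrFun (congrFun (h k hk) ⟨a, ha⟩) ⟨b, hb⟩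

theorem conjBy_inv_conjBy {h : Matrix (Block p n) (Block p n) K} (hh : IsUnitary F h)
    (M : Matrix (Index p) (Index p) K) : conjBy h⁻¹ (conjBy h M) = M := by
  refine matrix_ext_corner n fun k hk => ?_
  have hu := (hh.corner_extend hk).isUnit
  rw [corner_conjBy hk, corner_conjBy hk, nonsing_inv_nonsing_inv _ hh.isUnit,
    ← hh.inv_corner_extend hk, Matrix.mul_assoc, nonsing_inv_mul_cancel_right _ _ hu,
    nonsing_inv_mul_cancel_left _ _ hu]

theorem conjBy_conjBy_inv {h : Matrix (Block p n) (Block p n) K} (hh : IsUnitary F h)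
    (M : Matrix (Index p) (Index p) K) : conjBy h (conjBy h⁻¹ M) = M := by
  refine matrix_ext_corner n fun k hk => ?_
  have hu := (hh.corner_extend hk).isUnit
  rw [corner_conjBy hk, corner_conjBy hk, nonsing_inv_nonsing_inv _ hh.isUnit,
    ← hh.inv_corner_extend hk, Matrix.mul_assoc, mul_nonsing_inv_cancel_right _ _ hu,
    mul_nonsing_inv_cancel_left _ _ hu]

theorem preimage_conjL_cylinder (hK : Module.finrank F K = 2) (hk : n ≤ k)
    {h : Matrix (Block p n) (Block p n) K} (hh : IsUnitary F h)
    (X : Matrix (Block p k) (Block p k) K) :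
    conjL hK hh ⁻¹' cylinder F k X =
      cylinder F k ((corner k (extend h))⁻¹ * X * (corner k (extend h))⁻¹⁻¹) := by
  have hu := (hh.corner_extend hk).isUnit
  rw [nonsing_inv_nonsing_inv _ hu]
  ext M
  constructor
  · rintro ⟨h1, rfl⟩
    refine ⟨?_, ?_⟩
    · have := HasLevel.conjBy hk h⁻¹ h1
      rwa [show (conjL hK hh M).1 = conjBy h M.1 from rfl, conjBy_inv_conjBy hh] at this
    · rw [show (conjL hK hh M).1 = conjBy h M.1 from rfl, corner_conjBy hk,
        ← hh.inv_corner_extend hk, Matrix.mul_assoc, nonsing_inv_mul_cancel_right _ _ hu,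
        nonsing_inv_mul_cancel_left _ _ hu]
  · rintro ⟨h1, h2⟩
    refine ⟨h1.conjBy hk h, ?_⟩
    rw [show (conjL hK hh M).1 = conjBy h M.1 from rfl, corner_conjBy hk,
      ← hh.inv_corner_extend hk, h2, Matrix.mul_assoc, mul_nonsing_inv_cancel_right _ _ hu,
      mul_nonsing_inv_cancel_left _ _ hu]

open MeasureTheory

/-- A measure whose values on cylinders are invariant under finite unitary groups is invariant under
the infinite unitary group. -/
theorem measure_image_conjBy [Finite K] (hK : Module.finrank F K = 2) {P : Measure (LSpace F K p)}
    (hfin : ∀ k, ∀ X : Matrix (Block p k) (Block p k) K, IsSkewHermitian F X →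
      P (cylinder F k X) ≠ ⊤)
    (hP : ∀ k, ∀ g X : Matrix (Block p k) (Block p k) K, IsUnitary F g → IsSkewHermitian F X →
      P (cylinder F k (g * X * g⁻¹)) = P (cylinder F k X))
    {h : Matrix (Block p n) (Block p n) K} (hh : IsUnitary F h)
    {A : Set (LSpace F K p)} (hA : MeasurableSet A) :
    P {M' | ∃ M ∈ A, M'.1 = conjBy h M.1} = P A := by
  -- The image under conjugation by `h` is a preimage under conjugation by `h⁻¹`, hence accessible
  -- through a pushforward.
  have hset : {M' : LSpace F K p | ∃ M ∈ A, M'.1 = conjBy h M.1} = conjL hK (hh.inv hK) ⁻¹' A := by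
    ext M'
    constructor
    · rintro ⟨M, hM, hMM'⟩
      have : conjL hK (hh.inv hK) M' = M := Subtype.ext (by
        change conjBy h⁻¹ M'.1 = M.1
        rw [hMM', conjBy_inv_conjBy hh])
      rwa [Set.mem_preimage, this]
    · intro hM'
      exact ⟨_, hM', (conjBy_conjBy_inv hh M'.1).symm⟩
  obtain ⟨hm, hmap⟩ := map_eq_of_cylinder (P := P) n
    (fun k X => (corner k (extend h⁻¹))⁻¹ * X * (corner k (extend h⁻¹))⁻¹⁻¹)
    (fun k hk X => preimage_conjL_cylinder hK hk (hh.inv hK) X) (fun k _ => hfin k)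
    (fun k hk X hX => hP k _ X (((hh.inv hK).corner_extend hk).inv hK) hX)
  rw [hset, ← Measure.map_apply hm hA, hmap]

end Conjugation

end

end PronilHL

namespace PronilHL

noncomputable section

open Finset Matrix MeasureTheory

/-! ### The invariant measures -/

theorem fallingFactor_succ (t : ℝ) (m l : ℕ) :
    fallingFactor t m (l + 1) = fallingFactor t m l * (1 - t ^ (m - l)) := prod_range_succ _ _

theorem isNullityHarmonic_one (t : ℝ) : IsNullityHarmonic t 0 fun _ => 1 := fun l => by ring

/-- For `l ≤ m` the bracket `-t f(l+2) + (1+t) f(l+1)` equals `(1 - t^(2(m-l))) f(l)`; for `l > m`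
every term vanishes. -/
theorem isNullityHarmonic_fallingFactor (t : ℝ) (m : ℕ) :
    IsNullityHarmonic t (t ^ (2 * m)) (fallingFactor t m) := fun l => by
  rcases lt_or_ge m l with h | h
  · simp [fallingFactor_of_lt t h, fallingFactor_of_lt t (h.trans (Nat.lt_succ_self l)),
      fallingFactor_of_lt t (show m < l + 2 by omega)]
  rw [fallingFactor_succ, fallingFactor_succ]
  rcases h.eq_or_lt with rfl | h
  · simp
  · obtain ⟨d, rfl⟩ : ∃ d, m = l + d + 1 := ⟨m - l - 1, by omega⟩
    rw [show l + d + 1 - l = d + 1 by omega, show l + d + 1 - (l + 1) = d by omega]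
    ring

/-- The normalizing factor `q ^ (-N(N-1)/2) (1 - u) ^ (-N/2)`. -/
def weightConst (F : Type*) [Fintype F] (p : Parity) (u : ℝ) (n : ℕ) : ℝ :=
  ((Fintype.card F : ℝ) ^ (dim p n).choose 2)⁻¹ / √(1 - u) ^ dim p n

theorem weightConst_zero (F : Type*) [Fintype F] (p : Parity) (n : ℕ) :
    weightConst F p 0 n = ((Fintype.card F : ℝ) ^ (dim p n).choose 2)⁻¹ := by
  simp [weightConst]

section Weights

variable {F : Type*} [Field F] [Fintype F] {K : Type*} [Field K] [Algebra F K] {p : Parity} {n : ℕ}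

theorem one_sub_inv_sq_pos : 0 < 1 - ((Fintype.card F : ℝ) ^ 2)⁻¹ := by
  have hq : (1 : ℝ) < Fintype.card F := by exact_mod_cast Fintype.one_lt_card
  rw [sub_pos]
  exact inv_lt_one_of_one_lt₀ (one_lt_pow₀ hq two_ne_zero)

theorem weightConst_pos {u : ℝ} (hu : u < 1) (n : ℕ) : 0 < weightConst F p u n := by
  have hq : (0 : ℝ) < Fintype.card F := by exact_mod_cast Fintype.card_pos
  have := Real.sqrt_pos.2 (sub_pos.2 hu)
  unfold weightConst
  positivity

/-- The size `N` grows by `2`, and `N + 2` choose `2` exceeds `N` choose `2` by `2N + 1`, the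
exponent in the number of bordered extensions. -/
theorem weightConst_succ {u : ℝ} (hu : u < 1) (n : ℕ) :
    weightConst F p u (n + 1) * ((Fintype.card F : ℝ) ^ (2 * dim p n + 1) * (1 - u)) =
      weightConst F p u n := by
  have hq : (0 : ℝ) < Fintype.card F := by exact_mod_cast Fintype.card_pos
  have hs := Real.sqrt_pos.2 (sub_pos.2 hu)
  have hd : dim p (n + 1) = dim p n + 2 := by simp only [dim]; ring
  have hc : (dim p (n + 1)).choose 2 = (dim p n).choose 2 + (2 * dim p n + 1) := by
    rw [hd, Nat.choose_succ_succ' (dim p n + 1) 1, Nat.choose_succ_succ' (dim p n) 1]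
    simp
    ring
  have hsq := Real.sq_sqrt (sub_pos.2 hu).le
  rw [weightConst, weightConst, hc, hd]
  generalize √(1 - u) = s at hs hsq ⊢
  rw [← hsq, pow_add, pow_add s]
  field_simp

open Classical in
/-- For a function `f` of the dimension of the kernel that is harmonic for bordered extensions, there
is a measure giving a cylinder over `X` a mass proportional to `f`, provided that `X` satisfies a
given condition that is invariant under bordered extensions. -/
theorem exists_measure_of_isNullityHarmonic (hK : Module.finrank F K = 2) {u : ℝ} (hu : u < 1)
    {f : ℕ → ℝ} (hf0 : ∀ l, 0 ≤ f l) (hf : IsNullityHarmonic (-(Fintype.card F : ℝ)⁻¹) u f)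
    (R : ∀ n, Matrix (Block p n) (Block p n) K → Prop)
    (hR : ∀ n (Y : Matrix (Block p (n + 1)) (Block p (n + 1)) K), IsBordered Y →
      (R (n + 1) Y ↔ R n (shrink Y))) :
    ∃ P : Measure (LSpace F K p), ∀ n (X : Matrix (Block p n) (Block p n) K),
      IsSkewHermitian F X → P (cylinder F n X) =
        if R n X then ENNReal.ofReal (weightConst F p u n * f (nullity X)) else 0 := by
  have := finite_of_finrank_eq_two F hK
  have := Fintype.ofFinite K
  refine exists_measure_of_isConsistent (w := fun n X => if R n X then
    ENNReal.ofReal (weightConst F p u n * f (nullity X)) else 0) fun n X hX => ?_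
  rw [sum_bordered hK hX]
  simp_rw [hR n _ (isBordered_border F X _ _), shrink_border]
  split_ifs
  · have hnn : ∀ Y : Matrix (Block p (n + 1)) (Block p (n + 1)) K,
        0 ≤ weightConst F p u (n + 1) * f (nullity Y) := fun Y =>
      mul_nonneg (weightConst_pos hu _).le (hf0 _)
    -- The recurrence for `f` turns the sum over the extensions into a multiple of `f (nullity X)`,
    -- and the change of normalization absorbs the factor.
    rw [← weightConst_succ hu n, mul_assoc (weightConst F p u (n + 1)), ← sum_border hK hX hf, mul_sum,
      ENNReal.ofReal_sum_of_nonneg fun x _ => ?_]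
    · refine sum_congr rfl fun x _ => ?_
      rw [mul_sum, ENNReal.ofReal_sum_of_nonneg fun s _ => hnn _]
    · rw [mul_sum]
      exact sum_nonneg fun s _ => hnn _
  · simp

/-! ### Support on pronilpotent matrices, existence and uniqueness -/

theorem mem_pronilpotent_iff {X : Matrix (Block p n) (Block p n) K} {M : LSpace F K p}
    (hM : M ∈ cylinder F n X) : M ∈ pronilpotent F K p ↔ IsNilpotent X := by
  obtain ⟨h1, rfl⟩ := hM
  refine ⟨fun ⟨k, hk, hk'⟩ => ?_, fun h => ⟨n, h1, h⟩⟩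
  -- Both blocks are compared with the one of size `max n k`.
  rwa [← h1.isNilpotent_corner_iff (le_max_left n k), hk.isNilpotent_corner_iff (le_max_right n k)]

theorem cylinder_inter_pronilpotent {X : Matrix (Block p n) (Block p n) K} (hX : ¬ IsNilpotent X) :
    cylinder F n X ∩ pronilpotent F K p = ∅ :=
  Set.eq_empty_of_forall_notMem fun _ hM => hX ((mem_pronilpotent_iff hM.1).1 hM.2)

theorem cylinder_subset_pronilpotent {X : Matrix (Block p n) (Block p n) K} (hX : IsNilpotent X) :
    cylinder F n X ⊆ pronilpotent F K p := fun _ hM => (mem_pronilpotent_iff hM).2 hX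

theorem measure_cylinder_of_not_isNilpotent {P : Measure (LSpace F K p)}
    (hP : P (pronilpotent F K p)ᶜ = 0) {X : Matrix (Block p n) (Block p n) K}
    (hX : ¬ IsNilpotent X) : P (cylinder F n X) = 0 :=
  measure_mono_null (fun _ hM hM' => hX ((mem_pronilpotent_iff hM).1 hM')) hP

/-- The complement is covered by the null cylinders, of which there are countably many. -/
theorem measure_compl_pronilpotent [Finite K] {P : Measure (LSpace F K p)}
    (hP : ∀ k (X : Matrix (Block p k) (Block p k) K), IsSkewHermitian F X → ¬ IsNilpotent X →
      P (cylinder F k X) = 0) : P (pronilpotent F K p)ᶜ = 0 := by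
  have hsub : (pronilpotent F K p)ᶜ ⊆ ⋃₀ {S | S ∈ cylinders F K p 0 ∧ P S = 0} := by
    intro M hM
    obtain ⟨k, hk⟩ := M.2.2
    refine ⟨_, ⟨⟨k, Nat.zero_le k, _, rfl⟩, ?_⟩, mem_cylinder_self hk⟩
    exact hP k _ (isSkewHermitian_corner M) fun h => hM ⟨k, hk, h⟩
  refine measure_mono_null hsub ?_
  rw [measure_sUnion_null_iff ((countable_cylinders 0).mono fun S hS => hS.1)]
  exact fun S hS => hS.2

/-- The value of a functional on `Q̃_μ` in terms of the weight of a nilpotent matrix. -/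
theorem corresponds_value {Φ : SymFun →ₗ[ℝ] ℝ} {u : ℝ} {f : ℕ → ℝ}
    (hΦ : ∀ μ, Φ (signedQ (-(Fintype.card F : ℝ)⁻¹) μ) =
      √((1 - (-(Fintype.card F : ℝ)⁻¹) ^ 2) / (1 - u)) ^ μ.card *
        (- -(Fintype.card F : ℝ)⁻¹) ^ nStat μ * f (μ.colLen 0))
    {L : Type*} [Field L] {X : Matrix (Block p n) (Block p n) L} {μ : YoungDiagram}
    (hX : HasJordanType X μ) :
    (Fintype.card F : ℝ) ^ ((nStat μ : ℤ) - ((dim p n).choose 2 : ℤ)) /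
      (1 - ((Fintype.card F : ℝ) ^ 2)⁻¹) ^ ((dim p n : ℝ) / 2) *
      Φ (signedQ (-(Fintype.card F : ℝ)⁻¹) μ) = weightConst F p u n * f (nullity X) := by
  have hq : (0 : ℝ) < Fintype.card F := by exact_mod_cast Fintype.card_pos
  have hd := one_sub_inv_sq_pos (F := F)
  have hs := Real.sqrt_pos.2 hd
  -- With `|μ| = N`, the factor `q^n(μ)` cancels `(-t)^n(μ)`, and `(1 - q^(-2))^(N/2)` cancels the
  -- numerator of the power of the square root.
  rw [hΦ, hX.card_eq, card_block, hX.nullity_eq, Real.rpow_div_two_eq_sqrt _ hd.le,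
    Real.rpow_natCast, neg_sq, neg_neg, inv_pow, Real.sqrt_div hd.le, div_pow, zpow_sub₀ hq.ne',
    zpow_natCast, zpow_natCast, inv_pow, weightConst]
  generalize √(1 - ((Fintype.card F : ℝ) ^ 2)⁻¹) = s at hs ⊢
  field_simp

/-- The weights depend on `X` only through its nilpotency and nullity, which gives invariance. For
uniqueness, every nilpotent block has a Jordan type, so its mass is prescribed, and the support
condition makes the other cylinders null. -/
theorem existsUnique_invariantNilMeasure (hK : Module.finrank F K = 2) (p : Parity)
    {Φ : SymFun →ₗ[ℝ] ℝ} {u : ℝ} (hu : u < 1) {f : ℕ → ℝ} (hf0 : ∀ l, 0 ≤ f l)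
    (hf : IsNullityHarmonic (-(Fintype.card F : ℝ)⁻¹) u f)
    (hΦ : ∀ μ, Φ (signedQ (-(Fintype.card F : ℝ)⁻¹) μ) =
      √((1 - (-(Fintype.card F : ℝ)⁻¹) ^ 2) / (1 - u)) ^ μ.card *
        (- -(Fintype.card F : ℝ)⁻¹) ^ nStat μ * f (μ.colLen 0)) :
    ∃! P : Measure (LSpace F K p), IsInvariantNilMeasure F P ∧ Corresponds F P Φ := by
  classical
  have := finite_of_finrank_eq_two F hK
  obtain ⟨P, hP⟩ := exists_measure_of_isNullityHarmonic (p := p) hK hu hf0 hf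
    (fun _ X => IsNilpotent X) (fun _ _ hY => hY.isNilpotent_iff)
  have hfin : ∀ k, ∀ X : Matrix (Block p k) (Block p k) K, IsSkewHermitian F X →
      P (cylinder F k X) ≠ ⊤ := fun k X hX => by
    rw [hP k X hX]
    split_ifs <;> simp
  have hsupp : P (pronilpotent F K p)ᶜ = 0 :=
    measure_compl_pronilpotent fun k X hX hnil => by rw [hP k X hX, if_neg hnil]
  have hcorr : Corresponds F P Φ := fun n X μ hX hμ => by
    rw [corresponds_value hΦ hμ, hP n X hX, if_pos hμ.isNilpotent]
  refine ⟨P, ⟨⟨isFiniteMeasureOnCompacts_of_cylinder hfin, fun n h hh A hA => ?_, hsupp⟩, hcorr⟩, ?_⟩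
  · refine measure_image_conjBy hK hfin (fun k g X hg hX => ?_) hh hA
    rw [hP k X hX, hP k _ (hX.conj hK hg), nullity_conj hg.isUnit]
    exact if_congr (isNilpotent_conj_iff hg.isUnit X) rfl rfl
  · rintro Q ⟨hQ, hQ'⟩
    refine (measure_ext_of_cylinder 0 (fun k _ => hfin k) fun k _ X hX => ?_).symm
    by_cases hnil : IsNilpotent X
    · obtain ⟨μ, hμ⟩ := exists_hasJordanType hnil
      rw [hcorr k X μ hX hμ, hQ' k X μ hX hμ]
    · rw [measure_cylinder_of_not_isNilpotent hsupp hnil,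
        measure_cylinder_of_not_isNilpotent hQ.supported hnil]

/-! ### The Haar measure and its restriction -/

theorem preimage_add_cylinder {A : LSpace F K p} (hA : HasLevel n A.1)
    (X : Matrix (Block p n) (Block p n) K) :
    (fun M => A + M) ⁻¹' cylinder F n X = cylinder F n (X - corner n A.1) := by
  ext M
  constructor
  · rintro ⟨h1, rfl⟩
    refine ⟨fun i j hij hm => ?_, ?_⟩
    · have h2 : A.1 i j + M.1 i j = 0 := h1 i j hij hm
      rwa [hA i j hij hm, zero_add] at h2
    · ext i j
      exact (add_sub_cancel_left (A.1 i.1 j.1) (M.1 i.1 j.1)).symm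
  · rintro ⟨h1, h2⟩
    refine ⟨fun i j hij hm => ?_, ?_⟩
    · change A.1 i j + M.1 i j = 0
      rw [hA i j hij hm, h1 i j hij hm, add_zero]
    · ext i j
      have h3 : M.1 i.1 j.1 = X i j - A.1 i.1 j.1 := congrFun (congrFun h2 i) j
      change A.1 i.1 j.1 + M.1 i.1 j.1 = X i j
      rw [h3, add_sub_cancel]

theorem IsSkewHermitian.sub {X Y : Matrix (Block p n) (Block p n) K} (hX : IsSkewHermitian F X)
    (hY : IsSkewHermitian F Y) : IsSkewHermitian F (X - Y) := fun a b => by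
  rw [Matrix.sub_apply, Matrix.sub_apply, hX, hY, frob_sub, neg_sub_neg, neg_sub]

variable (F K p) in
/-- There is a Haar measure of `𝕃` whose values on cylinders depend only on the size of the block. -/
theorem exists_haar_measure (hK : Module.finrank F K = 2) :
    ∃ H : Measure (LSpace F K p), H.IsAddHaarMeasure ∧
      ∀ n (X : Matrix (Block p n) (Block p n) K), IsSkewHermitian F X →
        H (cylinder F n X) = ENNReal.ofReal (((Fintype.card F : ℝ) ^ (dim p n).choose 2)⁻¹) := by
  have := finite_of_finrank_eq_two F hK
  -- The case `f = 1`, `u = 0`, with no condition on the blocks.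
  obtain ⟨H, hH⟩ := exists_measure_of_isNullityHarmonic (F := F) (K := K) (p := p) hK one_pos
    (fun _ => zero_le_one) (isNullityHarmonic_one _) (fun _ _ => True) (fun _ _ _ => Iff.rfl)
  simp only [if_true, mul_one, weightConst_zero] at hH
  have hfin : ∀ k, ∀ X : Matrix (Block p k) (Block p k) K, IsSkewHermitian F X →
      H (cylinder F k X) ≠ ⊤ := fun k X hX => by simp [hH k X hX]
  refine ⟨H, ?_, hH⟩
  have h1 : IsFiniteMeasureOnCompacts H := isFiniteMeasureOnCompacts_of_cylinder hfin
  have h2 : H.IsAddLeftInvariant := ⟨fun A => by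
    obtain ⟨l, hl⟩ := A.2.2
    refine (map_eq_of_cylinder l (fun k X => X - corner k A.1)
      (fun k hk X => preimage_add_cylinder (hl.mono hk) X) (fun k _ => hfin k)
      fun k hk X hX => ?_).2
    rw [hH k X hX, hH k _ (hX.sub (isSkewHermitian_corner A))]⟩
  have h3 : H.IsOpenPosMeasure := ⟨fun U hU ⟨M, hM⟩ h0 => by
    obtain ⟨k, -, -, hk⟩ := exists_cylinder_subset hU hM 0
    have h4 := measure_mono_null hk h0
    rw [hH k _ (isSkewHermitian_corner M), ENNReal.ofReal_eq_zero] at h4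
    have hq : (0 : ℝ) < Fintype.card F := by exact_mod_cast Fintype.card_pos
    exact absurd h4 (not_le.2 (by positivity))⟩
  exact {}

theorem measure_cylinder_of_corresponds {P : Measure (LSpace F K p)} {Φ : SymFun →ₗ[ℝ] ℝ}
    (hΦ : ∀ μ, Φ (signedQ (-(Fintype.card F : ℝ)⁻¹) μ) =
      √(1 - (-(Fintype.card F : ℝ)⁻¹) ^ 2) ^ μ.card * (- -(Fintype.card F : ℝ)⁻¹) ^ nStat μ)
    (hP : Corresponds F P Φ) {X : Matrix (Block p n) (Block p n) K} (hX : IsSkewHermitian F X)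
    (hnil : IsNilpotent X) :
    P (cylinder F n X) = ENNReal.ofReal (((Fintype.card F : ℝ) ^ (dim p n).choose 2)⁻¹) := by
  obtain ⟨μ, hμ⟩ := exists_hasJordanType hnil
  -- The values of `Φ_∞` are the case `u = 0`, `f = 1`.
  rw [hP n X μ hX hμ, corresponds_value (u := 0) (f := fun _ => 1) (fun μ => by simp [hΦ]) hμ,
    weightConst_zero, mul_one]

theorem exists_haar_restrict_eq (hK : Module.finrank F K = 2) {P : Measure (LSpace F K p)}
    (hsupp : P (pronilpotent F K p)ᶜ = 0)
    (hP : ∀ n (X : Matrix (Block p n) (Block p n) K), IsSkewHermitian F X → IsNilpotent X →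
      P (cylinder F n X) = ENNReal.ofReal (((Fintype.card F : ℝ) ^ (dim p n).choose 2)⁻¹)) :
    ∃ H : Measure (LSpace F K p), H.IsAddHaarMeasure ∧
      H (cylinder F 0 (0 : Matrix (Block p 0) (Block p 0) K)) = 1 ∧
      P = H.restrict (pronilpotent F K p) := by
  have := finite_of_finrank_eq_two F hK
  obtain ⟨H, hH, hval⟩ := exists_haar_measure F K p hK
  have h0 : IsSkewHermitian F (0 : Matrix (Block p 0) (Block p 0) K) := fun a b => by simp
  refine ⟨H, hH, ?_, measure_ext_of_cylinder 0 (fun k _ X hX => ?_) fun k _ X hX => ?_⟩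
  · rw [hval 0 _ h0]
    -- The initial block has size `0` or `1`, so the binomial coefficient vanishes and the mass is
    -- `1`.
    cases p <;> simp [dim, Parity.toNat]
  · by_cases hnil : IsNilpotent X
    · simp [hP k X hX hnil]
    · simp [measure_cylinder_of_not_isNilpotent hsupp hnil]
  · rw [Measure.restrict_apply (measurableSet_cylinder X)]
    by_cases hnil : IsNilpotent X
    · rw [Set.inter_eq_left.2 (cylinder_subset_pronilpotent hnil), hval k X hX, hP k X hX hnil]
    · rw [cylinder_inter_pronilpotent hnil, measure_empty,
        measure_cylinder_of_not_isNilpotent hsupp hnil]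

end Weights

end

end PronilHL

theorem mainTheorem9 (t : ℝ) (ht : t ∈ Set.Ioo (-1) 0) :
    -- normalization, harmonicity and positivity
    ((∀ m : ℕ, 1 ≤ m → Phi t m (powerSum 2 two_ne_zero) = 1) ∧
      PhiInf t ht (powerSum 2 two_ne_zero) = 1 ∧
      ∀ p : Parity,
        (∀ m : ℕ, 1 ≤ m →
          IsP2Harmonic p (Phi t m).toLinearMap ∧ IsHLPositive p t (Phi t m).toLinearMap) ∧
        IsP2Harmonic p (PhiInf t ht).toLinearMap ∧ IsHLPositive p t (PhiInf t ht).toLinearMap) ∧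
    -- the invariant measures, for `t = -1/q` with `q` odd
    ∀ (F : Type*) [Field F] [Fintype F] (K : Type*) [Field K] [Algebra F K],
      Odd (Fintype.card F) → Module.finrank F K = 2 → t = -(Fintype.card F : ℝ)⁻¹ →
      ∀ p : Parity,
        (∀ m : ℕ, 1 ≤ m → ∃! P : MeasureTheory.Measure (LSpace F K p),
          IsInvariantNilMeasure F P ∧ Corresponds F P (Phi t m).toLinearMap) ∧
        (∃! P : MeasureTheory.Measure (LSpace F K p),
          IsInvariantNilMeasure F P ∧ Corresponds F P (PhiInf t ht).toLinearMap) ∧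
        ∀ P : MeasureTheory.Measure (LSpace F K p),
          IsInvariantNilMeasure F P → Corresponds F P (PhiInf t ht).toLinearMap →
          (∃ H : MeasureTheory.Measure (LSpace F K p), H.IsAddHaarMeasure ∧
            H (cylinder F 0 (0 : Matrix (Block p 0) (Block p 0) K)) = 1 ∧
            P = H.restrict (pronilpotent F K p)) ∧
          ∀ (n : ℕ) (X : Matrix (Block p n) (Block p n) K),
            IsSkewHermitian F X → IsNilpotent X →
            P (cylinder F n X) =
              ENNReal.ofReal (((Fintype.card F : ℝ) ^ (dim p n).choose 2)⁻¹) := by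
  -- For `Φ_m` the parameter `u` is `t^(2m)`.
  have htm : ∀ m, 1 ≤ m → t ^ (2 * m) < 1 := fun m hm =>
    sub_pos.1 (one_sub_pow_pos ht (by omega))
  have htn : (0 : ℝ) ≤ -t := by linarith [ht.2]
  refine ⟨⟨fun m hm => Phi_powerSum_two ht hm, PhiInf_powerSum_two ht, fun p =>
    ⟨fun m hm => ⟨isP2Harmonic_of_algHom p (Phi_powerSum_two ht hm),
      isHLPositive_of_signedQ p fun μ => ?_⟩,
      isP2Harmonic_of_algHom p (PhiInf_powerSum_two ht),
      isHLPositive_of_signedQ p fun μ => ?_⟩⟩, ?_⟩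
  · rw [AlgHom.toLinearMap_apply, Phi_signedQ ht hm]
    have := fallingFactor_nonneg ht m (μ.colLen 0)
    positivity
  · rw [AlgHom.toLinearMap_apply, PhiInf_signedQ ht]
    positivity
  intro F _ _ K _ _ _ hK htF p
  subst htF
  refine ⟨fun m hm => ?_, ?_, fun P hP hPc => ?_⟩
  · exact existsUnique_invariantNilMeasure hK p (htm m hm) (fallingFactor_nonneg ht m)
      (isNullityHarmonic_fallingFactor _ m) (Phi_signedQ ht hm)
  · exact existsUnique_invariantNilMeasure hK p one_pos (fun _ => zero_le_one)
      (isNullityHarmonic_one _) fun μ => by simp [PhiInf_signedQ ht]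
  · have hval : ∀ (n : ℕ) (X : Matrix (Block p n) (Block p n) K), IsSkewHermitian F X →
        IsNilpotent X → P (cylinder F n X) =
          ENNReal.ofReal (((Fintype.card F : ℝ) ^ (dim p n).choose 2)⁻¹) := fun n X hX hnil =>
      measure_cylinder_of_corresponds (PhiInf_signedQ ht) hPc hX hnil
    exact ⟨exists_haar_restrict_eq hK hP.supported hval, hval⟩
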